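/- Let $D,N\ge 0$ be integers and let $A_1,\dots,A_D:\mathbb R^D\to\mathbb C^{N\times N}$ be a (non-Abelian) gauge field: each $A_\mu$ is smooth, takes Hermitian values, and has derivatives of all orders of at most polynomial growth. On $\mathcal S(\mathbb R^D;\mathbb C^N)$ put $\hat p_\mu=-i\partial_\mu$, let $\hat x_\mu$ be multiplication by $x_\mu$, and let $\hat\pi_\mu=\hat p_\mu-A_\mu(\hat x)$. For an operator $T$ on $\mathcal S$, $e^{T}$ is the value at time $1$ of the unique one-parameter group of continuous operators on $\mathcal S$ generated by $T$. (0) The exponentials $e^{-iy\hat\pi/2}$, $e^{iy(\hat\pi-p)/2}$ and $e^{iq(\hat x-x)}$ exist for all $x,p,q,y\in\mathbb R^D$. (1) Let $\hat X$ be an operator with a kernel $\langle x|\hat X|x'\rangle$ in $\mathcal S(\mathbb R^{2D};\mathbb C^{N\times N})$. Then the integral $$X_W(x,p)=\int dy\, e^{ipy}\,\langle x|e^{-\frac i2 y\hat\pi}\,\hat X\,e^{-\frac i2 y\hat\pi}|x\rangle$$ converges absolutely for all $x,p$, $X_W$ is a Schwartz function on $\mathbb R^{2D}$, and $$\hat X=(2\pi)^{-2D}\int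 dq\,dy\,dx\,dp\; e^{\frac i2 y(\hat\pi-p)}\,e^{iq(\hat x-x)}\,X_W(x,p)\,e^{\frac i2 y(\hat\pi-p)},$$ as an absolutely convergent integral of matrix elements between Schwartz functions. The map $\hat X\mapsto X_W$ is a bijection from these operators onto $\mathcal S(\mathbb R^{2D};\mathbb C^{N\times N})$. (2) On kernels, the transform $\hat X\mapsto X_W$ has a unique linear extension to tempered distributions on $\mathbb R^{2D}$ that is continuous for the weak-* topology; this defines $X_W\in\mathcal S'(\mathbb R^{2D};\mathbb C^{N\times N})$ for every continuous operator $\hat X:\mathcal S(\mathbb R^D;\mathbb C^N)\to\mathcal S'(\mathbb R^D;\mathbb C^N)$ whose kernel $\langle x|\hat X|x'\rangle$ is a tempered distribution. The same inversion formula holds for these operators: for matrix elements between Schwartz functions and with a constant matrix unit in the place of $X_W(x,p)$, the integral over $(q,y)$ converges absolutely and is a Schwartz function of $(x,p)$, and the integral over $(x,p)$ is the pairing with the distribution $X_W$. The map $\hat X\mapsto X_W$ is a bijection from these operators onto $\mathcal S'(\mathbb R^{2D};\mathbb C^{N\times N})$. (3) The symbols are in the adjoint representation. Let $\Omega:\mathbb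 R^D\to U(N)$ be smooth with derivatives of at most polynomial growth. If $A_\mu$ is replaced by $\Omega A_\mu\Omega^\dagger+i\,\Omega\,\partial_\mu\Omega^\dagger$ and $\hat X$ by $\Omega(\hat x)\hat X\Omega(\hat x)^\dagger$, then $X_W(x,p)$ is replaced by $\Omega(x)X_W(x,p)\Omega(x)^\dagger$, for the operators of (1) and of (2). -/

import Mathlib

open MeasureTheory SchwartzMap Filter Topology
open scoped ContDiff LineDeriv

noncomputable section

namespace GaugeWeyl

/-! ### Spaces -/

/-- The `D`-dimensional Euclidean space. -/
abbrev Space (D : ℕ) := EuclideanSpace ℝ (Fin D)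

/-- Phase space: the points `(x, p)`.  The same product is used for pairs `(x, x')`, `(q, y)`. -/
abbrev Phase (D : ℕ) := Space D × Space D

/-- The gauge (internal) indices. -/
abbrev Inner (N : ℕ) := EuclideanSpace ℂ (Fin N)

/-- Complex `N × N` matrices, as operators on `ℂ ^ N`. -/
abbrev Mat (N : ℕ) := Inner N →L[ℂ] Inner N

/-- The space of Schwartz wave functions. -/
abbrev Wave (D N : ℕ) := 𝓢(Space D, Inner N)

/-- Continuous linear operators on Schwartz wave functions. -/
abbrev Op (D N : ℕ) := Wave D N →L[ℂ] Wave D N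

/-- Matrix units: `matUnit i j` maps the `j`-th basis vector to the `i`-th one. -/
def matUnit {N : ℕ} (i j : Fin N) : Mat N :=
  (EuclideanSpace.proj (𝕜 := ℂ) j : Inner N →L[ℂ] ℂ).smulRight (EuclideanSpace.single i (1 : ℂ))

/-- The `(i, j)` entry of a matrix. -/
def entry {N : ℕ} (m : Mat N) (i j : Fin N) : ℂ := m (EuclideanSpace.single j (1 : ℂ)) i

/-! ### Exponentials of operators -/

section Exponential

variable {F : Type*} [AddCommGroup F] [Module ℂ F] [TopologicalSpace F]

/-- `V` is a one-parameter group of continuous operators with generator `T`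
(that is, `V s = exp (s T)`). -/
structure IsOneParameterGroup (T : F →L[ℂ] F) (V : ℝ → F →L[ℂ] F) : Prop where
  map_zero : V 0 = ContinuousLinearMap.id ℂ F
  map_add : ∀ s t, V (s + t) = (V s).comp (V t)
  generator : ∀ f, Tendsto (fun s : ℝ => ((s⁻¹ : ℝ) : ℂ) • (V s f - f)) (𝓝[≠] 0) (𝓝 (T f))

/-- `T` generates exactly one one-parameter group. -/
def HasExp (T : F →L[ℂ] F) : Prop := ∃! V : ℝ → F →L[ℂ] F, IsOneParameterGroup T V

open Classical in
/-- The exponential of an operator that generates exactly one one-parameter group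
(and `0` for other operators). -/
def opExp (T : F →L[ℂ] F) : F →L[ℂ] F :=
  if h : HasExp T then h.choose 1 else 0

end Exponential

variable {D N : ℕ}

/-! ### Position, momentum, covariant momentum -/

open Classical in
/-- Multiplication of wave functions by a matrix-valued function of temperate growth
(and `0` for other functions). -/
def mulOp (B : Space D → Mat N) : Op D N :=
  if hB : B.HasTemperateGrowth then
    SchwartzMap.bilinLeftCLM (ContinuousLinearMap.id ℂ (Mat N)).flip hB
  else 0

/-- The position operator. -/
def position (μ : Fin D) : Op D N :=
  SchwartzMap.smulLeftCLM (Inner N) (fun x : Space D => ((x μ : ℝ) : ℂ))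

/-- The momentum operator `p_μ = - i ∂_μ`. -/
def momentum (μ : Fin D) : Op D N :=
  (-Complex.I) • LineDeriv.lineDerivOpCLM ℂ (Wave D N) (EuclideanSpace.single μ (1 : ℝ))

/-- The gauge covariant momentum `π_μ = p_μ - A_μ(x)`. -/
def covMomentum (A : Fin D → Space D → Mat N) (μ : Fin D) : Op D N :=
  momentum μ - mulOp (A μ)

/-- `c · (T - r) = ∑ μ, c_μ (T_μ - r_μ)` for a vector `T` of operators. -/
def dotOp (c : Space D) (T : Fin D → Op D N) (r : Space D) : Op D N :=
  ∑ μ, ((c μ : ℝ) : ℂ) • (T μ - ((r μ : ℝ) : ℂ) • ContinuousLinearMap.id ℂ (Wave D N))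

/-! ### The generalized Wigner transform of operators with a Schwartz kernel -/

/-- `k (x, x')` is the integral kernel `⟨x| X |x'⟩` of the operator `X`. -/
def HasSchwartzKernel (X : Op D N) (k : 𝓢(Phase D, Mat N)) : Prop :=
  ∀ (f : Wave D N) (x : Space D), X f x = ∫ x', k (x, x') (f x')

open Classical in
/-- The matrix element `⟨x| X |x'⟩`. -/
def braket (X : Op D N) (x x' : Space D) : Mat N :=
  if h : ∃ k, HasSchwartzKernel X k then h.choose (x, x') else 0

/-- The operator `exp (- i y·π / 2)`. -/
def wignerExp (A : Fin D → Space D → Mat N) (y : Space D) : Op D N :=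
  opExp (-(Complex.I / 2) • dotOp y (covMomentum A) 0)

/-- The integrand `e^{ipy} ⟨x| e^{-iyπ/2} X e^{-iyπ/2} |x⟩`. -/
def wignerIntegrand (A : Fin D → Space D → Mat N) (X : Op D N) (x p y : Space D) : Mat N :=
  Complex.exp (Complex.I * ((inner ℝ p y : ℝ) : ℂ)) •
    braket ((wignerExp A y).comp (X.comp (wignerExp A y))) x x

/-- The generalized Wigner transform
`X_W(x,p) = ∫ dy e^{ipy} ⟨x| e^{-iyπ/2} X e^{-iyπ/2} |x⟩`. -/
def wignerTransform (A : Fin D → Space D → Mat N) (X : Op D N) (x p : Space D) : Mat N :=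
  ∫ y, wignerIntegrand A X x p y

/-! ### The integrand of the inverse transform -/

/-- The operator `e^{iy(π-p)/2} e^{iq(x̂-x)} m e^{iy(π-p)/2}`, with `m` a constant matrix. -/
def weylIntegrand (A : Fin D → Space D → Mat N) (q y x p : Space D) (m : Mat N) : Op D N :=
  (opExp ((Complex.I / 2) • dotOp y (covMomentum A) p)).comp
    ((opExp (Complex.I • dotOp q position x)).comp
      ((mulOp fun _ => m).comp
        (opExp ((Complex.I / 2) • dotOp y (covMomentum A) p))))

/-- The bilinear pairing `∫ φ(z) f(z) dz` of a scalar test function with a wave function. -/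
def pair (φ : 𝓢(Space D, ℂ)) (f : Wave D N) : Inner N := ∫ z, φ z • f z

/-- The operator `X` on Schwartz space equals, weakly and with an absolutely convergent integral,
`(2π)^{-2D} ∫ dq dy dx dp e^{iy(π-p)/2} e^{iq(x̂-x)} a(x,p) e^{iy(π-p)/2}`. -/
def IsWeylIntegral (A : Fin D → Space D → Mat N) (a : Space D → Space D → Mat N)
    (X : Op D N) : Prop :=
  ∀ (ψ : Wave D N) (φ : 𝓢(Space D, ℂ)),
    Integrable (fun w : Phase D × Phase D =>
      pair φ (weylIntegrand A w.1.1 w.1.2 w.2.1 w.2.2 (a w.2.1 w.2.2) ψ)) ∧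
    pair φ (X ψ) = (((2 * Real.pi) ^ (2 * D))⁻¹ : ℝ) •
      ∫ w : Phase D × Phase D,
        pair φ (weylIntegrand A w.1.1 w.1.2 w.2.1 w.2.2 (a w.2.1 w.2.2) ψ)

/-! ### Operators with a tempered distribution kernel -/

/-- The decay estimate for the tensor product of two Schwartz functions. -/
theorem tensor_decay (φ g : 𝓢(Space D, ℂ)) (k n : ℕ) :
    ∃ C, ∀ z : Phase D, ‖z‖ ^ k * ‖iteratedFDeriv ℝ n (fun z => φ z.1 * g z.2) z‖ ≤ C := by
  have hφ : ContDiff ℝ ∞ (fun z : Phase D => φ z.1) := (φ.smooth ⊤).comp contDiff_fst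
  have hg : ContDiff ℝ ∞ (fun z : Phase D => g z.2) := (g.smooth ⊤).comp contDiff_snd
  have key : ∀ (f : 𝓢(Space D, ℂ)) (L : Phase D →L[ℝ] Space D), ‖L‖ ≤ 1 → ∀ (i : ℕ) (z : Phase D),
      ‖iteratedFDeriv ℝ i (fun z : Phase D => f (L z)) z‖ ≤ ‖iteratedFDeriv ℝ i f (L z)‖ := by
    intro f L hL i z
    have h := L.iteratedFDeriv_comp_right (f.smooth ⊤) z (i := i) (mod_cast le_top)
    have h2 := ContinuousMultilinearMap.norm_compContinuousLinearMap_le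
      (iteratedFDeriv ℝ i f (L z)) (fun _ => L)
    rw [← h] at h2
    refine h2.trans ?_
    rw [Finset.prod_const]
    exact mul_le_of_le_one_right (norm_nonneg _) (pow_le_one₀ (norm_nonneg _) hL)
  choose P hP using fun m i => φ.decay' m i
  choose Q hQ using fun m i => g.decay' m i
  refine ⟨∑ i ∈ Finset.range (n + 1), (n.choose i : ℝ) *
    (P k i * Q 0 (n - i) + P 0 i * Q k (n - i)), fun z => ?_⟩
  have hmul := norm_iteratedFDeriv_mul_le (𝕜 := ℝ) hφ hg z (n := n) (mod_cast le_top)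
  refine (mul_le_mul_of_nonneg_left hmul (by positivity)).trans ?_
  rw [Finset.mul_sum]
  refine Finset.sum_le_sum fun i _ => ?_
  have h1 := key φ (ContinuousLinearMap.fst ℝ _ _) (ContinuousLinearMap.norm_fst_le ..) i z
  have h2 := key g (ContinuousLinearMap.snd ℝ _ _) (ContinuousLinearMap.norm_snd_le ..) (n - i) z
  simp only [ContinuousLinearMap.coe_fst', ContinuousLinearMap.coe_snd'] at h1 h2
  have p1 : ‖z.1‖ ^ k * ‖iteratedFDeriv ℝ i φ z.1‖ ≤ P k i := hP k i z.1
  have p0 : ‖iteratedFDeriv ℝ i φ z.1‖ ≤ P 0 i := by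
    have := hP 0 i z.1
    rwa [pow_zero, one_mul] at this
  have q1 : ‖z.2‖ ^ k * ‖iteratedFDeriv ℝ (n - i) g z.2‖ ≤ Q k (n - i) := hQ k (n - i) z.2
  have q0 : ‖iteratedFDeriv ℝ (n - i) g z.2‖ ≤ Q 0 (n - i) := by
    have := hQ 0 (n - i) z.2
    rwa [pow_zero, one_mul] at this
  have hz : ‖z‖ ^ k ≤ ‖z.1‖ ^ k + ‖z.2‖ ^ k := by
    rw [Prod.norm_def]
    rcases max_cases ‖z.1‖ ‖z.2‖ with h | h <;> rw [h.1] <;>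
      linarith [pow_nonneg (norm_nonneg z.1) k, pow_nonneg (norm_nonneg z.2) k]
  set a := ‖iteratedFDeriv ℝ i φ z.1‖
  set b := ‖iteratedFDeriv ℝ (n - i) g z.2‖
  have ha : 0 ≤ a := norm_nonneg _
  have hb : 0 ≤ b := norm_nonneg _
  calc _ ≤ (‖z.1‖ ^ k + ‖z.2‖ ^ k) * ((n.choose i : ℝ) * a * b) := by
        gcongr
    _ = (n.choose i : ℝ) * ((‖z.1‖ ^ k * a) * b + a * (‖z.2‖ ^ k * b)) := by ring
    _ ≤ _ := by
        have hk1 : 0 ≤ ‖z.1‖ ^ k * a := by positivity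
        have hk2 : 0 ≤ ‖z.2‖ ^ k * b := by positivity
        have hP1 : 0 ≤ P k i := hk1.trans p1
        have hP0 : 0 ≤ P 0 i := ha.trans p0
        gcongr

/-- The tensor product `(φ ⊗ g)(x, x') = φ(x) g(x')` of Schwartz functions. -/
def tensor (φ g : 𝓢(Space D, ℂ)) : 𝓢(Phase D, ℂ) where
  toFun z := φ z.1 * g z.2
  smooth' := ((φ.smooth ⊤).comp contDiff_fst).mul ((g.smooth ⊤).comp contDiff_snd)
  decay' := tensor_decay φ g

/-- The wave function `g ⊗ v`. -/
def vecWave (g : 𝓢(Space D, ℂ)) (v : Inner N) : Wave D N :=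
  SchwartzMap.postcompCLM ((ContinuousLinearMap.id ℂ ℂ).smulRight v) g

/-- The operator `X` from Schwartz functions to tempered distributions has the kernel
`K(x, x') = ⟨x| X |x'⟩`. -/
def HasTemperedKernel (X : Wave D N →L[ℂ] 𝓢'(Space D, Inner N)) (K : 𝓢'(Phase D, Mat N)) : Prop :=
  ∀ (φ g : 𝓢(Space D, ℂ)) (v : Inner N), X (vecWave g v) φ = K (tensor φ g) v

/-- Operators whose matrix elements `⟨x| X |x'⟩` form a tempered distribution. -/
abbrev TemperedOperator (D N : ℕ) :=
  {X : Wave D N →L[ℂ] 𝓢'(Space D, Inner N) // ∃ K : 𝓢'(Phase D, Mat N), HasTemperedKernel X K}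

/-- The kernel of an operator with a tempered kernel. -/
def TemperedOperator.kernel (X : TemperedOperator D N) : 𝓢'(Phase D, Mat N) := X.2.choose

instance : (volume : Measure (Phase D)).HasTemperateGrowth := by
  have : (volume : Measure (Phase D)).IsAddHaarMeasure :=
    inferInstanceAs
      ((volume : Measure (Space D)).prod (volume : Measure (Space D))).IsAddHaarMeasure
  infer_instance

/-- `W` is a weakly continuous linear map from tempered kernels to tempered symbols, given on
operators with a Schwartz kernel by the integral formula of the Wigner transform. -/
def ExtendsWigner (A : Fin D → Space D → Mat N)
    (W : 𝓢'(Phase D, Mat N) →L[ℂ] 𝓢'(Phase D, Mat N)) : Prop :=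
  ∀ (X : Op D N) (k : 𝓢(Phase D, Mat N)), HasSchwartzKernel X k →
    ∀ φ : 𝓢(Phase D, ℂ),
      W (SchwartzMap.toTemperedDistributionCLM (Phase D) (Mat N) volume k) φ =
        ∫ w : Phase D, φ w • wignerTransform A X w.1 w.2

open Classical in
/-- The unique weakly continuous extension of the Wigner transform to tempered kernels. -/
def wignerExtension (A : Fin D → Space D → Mat N) :
    𝓢'(Phase D, Mat N) →L[ℂ] 𝓢'(Phase D, Mat N) :=
  if h : ∃! W, ExtendsWigner A W then h.choose else 0

/-- The generalized Weyl symbol of an operator with a tempered kernel. -/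
def weylSymbol (A : Fin D → Space D → Mat N) (X : TemperedOperator D N) : 𝓢'(Phase D, Mat N) :=
  wignerExtension A X.kernel

/-- The operator `X` from Schwartz functions to tempered distributions equals
`(2π)^{-2D} ∫ dq dy dx dp e^{iy(π-p)/2} e^{iq(x̂-x)} T(x,p) e^{iy(π-p)/2}` for the tempered
symbol `T`: in matrix elements the integral over `(q, y)` converges absolutely for every matrix
unit inserted in place of `T(x,p)`, gives a Schwartz function of `(x, p)`, and the integral over
`(x, p)` is the pairing of that function with the distribution `T`. -/
def IsTemperedWeylIntegral (A : Fin D → Space D → Mat N) (T : 𝓢'(Phase D, Mat N))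
    (X : Wave D N →L[ℂ] 𝓢'(Space D, Inner N)) : Prop :=
  ∀ (ψ : Wave D N) (φ : 𝓢(Space D, ℂ)) (l : Fin N),
    ∃ g : Fin N → Fin N → 𝓢(Phase D, ℂ),
      (∀ i j x p,
        Integrable (fun w : Phase D => pair φ (weylIntegrand A w.1 w.2 x p (matUnit i j) ψ)) ∧
        g i j (x, p) = (((2 * Real.pi) ^ (2 * D))⁻¹ : ℝ) *
          (∫ w : Phase D, pair φ (weylIntegrand A w.1 w.2 x p (matUnit i j) ψ)) l) ∧
      X ψ φ l = ∑ i, ∑ j, entry (T (g i j)) i j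

/-! ### Gauge transformations -/

/-- A smooth gauge transformation, of temperate growth. -/
structure IsGauge (Ω : Space D → Mat N) : Prop where
  temperate : Ω.HasTemperateGrowth
  unitary : ∀ x, Ω x ∈ unitary (Mat N)

/-- The transformed gauge field `Ω A_μ Ω† + i Ω ∂_μ Ω†`, for which
`∂_μ - i A'_μ = Ω (∂_μ - i A_μ) Ω†`. -/
def gaugeField (Ω : Space D → Mat N) (A : Fin D → Space D → Mat N) (μ : Fin D) (x : Space D) :
    Mat N :=
  Ω x * A μ x * star (Ω x) +
    Complex.I • (Ω x * fderiv ℝ (fun z => star (Ω z)) x (EuclideanSpace.single μ (1 : ℝ)))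

/-- The value at `φ` of the product `Ω T` of a matrix function and a vector-valued distribution. -/
def distMul (Ω : Space D → Mat N) (T : 𝓢'(Space D, Inner N)) (φ : 𝓢(Space D, ℂ)) : Inner N :=
  ∑ i, ∑ j, matUnit i j (T (SchwartzMap.smulLeftCLM ℂ (fun x => entry (Ω x) i j) φ))

/-- The value at `φ` of the phase space distribution `Ω(x) T(x,p) Ω(x)†`. -/
def adjointAction (Ω : Space D → Mat N) (T : 𝓢'(Phase D, Mat N)) (φ : 𝓢(Phase D, ℂ)) : Mat N :=
  ∑ i, ∑ j, ∑ k, ∑ l, matUnit i j *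
    T (SchwartzMap.smulLeftCLM ℂ
      (fun w : Phase D => entry (Ω w.1) i j * entry (star (Ω w.1)) k l) φ) * matUnit k l

end GaugeWeyl

end

/-!
The exponential of `i c·(π - p)` is explicit: it is the translation by `c`, followed by the
parallel transport of the gauge field along the segment from `z + c` to `z` and by the phase
`e^{-ic·p}`. The transport solves a linear differential equation along the line, it is unitary and
it is multiplicative along the line; so these operators form a one-parameter group on Schwartz
space (`hasExp_of_cocycle`, `hasExp_dotOp_covMomentum`). The group is the only one with its
generator because it is isometric for the `L²` norm: its generator is antisymmetric, and the `L²`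
distance of two orbits is constant.

If `k` is the kernel of `X`, the integrand of the Wigner transform at `(u, p)` is therefore
`e^{ip·y} U(u, u - y/2) k(u - y/2, u + y/2) U(u + y/2, u)`, with transports `U`. So the map from
kernels to symbols is a linear change of variables (`midEquiv`), then a multiplication by unitary
matrix functions (`sandwichCLM`), then a partial Fourier transform (`phaseIntegral`). Each of the
three is an automorphism of Schwartz space, which gives the bijection `wignerCLM` with the inverse
`wignerInvCLM`. The multiplication preserves Schwartz space because the transport is smooth with
derivatives of polynomial growth (`hasTemperateGrowth_transport`): Duhamel's formula writes its
derivative as an integral of products of transports and derivatives of the gauge field, so that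
regularity bootstraps, and unitarity supplies the bound at order zero.

For the inversion, a matrix element of the Weyl integrand is a phase times the Fourier transform, in
the midpoint, of a Schwartz function built from the test functions and the inverse transports
(`pair_weylIntegrand`). Fourier inversion in one variable and Parseval's formula in the other
evaluate the integral; the transports cancel those in the symbol (`integral_weylTheta_apply`), and
the matrix element of `X` remains (`isWeylIntegral`).

For tempered distributions, the three steps are replaced by their transposes (`wignerDist`). These
are weakly continuous, and Schwartz functions are weakly dense (`dense_schwartz`), so every identity
extends, and so does the uniqueness of the extension. A tempered kernel is determined by its
operator because tensor products of Schwartz functions are dense (`eq_zero_of_tensor`), and every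
tempered distribution is a kernel (`kernelDistOp`).

A gauge transformation conjugates a transport by the values of `Ω` at its two end points
(`transport_gauge`). In the symbol, the values at `u ± y/2` cancel those in the transformed kernel,
and only the values at the midpoint remain (`wignerCLM_gaugeKernel`).
-/

open MeasureTheory SchwartzMap Filter Topology
open scoped ContDiff LineDeriv

noncomputable section

namespace GaugeWeyl

set_option linter.unusedSectionVars false

/-! ### Functions of temperate growth up to a finite order -/


section TemperateUpTo

variable {E E' F G H : Type}
  [NormedAddCommGroup E] [NormedSpace ℝ E] [NormedAddCommGroup E'] [NormedSpace ℝ E']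
  [NormedAddCommGroup F] [NormedSpace ℝ F] [NormedAddCommGroup G] [NormedSpace ℝ G]
  [NormedAddCommGroup H] [NormedSpace ℝ H]

/-- The function `f` is bounded by a polynomial in the norm. -/
def PolyBounded (f : E → F) : Prop := ∃ (k : ℕ) (C : ℝ), ∀ x, ‖f x‖ ≤ C * (1 + ‖x‖) ^ k

theorem PolyBounded.nonneg {f : E → F} (hf : PolyBounded f) :
    ∃ (k : ℕ) (C : ℝ), 0 ≤ C ∧ ∀ x, ‖f x‖ ≤ C * (1 + ‖x‖) ^ k := by
  obtain ⟨k, C, h⟩ := hf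
  refine ⟨k, C, ?_, h⟩
  have := (norm_nonneg _).trans (h 0)
  simpa using this

theorem PolyBounded.add {f g : E → F} (hf : PolyBounded f) (hg : PolyBounded g) :
    PolyBounded (fun x => f x + g x) := by
  obtain ⟨k, C, hC, h⟩ := hf.nonneg
  obtain ⟨l, C', hC', h'⟩ := hg.nonneg
  refine ⟨k + l, C + C', fun x => (norm_add_le _ _).trans ?_⟩
  rw [add_mul]
  have h1 : (1 : ℝ) ≤ 1 + ‖x‖ := by simp
  refine add_le_add ((h x).trans ?_) ((h' x).trans ?_) <;> gcongr <;> omega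

theorem PolyBounded.bilin (B : F →L[ℝ] G →L[ℝ] H) {f : E → F} {g : E → G}
    (hf : PolyBounded f) (hg : PolyBounded g) : PolyBounded (fun x => B (f x) (g x)) := by
  obtain ⟨k, C, hC, h⟩ := hf.nonneg
  obtain ⟨l, C', hC', h'⟩ := hg.nonneg
  refine ⟨k + l, ‖B‖ * C * C', fun x => (B.le_opNorm₂ _ _).trans ?_⟩
  calc ‖B‖ * ‖f x‖ * ‖g x‖ ≤ ‖B‖ * (C * (1 + ‖x‖) ^ k) * (C' * (1 + ‖x‖) ^ l) := by
        gcongr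
        · exact h x
        · exact h' x
    _ = _ := by rw [pow_add]; ring

theorem PolyBounded.comp {f : E → F} {g : E' → E} (hf : PolyBounded f) (hg : PolyBounded g) :
    PolyBounded (fun x => f (g x)) := by
  obtain ⟨k, C, hC, h⟩ := hf.nonneg
  obtain ⟨l, C', hC', h'⟩ := hg.nonneg
  refine ⟨l * k, C * (1 + C') ^ k, fun x => (h _).trans ?_⟩
  rw [mul_assoc, pow_mul, ← mul_pow]
  have h1 : (1 : ℝ) ≤ (1 + ‖x‖) ^ l := one_le_pow₀ (by simp)
  gcongr
  have := h' x
  rw [add_mul]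
  linarith

/-- Temperate growth of a function and of its derivatives up to the order `n`. The recursion on the
derivative, rather than a bound on the iterated derivatives, is what makes bootstrapping from a
differential equation convenient. -/
def TemperateUpTo : ℕ → ∀ {F : Type} [NormedAddCommGroup F] [NormedSpace ℝ F], (E → F) → Prop
  | 0, _, _, _, f => Continuous f ∧ PolyBounded f
  | n + 1, _, _, _, f => PolyBounded f ∧ Differentiable ℝ f ∧ TemperateUpTo n (fderiv ℝ f)

theorem TemperateUpTo.polyBounded {n : ℕ} {f : E → F} (hf : TemperateUpTo n f) :
    PolyBounded f := by
  cases n with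
  | zero => exact hf.2
  | succ n => exact hf.1

theorem TemperateUpTo.continuous {n : ℕ} {f : E → F} (hf : TemperateUpTo n f) :
    Continuous f := by
  cases n with
  | zero => exact hf.1
  | succ n => exact hf.2.1.continuous

theorem TemperateUpTo.of_hasFDerivAt {n : ℕ} {f : E → F} {f' : E → E →L[ℝ] F}
    (hb : PolyBounded f) (hd : ∀ x, HasFDerivAt f (f' x) x) (h : TemperateUpTo n f') :
    TemperateUpTo (n + 1) f := by
  have : fderiv ℝ f = f' := funext fun x => (hd x).fderiv
  exact ⟨hb, fun x => (hd x).differentiableAt, this ▸ h⟩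

theorem TemperateUpTo.of_succ {n : ℕ} {F : Type} [NormedAddCommGroup F] [NormedSpace ℝ F]
    {f : E → F} (hf : TemperateUpTo (n + 1) f) : TemperateUpTo n f := by
  induction n generalizing F with
  | zero => exact ⟨hf.continuous, hf.polyBounded⟩
  | succ n ih => exact ⟨hf.1, hf.2.1, ih hf.2.2⟩

theorem TemperateUpTo.hasTemperateGrowth {f : E → F} (hf : ∀ n, TemperateUpTo n f) :
    f.HasTemperateGrowth := by
  have key : ∀ (n : ℕ) (F : Type) [NormedAddCommGroup F] [NormedSpace ℝ F] (f : E → F),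
      TemperateUpTo n f → ContDiff ℝ n f ∧ PolyBounded (iteratedFDeriv ℝ n f) := by
    intro n
    induction n with
    | zero =>
      intro F _ _ f hf
      refine ⟨contDiff_zero.2 hf.1, ?_⟩
      obtain ⟨k, C, h⟩ := hf.2
      exact ⟨k, C, fun x => by simpa using h x⟩
    | succ n ih =>
      intro F _ _ f hf
      obtain ⟨h1, k, C, h2⟩ := ih _ _ hf.2.2
      refine ⟨?_, k, C, fun x => ?_⟩
      · rw [Nat.cast_succ]
        exact contDiff_succ_iff_fderiv.2 ⟨hf.2.1, by simp, h1⟩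
      · rw [← norm_iteratedFDeriv_fderiv]
        exact h2 x
  exact ⟨contDiff_infty.2 fun n => (key n F f (hf n)).1, fun n => (key n F f (hf n)).2⟩

theorem HasTemperateGrowth.fderiv {f : E → F} (hf : f.HasTemperateGrowth) :
    (fderiv ℝ f).HasTemperateGrowth := by
  refine ⟨hf.1.fderiv_right (m := ∞) (by simp), fun n => ?_⟩
  obtain ⟨k, C, h⟩ := hf.2 (n + 1)
  exact ⟨k, C, fun x => by rw [norm_iteratedFDeriv_fderiv]; exact h x⟩

theorem HasTemperateGrowth.polyBounded {f : E → F} (hf : f.HasTemperateGrowth) :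
    PolyBounded f := by
  obtain ⟨k, C, h⟩ := hf.2 0
  exact ⟨k, C, fun x => by simpa using h x⟩

theorem HasTemperateGrowth.temperateUpTo (n : ℕ) {F : Type} [NormedAddCommGroup F]
    [NormedSpace ℝ F] {f : E → F} (hf : f.HasTemperateGrowth) : TemperateUpTo n f := by
  induction n generalizing F with
  | zero => exact ⟨hf.1.continuous, HasTemperateGrowth.polyBounded hf⟩
  | succ n ih =>
    exact ⟨HasTemperateGrowth.polyBounded hf, hf.1.differentiable (by simp),
      ih (HasTemperateGrowth.fderiv hf)⟩

theorem HasTemperateGrowth.prodMk {f : E → F} {g : E → G} (hf : f.HasTemperateGrowth)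
    (hg : g.HasTemperateGrowth) : (fun x => (f x, g x)).HasTemperateGrowth := by
  have := ((ContinuousLinearMap.inl ℝ F G).hasTemperateGrowth.comp hf).add
    ((ContinuousLinearMap.inr ℝ F G).hasTemperateGrowth.comp hg)
  convert! this using 2 with x
  simp

theorem TemperateUpTo.add {n : ℕ} {F : Type} [NormedAddCommGroup F] [NormedSpace ℝ F]
    {f g : E → F} (hf : TemperateUpTo n f) (hg : TemperateUpTo n g) :
    TemperateUpTo n (fun x => f x + g x) := by
  induction n generalizing F with
  | zero => exact ⟨hf.1.add hg.1, hf.2.add hg.2⟩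
  | succ n ih =>
    exact .of_hasFDerivAt (hf.1.add hg.1)
      (fun x => (hf.2.1 x).hasFDerivAt.add (hg.2.1 x).hasFDerivAt) (ih hf.2.2 hg.2.2)

/-- Leibniz' rule for a continuous bilinear map. -/
theorem TemperateUpTo.bilin {n : ℕ} {F G H : Type}
    [NormedAddCommGroup F] [NormedSpace ℝ F] [NormedAddCommGroup G] [NormedSpace ℝ G]
    [NormedAddCommGroup H] [NormedSpace ℝ H] (B : F →L[ℝ] G →L[ℝ] H) {f : E → F} {g : E → G}
    (hf : TemperateUpTo n f) (hg : TemperateUpTo n g) :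
    TemperateUpTo n (fun x => B (f x) (g x)) := by
  induction n generalizing F G H with
  | zero => exact ⟨(B.continuous.comp hf.1).clm_apply hg.1, hf.2.bilin B hg.2⟩
  | succ n ih =>
    refine .of_hasFDerivAt (hf.1.bilin B hg.1)
      (fun x => B.hasFDerivAt_of_bilinear (hf.2.1 x).hasFDerivAt (hg.2.1 x).hasFDerivAt) ?_
    exact (ih (B.precompR E) hf.of_succ hg.2.2).add (ih (B.precompL E) hf.2.2 hg.of_succ)

theorem TemperateUpTo.postcomp {n : ℕ} (L : F →L[ℝ] G) {f : E → F} (hf : TemperateUpTo n f) :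
    TemperateUpTo n (fun x => L (f x)) :=
  TemperateUpTo.bilin (ContinuousLinearMap.apply ℝ G).flip
    (HasTemperateGrowth.temperateUpTo n (Function.HasTemperateGrowth.const L)) hf

theorem TemperateUpTo.comp {n : ℕ} {F : Type} [NormedAddCommGroup F] [NormedSpace ℝ F]
    {f : E → F} {g : E' → E} (hf : TemperateUpTo n f) (hg : g.HasTemperateGrowth) :
    TemperateUpTo n (fun x => f (g x)) := by
  induction n generalizing F with
  | zero =>
    exact ⟨hf.1.comp hg.1.continuous, hf.2.comp (HasTemperateGrowth.polyBounded hg)⟩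
  | succ n ih =>
    refine .of_hasFDerivAt (hf.1.comp (HasTemperateGrowth.polyBounded hg))
      (fun x => (hf.2.1 (g x)).hasFDerivAt.comp x (hg.1.differentiable (by simp) x).hasFDerivAt) ?_
    exact TemperateUpTo.bilin (ContinuousLinearMap.compL ℝ E' E F) (ih hf.2.2)
      (HasTemperateGrowth.temperateUpTo n (HasTemperateGrowth.fderiv hg))

/-- A polynomial bound on `ℝ × E` is uniform for parameters in the unit interval. -/
theorem PolyBounded.of_mem_Ioc {f : ℝ × E → F} (hf : PolyBounded f) :
    ∃ (k : ℕ) (C : ℝ), 0 ≤ C ∧ ∀ s ∈ Set.Ioc (0 : ℝ) 1, ∀ z, ‖f (s, z)‖ ≤ C * (1 + ‖z‖) ^ k := by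
  obtain ⟨k, C, hC, h⟩ := hf.nonneg
  refine ⟨k, C * 2 ^ k, by positivity, fun s hs z => (h _).trans ?_⟩
  rw [mul_assoc, ← mul_pow]
  gcongr
  have : ‖((s, z) : ℝ × E)‖ ≤ 1 + ‖z‖ := by
    rw [Prod.norm_def]
    refine max_le ?_ (by simp)
    rw [Real.norm_of_nonneg hs.1.le]
    linarith [hs.2, norm_nonneg z]
  linarith [norm_nonneg z]

theorem PolyBounded.exists_bound_ball {f : ℝ × E → F} (hf : PolyBounded f) (z₀ : E) :
    ∃ M : ℝ, ∀ s ∈ Set.Ioc (0 : ℝ) 1, ∀ z ∈ Metric.ball z₀ 1, ‖f (s, z)‖ ≤ M := by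
  obtain ⟨k, C, hC, h⟩ := hf.of_mem_Ioc
  refine ⟨C * (1 + (‖z₀‖ + 1)) ^ k, fun s hs z hz => (h s hs z).trans ?_⟩
  have : ‖z‖ ≤ ‖z₀‖ + 1 := by
    have := norm_le_norm_add_norm_sub' z z₀
    rw [mem_ball_iff_norm] at hz
    linarith
  gcongr

theorem integrableOn_Ioc_of_continuous {f : ℝ → F} (hf : Continuous f) :
    IntegrableOn f (Set.Ioc (0 : ℝ) 1) :=
  hf.integrableOn_Icc.mono_set Set.Ioc_subset_Icc_self

/-- Integration over the unit interval preserves temperate growth. -/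
theorem TemperateUpTo.integral {n : ℕ} {F : Type} [NormedAddCommGroup F] [NormedSpace ℝ F]
    {f : ℝ × E → F} (hf : TemperateUpTo n f) :
    TemperateUpTo n (fun z => ∫ s in Set.Ioc (0 : ℝ) 1, f (s, z)) := by
  have pb : ∀ {F : Type} [NormedAddCommGroup F] [NormedSpace ℝ F] {f : ℝ × E → F},
      PolyBounded f → PolyBounded (fun z => ∫ s in Set.Ioc (0 : ℝ) 1, f (s, z)) := by
    intro F _ _ f hf
    obtain ⟨k, C, -, h⟩ := hf.of_mem_Ioc
    refine ⟨k, C, fun z => ?_⟩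
    refine (norm_setIntegral_le_of_norm_le_const (by simp) fun s hs => h s hs z).trans ?_
    simp
  induction n generalizing F with
  | zero =>
    refine ⟨continuous_iff_continuousAt.2 fun z₀ => ?_, pb hf.2⟩
    obtain ⟨M, hM⟩ := hf.2.exists_bound_ball z₀
    refine continuousAt_of_dominated (bound := fun _ => M) ?_ ?_ (integrable_const M) ?_
    · exact .of_forall fun z => (hf.1.comp (Continuous.prodMk_left z)).aestronglyMeasurable
    · filter_upwards [Metric.ball_mem_nhds z₀ one_pos] with z hz
      filter_upwards [ae_restrict_mem measurableSet_Ioc] with s hs using hM s hs z hz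
    · exact .of_forall fun s => (hf.1.comp (Continuous.prodMk_right s)).continuousAt
  | succ n ih =>
    have hbil := TemperateUpTo.bilin (ContinuousLinearMap.compL ℝ E (ℝ × E) F) hf.2.2
      (HasTemperateGrowth.temperateUpTo n
        (Function.HasTemperateGrowth.const (ContinuousLinearMap.inr ℝ ℝ E)))
    refine .of_hasFDerivAt (pb hf.1) (fun z₀ => ?_) (ih hbil)
    obtain ⟨M, hM⟩ := hbil.polyBounded.exists_bound_ball z₀
    refine hasFDerivAt_integral_of_dominated_of_fderiv_le (bound := fun _ => M)
      (F' := fun z s => (fderiv ℝ f (s, z)).comp (ContinuousLinearMap.inr ℝ ℝ E))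
      (Metric.ball_mem_nhds z₀ one_pos) ?_ ?_ ?_
      (by filter_upwards [ae_restrict_mem measurableSet_Ioc] with s hs using hM s hs)
      (integrable_const M) ?_
    · exact .of_forall fun z => (hf.continuous.comp (Continuous.prodMk_left z)).aestronglyMeasurable
    · exact integrableOn_Ioc_of_continuous (hf.continuous.comp (Continuous.prodMk_left z₀))
    · exact (hbil.continuous.comp (Continuous.prodMk_left z₀)).aestronglyMeasurable
    · exact .of_forall fun s z _ => (hf.2.1 (s, z)).hasFDerivAt.comp z (hasFDerivAt_prodMk_right s z)

/-- The exponential `exp (i f)` of a real function of temperate growth is of temperate growth. -/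
theorem hasTemperateGrowth_cexp {f : E → ℝ} (hf : f.HasTemperateGrowth) :
    (fun x => Complex.exp (Complex.I * (f x : ℂ))).HasTemperateGrowth := by
  have hb : PolyBounded (fun x => Complex.exp (Complex.I * (f x : ℂ))) :=
    ⟨0, 1, fun x => by simp [Complex.norm_exp]⟩
  have hd : ∀ x, HasFDerivAt (fun x => Complex.exp (Complex.I * (f x : ℂ)))
      (((ContinuousLinearMap.mul ℝ ℂ).flip (Complex.I * Complex.exp (Complex.I * (f x : ℂ)))).comp
        (Complex.ofRealCLM.comp (fderiv ℝ f x))) x := by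
    intro x
    have h1 := (hf.1.differentiable (by simp) x).hasFDerivAt
    have h2 := ((Complex.ofRealCLM.hasFDerivAt.comp x h1).const_mul Complex.I).cexp
    convert! h2 using 1
    ext v
    simp
    ring
  have key : ∀ n, TemperateUpTo n (fun x => Complex.exp (Complex.I * (f x : ℂ))) := by
    intro n
    induction n with
    | zero => exact ⟨(by have := hf.1.continuous; fun_prop), hb⟩
    | succ n ih =>
      refine .of_hasFDerivAt hb hd ?_
      refine TemperateUpTo.bilin (ContinuousLinearMap.compL ℝ E ℂ ℂ) ?_ ?_
      · exact ((ih.postcomp (ContinuousLinearMap.mul ℝ ℂ Complex.I)).postcomp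
          (ContinuousLinearMap.mul ℝ ℂ).flip)
      · exact (HasTemperateGrowth.temperateUpTo n (HasTemperateGrowth.fderiv hf)).postcomp
          (ContinuousLinearMap.compL ℝ E ℝ ℂ Complex.ofRealCLM)
  exact TemperateUpTo.hasTemperateGrowth key

end TemperateUpTo

/-! ### Linear differential equations with anti-Hermitian coefficients -/

section LinearODE

variable {𝔸 : Type} [CStarAlgebra 𝔸] [FiniteDimensional ℝ 𝔸] [IsDedekindFiniteMonoid 𝔸]

theorem norm_le_one_of_mul_star {a : 𝔸} (h : a * star a = 1) : ‖a‖ ≤ 1 := by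
  have h1 : ‖a‖ * ‖a‖ ≤ 1 := by
    rw [← CStarRing.norm_self_mul_star, h]
    rcases subsingleton_or_nontrivial 𝔸 with _ | _
    · simp [Subsingleton.elim (1 : 𝔸) 0]
    · simp
  nlinarith [norm_nonneg a]

/-- The product `M K†` is conserved for two solutions of `M' = M B` with `B` anti-Hermitian. -/
theorem mul_star_eq_one_of_ode {B : ℝ → 𝔸} (hB : ∀ t, star (B t) = -B t) {T : ℝ} (hT : 0 < T)
    {M K : ℝ → 𝔸} {c : ℝ → ℝ} (hM : ∀ t ∈ Set.Ioo (-T) T, HasDerivAt M (c t • (M t * B t)) t)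
    (hK : ∀ t ∈ Set.Ioo (-T) T, HasDerivAt K (c t • (K t * B t)) t) (hM0 : M 0 = 1) (hK0 : K 0 = 1)
    {t : ℝ} (ht : t ∈ Set.Ioo (-T) T) : M t * star (K t) = 1 := by
  have hd : ∀ t ∈ Set.Ioo (-T) T, HasDerivAt (fun t => M t * star (K t)) 0 t := by
    intro t ht
    convert! (hM t ht).mul (hK t ht).star using 1
    rw [star_smul, star_mul, hB]
    simp [mul_assoc]
  have := isOpen_Ioo.is_const_of_deriv_eq_zero isPreconnected_Ioo
    (fun t ht => (hd t ht).differentiableAt.differentiableWithinAt) (fun t ht => (hd t ht).deriv) ht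
    (show (0 : ℝ) ∈ Set.Ioo (-T) T from ⟨by linarith, hT⟩)
  simpa [hM0, hK0] using this

/-- Solutions of `M' = M B` with `B` anti-Hermitian are unique: `M = M (K† K) = (M K†) K = K`.
No Lipschitz bound on the coefficients is needed. -/
theorem eq_of_ode {B : ℝ → 𝔸} (hB : ∀ t, star (B t) = -B t) {T : ℝ} (hT : 0 < T)
    {M K : ℝ → 𝔸} (hM : ∀ t ∈ Set.Ioo (-T) T, HasDerivAt M (M t * B t) t)
    (hK : ∀ t ∈ Set.Ioo (-T) T, HasDerivAt K (K t * B t) t) (hM0 : M 0 = 1) (hK0 : K 0 = 1)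
    {t : ℝ} (ht : t ∈ Set.Ioo (-T) T) : M t = K t := by
  have h1 := mul_star_eq_one_of_ode hB hT (c := fun _ => 1) (by simpa using hM) (by simpa using hK)
    hM0 hK0 ht
  have h2 := mul_star_eq_one_of_ode hB hT (c := fun _ => 1) (by simpa using hK) (by simpa using hK)
    hK0 hK0 ht
  calc M t = M t * (star (K t) * K t) := by rw [mul_eq_one_comm.1 h2, mul_one]
    _ = K t := by rw [← mul_assoc, h1, one_mul]

/-- Solutions exist on every bounded interval. The Picard-Lindelöf theorem is applied to the field
`g(M) B(t)` with `g` smooth, bounded, and equal to the identity near the unit ball; the solutions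
stay unitary, so the cutoff is never felt. -/
theorem exists_ode_Ioo {B : ℝ → 𝔸} (hBc : Continuous B) (hB : ∀ t, star (B t) = -B t)
    {T : ℝ} (hT : 0 < T) :
    ∃ M : ℝ → 𝔸, M 0 = 1 ∧ ∀ t ∈ Set.Ioo (-T) T, HasDerivAt M (M t * B t) t := by
  let φ : ContDiffBump (0 : 𝔸) := ⟨2, 3, by norm_num, by norm_num⟩
  let g : 𝔸 → 𝔸 := fun m => φ m • m
  have hgs : ContDiff ℝ ∞ g := φ.contDiff.smul contDiff_id
  have hgc : HasCompactSupport g := φ.hasCompactSupport.smul_right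
  obtain ⟨K, hK⟩ := hgs.lipschitzWith_of_hasCompactSupport hgc (by simp)
  have hgb : ∀ m, ‖g m‖ ≤ 3 := by
    intro m
    by_cases hm : m ∈ Metric.ball (0 : 𝔸) 3
    · rw [mem_ball_zero_iff] at hm
      simp only [g, norm_smul]
      rw [Real.norm_of_nonneg φ.nonneg]
      calc φ m * ‖m‖ ≤ 1 * 3 := mul_le_mul φ.le_one hm.le (norm_nonneg _) zero_le_one
        _ = 3 := one_mul _
    · have : φ m = 0 := φ.zero_of_le_dist (by simpa [dist_eq_norm] using hm)
      simp [g, this]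
  obtain ⟨C, hC⟩ := isCompact_Icc.exists_bound_of_continuousOn (s := Set.Icc (-T) T)
    hBc.continuousOn
  have hC0 : 0 ≤ C := (norm_nonneg _).trans (hC 0 ⟨by linarith, hT.le⟩)
  lift C to NNReal using hC0
  lift T to NNReal using hT.le
  have hpl : IsPicardLindelof (fun t m => g m * B t) (tmin := -T) (tmax := T)
      ⟨0, by simp, by simp⟩ (1 : 𝔸) (3 * C * T) 0 (3 * C) (K * C) := by
    refine ⟨fun t ht => ?_, fun m _ => ?_, fun t ht m _ => ?_, ?_⟩
    · refine LipschitzOnWith.of_dist_le_mul fun m _ m' _ => ?_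
      rw [dist_eq_norm, ← sub_mul]
      refine (norm_mul_le _ _).trans ?_
      rw [← dist_eq_norm]
      calc _ ≤ K * dist m m' * C := mul_le_mul (hK.dist_le_mul m m') (hC t ht) (norm_nonneg _)
            (by positivity)
        _ = _ := by push_cast; ring
    · exact (continuous_const.mul hBc).continuousOn
    · refine (norm_mul_le _ _).trans ?_
      exact mul_le_mul (hgb m) (hC t ht) (norm_nonneg _) (by norm_num)
    · simp
  obtain ⟨M, hM0, hM⟩ := hpl.exists_eq_forall_mem_Icc_hasDerivWithinAt₀
  have hM' : ∀ t ∈ Set.Ioo (-(T : ℝ)) T, HasDerivAt M (φ (M t) • (M t * B t)) t := by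
    intro t ht
    have := (hM t (Set.Ioo_subset_Icc_self ht)).hasDerivAt (Icc_mem_nhds ht.1 ht.2)
    simpa [g] using this
  refine ⟨M, hM0, fun t ht => ?_⟩
  have h1 := mul_star_eq_one_of_ode hB hT hM' hM' hM0 hM0 ht
  have h2 : φ (M t) = 1 := φ.one_of_mem_closedBall (by
    rw [mem_closedBall_zero_iff]
    exact (norm_le_one_of_mul_star h1).trans (by norm_num [φ]))
  simpa [h2] using hM' t ht

end LinearODE

/-! ### Parallel transport along straight lines -/

section Transport

variable {D : ℕ} {𝔸 : Type} [CStarAlgebra 𝔸]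

/-- The connection matrix `- i v·A(x)` along the vector `v`. -/
def connection (A : Fin D → Space D → 𝔸) (x v : Space D) : 𝔸 :=
  -(Complex.I • ∑ μ, ((v μ : ℝ) : ℂ) • A μ x)

variable {A : Fin D → Space D → 𝔸}

theorem star_connection (hA' : ∀ μ x, IsSelfAdjoint (A μ x)) (x v : Space D) :
    star (connection A x v) = -connection A x v := by
  simp only [connection, star_neg, star_smul, star_sum]
  simp [(hA' _ _).star_eq]

theorem connection_smul (x v : Space D) (c : ℝ) :
    connection A x (c • v) = c • connection A x v := by
  simp only [connection, PiLp.smul_apply, smul_eq_mul, Complex.ofReal_mul, mul_smul,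
    ← Finset.smul_sum, smul_neg]
  rw [smul_comm, Complex.coe_smul]

theorem hasTemperateGrowth_connection (hA : ∀ μ, (A μ).HasTemperateGrowth) :
    (fun z : Phase D => connection A z.1 z.2).HasTemperateGrowth := by
  have h : ∀ μ, (fun z : Phase D => ((z.2 μ : ℝ) : ℂ) • A μ z.1).HasTemperateGrowth := by
    intro μ
    have h1 : (fun z : Phase D => ((z.2 μ : ℝ) : ℂ)).HasTemperateGrowth :=
      (Complex.ofRealCLM.comp ((EuclideanSpace.proj μ : Space D →L[ℝ] ℝ).comp
        (ContinuousLinearMap.snd ℝ (Space D) (Space D)))).hasTemperateGrowth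
    have h2 : (fun z : Phase D => A μ z.1).HasTemperateGrowth :=
      (hA μ).comp (ContinuousLinearMap.fst ℝ (Space D) (Space D)).hasTemperateGrowth
    exact h1.smul h2
  have h2 := Function.HasTemperateGrowth.sum (s := Finset.univ) (fun μ _ => h μ)
  have h3 := (Function.HasTemperateGrowth.const (E := Phase D) (-Complex.I)).smul h2
  convert! h3 using 2 with z
  simp [connection]

theorem continuous_connection (hA : ∀ μ, (A μ).HasTemperateGrowth) :
    Continuous (fun z : Phase D => connection A z.1 z.2) :=
  (hasTemperateGrowth_connection hA).1.continuous

open Classical in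
/-- The solution of the transport equation along the line `x + t v`. It is required on the interval
`(-2, 2)` only, so that finite-interval existence applies; the interval contains `t = 1` in its
interior. The junk value `0`, for a gauge field without a solution, never occurs for the gauge fields
of `IsGaugeField`. -/
def lineSolution (A : Fin D → Space D → 𝔸) (x v : Space D) : ℝ → 𝔸 :=
  if h : ∃ M : ℝ → 𝔸, M 0 = 1 ∧
    ∀ t ∈ Set.Ioo (-2 : ℝ) 2, HasDerivAt M (M t * connection A (x + t • v) v) t
  then h.choose else 0

/-- The parallel transport from `x + v` to `x` along the straight line: the ordered exponential
of `- i ∫ A`. -/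
def transport (A : Fin D → Space D → 𝔸) (x v : Space D) : 𝔸 := lineSolution A x v 1

/-- A gauge field: Hermitian and of temperate growth. -/
structure IsGaugeField (A : Fin D → Space D → 𝔸) : Prop where
  temperate : ∀ μ, (A μ).HasTemperateGrowth
  selfAdjoint : ∀ μ x, IsSelfAdjoint (A μ x)

variable [FiniteDimensional ℝ 𝔸] [IsDedekindFiniteMonoid 𝔸]

theorem continuous_connection_line (h : IsGaugeField A) (x v : Space D) :
    Continuous (fun t : ℝ => connection A (x + t • v) v) :=
  (continuous_connection h.temperate).comp (by fun_prop : Continuous fun t : ℝ => (x + t • v, v))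

theorem lineSolution_spec (h : IsGaugeField A) (x v : Space D) :
    lineSolution A x v 0 = 1 ∧ ∀ t ∈ Set.Ioo (-2 : ℝ) 2,
      HasDerivAt (lineSolution A x v) (lineSolution A x v t * connection A (x + t • v) v) t := by
  have := exists_ode_Ioo (continuous_connection_line h x v)
    (fun t => star_connection h.selfAdjoint _ _) (T := 2) (by norm_num)
  rw [lineSolution, dif_pos this]
  exact this.choose_spec

/-- Rescaling the direction of the line rescales the parameter. -/
theorem lineSolution_smul (h : IsGaugeField A) (x v : Space D) {c t : ℝ} (hc : c ≠ 0)
    (ht : |t| < 2) (hct : |c * t| < 2) :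
    lineSolution A x (c • v) t = lineSolution A x v (c * t) := by
  obtain ⟨h0, h1⟩ := lineSolution_spec h x (c • v)
  obtain ⟨h0', h1'⟩ := lineSolution_spec h x v
  have hcp : 0 < |c| := abs_pos.2 hc
  refine eq_of_ode (B := fun t => connection A (x + t • c • v) (c • v))
    (fun t => star_connection h.selfAdjoint _ _) (T := min 2 (2 / |c|)) (by positivity)
    (fun s hs => h1 s ?_) (K := fun t => lineSolution A x v (c * t)) (fun s hs => ?_) h0
    (by simpa using h0') ?_
  · exact abs_lt.1 ((abs_lt.2 hs).trans_le (min_le_left _ _))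
  · have hs' : |c * s| < 2 := by
      have := (abs_lt.2 hs).trans_le (min_le_right _ _)
      rw [abs_mul, mul_comm]
      exact (lt_div_iff₀ hcp).1 this
    have := (h1' (c * s) (abs_lt.1 hs')).scomp s ((hasDerivAt_id s).const_mul c)
    convert! this using 1
    rw [connection_smul, smul_smul, mul_comm s c, mul_one, mul_smul_comm]
  · refine abs_lt.1 (lt_min ht ?_)
    rw [abs_mul, mul_comm] at hct
    exact (lt_div_iff₀ hcp).2 hct

theorem transport_smul_eq (h : IsGaugeField A) (x v : Space D) {t : ℝ} (ht : |t| < 2) :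
    transport A x (t • v) = lineSolution A x v t := by
  rcases eq_or_ne t 0 with rfl | h0
  · have := lineSolution_spec h x (0 : Space D)
    rw [zero_smul, (lineSolution_spec h x v).1, transport]
    refine eq_of_ode (B := fun t => connection A (x + t • (0 : Space D)) 0)
      (fun t => star_connection h.selfAdjoint _ _) (T := 2) two_pos
      this.2 (K := fun _ => 1) (fun s hs => ?_) this.1 rfl ⟨by norm_num, by norm_num⟩
    simpa [connection] using hasDerivAt_const s (1 : 𝔸)
  · rw [transport, lineSolution_smul h x v h0 (by norm_num) (by simpa using ht), mul_one]

@[simp]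
theorem transport_zero (h : IsGaugeField A) (x : Space D) : transport A x 0 = 1 := by
  have := transport_smul_eq h x 0 (t := 0) (by norm_num)
  rw [zero_smul] at this
  rw [this, (lineSolution_spec h x 0).1]

/-- The transport equation. -/
theorem hasDerivAt_transport (h : IsGaugeField A) (x v : Space D) (t : ℝ) :
    HasDerivAt (fun s : ℝ => transport A x (s • v))
      (transport A x (t • v) * connection A (x + t • v) v) t := by
  -- the solution along `x + s S v` on `(-2, 2)` covers the parameters `s` below `2 S`
  set S : ℝ := |t| + 1 with hS
  have hS0 : 0 < S := by positivity
  have hts : |t / S| < 2 := by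
    rw [abs_div, abs_of_pos hS0, div_lt_iff₀ hS0]
    linarith [abs_nonneg t]
  have heq : ∀ s : ℝ, |s / S| < 2 →
      transport A x (s • v) = lineSolution A x (S • v) (s / S) := by
    intro s hs
    rw [← transport_smul_eq h x (S • v) hs, smul_smul, div_mul_cancel₀ _ hS0.ne']
  have hd := ((lineSolution_spec h x (S • v)).2 (t / S) (abs_lt.1 hts)).scomp t
    ((hasDerivAt_id t).div_const S)
  have hev : (fun s : ℝ => transport A x (s • v)) =ᶠ[𝓝 t]
      (lineSolution A x (S • v) ∘ fun s => id s / S) := by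
    have : ∀ᶠ s in 𝓝 t, |s / S| < 2 :=
      (by fun_prop : Continuous fun s : ℝ => |s / S|).continuousAt.eventually_lt
        continuousAt_const hts
    filter_upwards [this] with s hs using heq s hs
  convert! hd.congr_of_eventuallyEq hev using 1
  rw [heq t hts, connection_smul, smul_smul, div_mul_cancel₀ _ hS0.ne', mul_smul_comm,
    smul_smul, one_div_mul_cancel hS0.ne', one_smul]

/-- The transport equation along a line determines the transport. -/
theorem transport_unique (h : IsGaugeField A) (x v : Space D) {M : ℝ → 𝔸} (h0 : M 0 = 1)
    (hM : ∀ t, HasDerivAt M (M t * connection A (x + t • v) v) t) (t : ℝ) :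
    M t = transport A x (t • v) :=
  eq_of_ode (fun t => star_connection h.selfAdjoint _ _) (T := |t| + 1) (by positivity)
    (fun s _ => hM s) (fun s _ => hasDerivAt_transport h x v s) h0 (by simp [h])
    (abs_lt.1 (lt_add_one |t|))

/-- The transport is unitary, since the connection is anti-Hermitian. -/
theorem transport_mul_star (h : IsGaugeField A) (x v : Space D) :
    transport A x v * star (transport A x v) = 1 := by
  have := mul_star_eq_one_of_ode (B := fun t => connection A (x + t • v) v) (T := 2) (c := fun _ => 1)
    (fun t => star_connection h.selfAdjoint _ _) two_pos
    (fun s _ => by simpa using hasDerivAt_transport h x v s)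
    (fun s _ => by simpa using hasDerivAt_transport h x v s) (by simp [h]) (by simp [h])
    (t := 1) ⟨by norm_num, by norm_num⟩
  simpa using this

theorem star_transport_mul (h : IsGaugeField A) (x v : Space D) :
    star (transport A x v) * transport A x v = 1 :=
  mul_eq_one_comm.1 (transport_mul_star h x v)

theorem norm_transport_le (h : IsGaugeField A) (x v : Space D) : ‖transport A x v‖ ≤ 1 :=
  norm_le_one_of_mul_star (transport_mul_star h x v)

/-- Transports along consecutive segments of one line compose. -/
theorem transport_add_smul (h : IsGaugeField A) (x v : Space D) (s t : ℝ) :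
    transport A x ((s + t) • v) = transport A x (s • v) * transport A (x + s • v) (t • v) := by
  have := transport_unique h (x + s • v) v
    (M := fun t => star (transport A x (s • v)) * transport A x ((s + t) • v))
    (by simp [star_transport_mul h]) (fun t => ?_) t
  · rw [← this, ← mul_assoc, transport_mul_star h, one_mul]
  · have h1 := (hasDerivAt_transport h x v (s + t)).comp_const_add s t
    have h2 := h1.const_mul (star (transport A x (s • v)))
    convert! h2 using 1
    rw [← mul_assoc, add_smul, add_assoc]

/-- The adjoint of a transport is the transport along the reversed segment. -/
theorem star_transport (h : IsGaugeField A) (x v : Space D) :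
    star (transport A x v) = transport A (x + v) (-v) := by
  have h1 := transport_add_smul h x v 1 (-1)
  simp only [add_neg_cancel, zero_smul, one_smul, neg_smul, transport_zero h] at h1
  calc star (transport A x v) =
      star (transport A x v) * (transport A x v * transport A (x + v) (-v)) := by rw [← h1, mul_one]
    _ = _ := by rw [← mul_assoc, star_transport_mul h, one_mul]

/-- Duhamel's formula for the dependence of the transport on the line. -/
theorem transport_sub_transport (h : IsGaugeField A) (z w : Phase D) :
    transport A w.1 w.2 - transport A z.1 z.2 =
      (∫ s in Set.Ioc (0 : ℝ) 1, transport A w.1 (s • w.2) *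
        (connection A (w.1 + s • w.2) w.2 - connection A (z.1 + s • z.2) z.2) *
        star (transport A z.1 (s • z.2))) * transport A z.1 z.2 := by
  have hd : ∀ t, HasDerivAt
      (fun s : ℝ => transport A w.1 (s • w.2) * star (transport A z.1 (s • z.2)))
      (transport A w.1 (t • w.2) *
        (connection A (w.1 + t • w.2) w.2 - connection A (z.1 + t • z.2) z.2) *
        star (transport A z.1 (t • z.2))) t := by
    intro t
    convert! (hasDerivAt_transport h w.1 w.2 t).mul (hasDerivAt_transport h z.1 z.2 t).star using 1
    rw [star_mul, star_connection h.selfAdjoint]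
    noncomm_ring
  have hc : ∀ z : Phase D, Continuous fun s : ℝ => transport A z.1 (s • z.2) := fun z =>
    continuous_iff_continuousAt.2 fun t => (hasDerivAt_transport h z.1 z.2 t).continuousAt
  have hcont : Continuous fun t : ℝ => transport A w.1 (t • w.2) *
        (connection A (w.1 + t • w.2) w.2 - connection A (z.1 + t • z.2) z.2) *
        star (transport A z.1 (t • z.2)) :=
    ((hc w).mul ((continuous_connection_line h _ _).sub (continuous_connection_line h _ _))).mul
      (hc z).star
  have := intervalIntegral.integral_eq_sub_of_hasDerivAt (a := 0) (b := 1) (fun t _ => hd t)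
    (hcont.intervalIntegrable _ _)
  rw [intervalIntegral.integral_of_le zero_le_one] at this
  rw [this]
  simp only [one_smul, zero_smul, transport_zero h, star_one, mul_one, sub_mul, one_mul, mul_assoc,
    star_transport_mul h]

end Transport

/-! ### Smoothness and growth of the parallel transport -/

section TransportSmooth

variable {D : ℕ} {𝔸 : Type} [CStarAlgebra 𝔸] {A : Fin D → Space D → 𝔸}

/-- The product rule at a zero of the second factor: the first factor need only be continuous. -/
theorem hasFDerivAt_mul_of_eq_zero {E : Type} [NormedAddCommGroup E] [NormedSpace ℝ E]
    {a b : E → 𝔸} {b' : E →L[ℝ] 𝔸} {z : E} (ha : ContinuousAt a z) (hb : HasFDerivAt b b' z)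
    (h0 : b z = 0) :
    HasFDerivAt (fun w => a w * b w) ((ContinuousLinearMap.mul ℝ 𝔸 (a z)).comp b') z := by
  rw [hasFDerivAt_iff_isLittleO]
  have h1 : (fun w => a w * (b w - b z - b' (w - z))) =o[𝓝 z] fun w => w - z := by
    have := (ha.norm.isBoundedUnder_le.isBigO_one ℝ).mul_isLittleO
      (hasFDerivAt_iff_isLittleO.1 hb).norm_right
    simpa using this
  have h2 : (fun w => (a w - a z) * b' (w - z)) =o[𝓝 z] fun w => w - z := by
    have h3 : (fun w => a w - a z) =o[𝓝 z] fun _ => (1 : ℝ) := by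
      rw [Asymptotics.isLittleO_one_iff]
      simpa using ha.sub_const (a z)
    have := h3.mul_isBigO (b'.isBigO_sub (𝓝 z) z).norm_right
    simpa using this
  refine (h1.add h2).congr_left fun w => ?_
  simp only [h0, sub_zero, mul_zero, ContinuousLinearMap.comp_apply, ContinuousLinearMap.mul_apply']
  noncomm_ring

/-- The connection along the line `x + s v`, as a function of `(s, (x, v))`. -/
def lineConnection (A : Fin D → Space D → 𝔸) (p : ℝ × Phase D) : 𝔸 :=
  connection A (p.2.1 + p.1 • p.2.2) p.2.2

/-- The line `(x, v)` shrunk by the factor `s`. -/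
def shrinkLine (p : ℝ × Phase D) : Phase D := (p.2.1, p.1 • p.2.2)

theorem hasTemperateGrowth_shrinkLine : (shrinkLine (D := D)).HasTemperateGrowth := by
  exact HasTemperateGrowth.prodMk
    ((ContinuousLinearMap.fst ℝ (Space D) (Space D)).comp
      (ContinuousLinearMap.snd ℝ ℝ (Phase D))).hasTemperateGrowth
    ((ContinuousLinearMap.fst ℝ ℝ (Phase D)).hasTemperateGrowth.smul
      ((ContinuousLinearMap.snd ℝ (Space D) (Space D)).comp
        (ContinuousLinearMap.snd ℝ ℝ (Phase D))).hasTemperateGrowth)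

theorem hasTemperateGrowth_lineConnection (hA : ∀ μ, (A μ).HasTemperateGrowth) :
    (lineConnection A).HasTemperateGrowth := by
  have h1 : (fun p : ℝ × Phase D => (p.2.1 + p.1 • p.2.2, p.2.2)).HasTemperateGrowth := by
    refine HasTemperateGrowth.prodMk (Function.HasTemperateGrowth.add
      ((ContinuousLinearMap.fst ℝ (Space D) (Space D)).comp
        (ContinuousLinearMap.snd ℝ ℝ (Phase D))).hasTemperateGrowth
      ((ContinuousLinearMap.fst ℝ ℝ (Phase D)).hasTemperateGrowth.smul
        ((ContinuousLinearMap.snd ℝ (Space D) (Space D)).comp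
          (ContinuousLinearMap.snd ℝ ℝ (Phase D))).hasTemperateGrowth))
      ((ContinuousLinearMap.snd ℝ (Space D) (Space D)).comp
        (ContinuousLinearMap.snd ℝ ℝ (Phase D))).hasTemperateGrowth
  exact (hasTemperateGrowth_connection hA).comp h1

variable [FiniteDimensional ℝ 𝔸] [IsDedekindFiniteMonoid 𝔸]

/-- The connection along a line is locally Lipschitz in the line, uniformly on the unit interval. -/
theorem exists_lipschitz_lineConnection (h : IsGaugeField A) (z : Phase D) :
    ∃ M : ℝ, ∀ s ∈ Set.Ioc (0 : ℝ) 1, ∀ w ∈ Metric.ball z 1,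
      ‖lineConnection A (s, w) - lineConnection A (s, z)‖ ≤ M * ‖w - z‖ := by
  have hTG := hasTemperateGrowth_lineConnection h.temperate
  obtain ⟨M, hM⟩ := (HasTemperateGrowth.polyBounded
    (HasTemperateGrowth.fderiv hTG)).exists_bound_ball z
  refine ⟨M * ‖ContinuousLinearMap.inr ℝ ℝ (Phase D)‖, fun s hs w hw => ?_⟩
  refine (convex_ball z 1).norm_image_sub_le_of_norm_hasFDerivWithin_le
    (f := fun w => lineConnection A (s, w)) (fun y _ =>
      ((hTG.1.differentiable (by simp) (s, y)).hasFDerivAt.comp y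
        (hasFDerivAt_prodMk_right s y)).hasFDerivWithinAt) (fun y hy => ?_)
    (Metric.mem_ball_self one_pos) hw
  exact (ContinuousLinearMap.opNorm_comp_le _ _).trans
    (mul_le_mul_of_nonneg_right (hM s hs y hy) (norm_nonneg _))

theorem continuous_transport_smul (h : IsGaugeField A) (w : Phase D) :
    Continuous fun s : ℝ => transport A w.1 (s • w.2) :=
  continuous_iff_continuousAt.2 fun t => (hasDerivAt_transport h w.1 w.2 t).continuousAt

theorem norm_star_transport_le (h : IsGaugeField A) (x v : Space D) :
    ‖star (transport A x v)‖ ≤ 1 := by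
  rw [norm_star]; exact norm_transport_le h x v

/-- The integrand of Duhamel's formula. -/
def duhamel (A : Fin D → Space D → 𝔸) (z w : Phase D) (s : ℝ) : 𝔸 :=
  transport A w.1 (s • w.2) * (lineConnection A (s, w) - lineConnection A (s, z)) *
    star (transport A z.1 (s • z.2))

theorem continuous_duhamel (h : IsGaugeField A) (z w : Phase D) : Continuous (duhamel A z w) :=
  ((continuous_transport_smul h w).mul ((continuous_connection_line h w.1 w.2).sub
    (continuous_connection_line h z.1 z.2))).mul (continuous_transport_smul h z).star

theorem norm_duhamel_le (h : IsGaugeField A) (z w : Phase D) (s : ℝ) :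
    ‖duhamel A z w s‖ ≤ ‖lineConnection A (s, w) - lineConnection A (s, z)‖ := by
  refine (norm_mul_le _ _).trans ?_
  refine (mul_le_of_le_one_right (norm_nonneg _) (norm_star_transport_le h _ _)).trans ?_
  exact (norm_mul_le _ _).trans (mul_le_of_le_one_left (norm_nonneg _) (norm_transport_le h _ _))

theorem transport_eq_duhamel (h : IsGaugeField A) (z w : Phase D) :
    transport A w.1 w.2 = transport A z.1 z.2 +
      (∫ s in Set.Ioc (0 : ℝ) 1, duhamel A z w s) * transport A z.1 z.2 :=
  (sub_eq_iff_eq_add'.1 (transport_sub_transport h z w))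

theorem continuous_transport (h : IsGaugeField A) :
    Continuous fun z : Phase D => transport A z.1 z.2 := by
  refine continuous_iff_continuousAt.2 fun z => ?_
  obtain ⟨M, hM⟩ := exists_lipschitz_lineConnection h z
  have key : ∀ᶠ w in 𝓝 z, ‖transport A w.1 w.2 - transport A z.1 z.2‖ ≤ M * ‖w - z‖ := by
    filter_upwards [Metric.ball_mem_nhds z one_pos] with w hw
    rw [transport_eq_duhamel h z w, add_sub_cancel_left]
    refine (norm_mul_le _ _).trans
      ((mul_le_of_le_one_right (norm_nonneg _) (norm_transport_le h _ _)).trans ?_)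
    refine (norm_setIntegral_le_of_norm_le_const (by simp)
      fun s hs => (norm_duhamel_le h z w s).trans (hM s hs w hw)).trans ?_
    simp
  rw [ContinuousAt, tendsto_iff_norm_sub_tendsto_zero]
  refine squeeze_zero' (.of_forall fun _ => norm_nonneg _) key ?_
  have : Continuous fun w : Phase D => M * ‖w - z‖ := by fun_prop
  simpa using this.tendsto z

/-- The integrand of the derivative of the transport. -/
def transportDeriv (A : Fin D → Space D → 𝔸) (p : ℝ × Phase D) : Phase D →L[ℝ] 𝔸 :=
  (ContinuousLinearMap.mul ℝ 𝔸 (transport A (shrinkLine p).1 (shrinkLine p).2)).comp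
    ((((ContinuousLinearMap.mul ℝ 𝔸).flip (star (transport A (shrinkLine p).1 (shrinkLine p).2) *
      transport A p.2.1 p.2.2)).comp
        ((fderiv ℝ (lineConnection A) p).comp (ContinuousLinearMap.inr ℝ ℝ (Phase D)))))

/-- The bootstrap step: the integrand of the derivative of the transport involves the transport
itself, undifferentiated. -/
theorem temperateUpTo_transportDeriv (h : IsGaugeField A) {n : ℕ}
    (hU : TemperateUpTo n fun z : Phase D => transport A z.1 z.2) :
    TemperateUpTo n (transportDeriv A) := by
  have h1 := hU.comp (hasTemperateGrowth_shrinkLine (D := D))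
  have h2 := hU.comp (ContinuousLinearMap.snd ℝ ℝ (Phase D)).hasTemperateGrowth
  have h3 := h1.postcomp (starL' ℝ : 𝔸 ≃L[ℝ] 𝔸).toContinuousLinearMap
  have h4 := TemperateUpTo.bilin (ContinuousLinearMap.mul ℝ 𝔸) h3 h2
  have h5 := TemperateUpTo.bilin (ContinuousLinearMap.compL ℝ (Phase D) (ℝ × Phase D) 𝔸)
    (HasTemperateGrowth.temperateUpTo n
      (HasTemperateGrowth.fderiv (hasTemperateGrowth_lineConnection h.temperate)))
    (HasTemperateGrowth.temperateUpTo n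
      (Function.HasTemperateGrowth.const (ContinuousLinearMap.inr ℝ ℝ (Phase D))))
  have h6 := TemperateUpTo.bilin (ContinuousLinearMap.compL ℝ (Phase D) 𝔸 𝔸)
    (h4.postcomp (ContinuousLinearMap.mul ℝ 𝔸).flip) h5
  exact TemperateUpTo.bilin (ContinuousLinearMap.compL ℝ (Phase D) 𝔸 𝔸)
    (h1.postcomp (ContinuousLinearMap.mul ℝ 𝔸)) h6

/-- The derivative of the transport at `z`, by differentiating Duhamel's formula in `w` at `w = z`.
The integrand vanishes there, so its derivative exists although only the continuity of the transport
in `w` is known. -/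
theorem hasFDerivAt_transport (h : IsGaugeField A) (z : Phase D) :
    HasFDerivAt (fun z : Phase D => transport A z.1 z.2)
      (∫ s in Set.Ioc (0 : ℝ) 1, transportDeriv A (s, z)) z := by
  have hU0 : TemperateUpTo 0 fun z : Phase D => transport A z.1 z.2 :=
    ⟨continuous_transport h, 0, 1, fun z => by simpa using norm_transport_le h z.1 z.2⟩
  obtain ⟨M, hM⟩ := exists_lipschitz_lineConnection h z
  set R : 𝔸 →L[ℝ] 𝔸 := (ContinuousLinearMap.mul ℝ 𝔸).flip (transport A z.1 z.2) with hR
  have hd : ∀ s : ℝ, HasFDerivAt (fun w => R (duhamel A z w s)) (transportDeriv A (s, z)) z := by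
    intro s
    have hcont : ContinuousAt (fun w : Phase D => transport A w.1 (s • w.2)) z :=
      ((continuous_transport h).comp
        (by fun_prop : Continuous fun w : Phase D => (w.1, s • w.2))).continuousAt
    have hb := ((((hasTemperateGrowth_lineConnection h.temperate).1.differentiable (by simp)
      (s, z)).hasFDerivAt.comp z (hasFDerivAt_prodMk_right s z)).sub_const
        (lineConnection A (s, z)))
    have hb2 := ((ContinuousLinearMap.mul ℝ 𝔸).flip (star (transport A z.1 (s • z.2)) *
      transport A z.1 z.2)).hasFDerivAt.comp z hb
    have := hasFDerivAt_mul_of_eq_zero hcont hb2 (by simp)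
    refine this.congr_of_eventuallyEq (.of_forall fun w => ?_)
    simp [hR, duhamel, mul_assoc, sub_mul]
  have hmain := (hasFDerivAt_integral_of_dominated_loc_of_lip'
    (μ := volume.restrict (Set.Ioc (0 : ℝ) 1)) (F := fun w s => R (duhamel A z w s))
    (F' := fun s => transportDeriv A (s, z)) (bound := fun _ => M)
    (Metric.ball_mem_nhds z one_pos) ?_ ?_ ?_ ?_ (integrable_const M)
    (.of_forall hd)).2
  · have hconst : ∀ w, transport A w.1 w.2 = transport A z.1 z.2 +
        ∫ s in Set.Ioc (0 : ℝ) 1, R (duhamel A z w s) := by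
      intro w
      rw [R.integral_comp_comm (integrableOn_Ioc_of_continuous (continuous_duhamel h z w))]
      exact transport_eq_duhamel h z w
    exact (hmain.const_add (transport A z.1 z.2)).congr_of_eventuallyEq (.of_forall hconst)
  · exact fun w _ => (R.continuous.comp (continuous_duhamel h z w)).aestronglyMeasurable
  · exact integrableOn_Ioc_of_continuous (R.continuous.comp (continuous_duhamel h z z))
  · exact ((temperateUpTo_transportDeriv h hU0).continuous.comp
      (Continuous.prodMk_left z)).aestronglyMeasurable
  · filter_upwards [ae_restrict_mem measurableSet_Ioc] with s hs w hw
    have h0 : duhamel A z z s = 0 := by simp [duhamel]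
    rw [h0, map_zero, sub_zero]
    refine (norm_mul_le _ _).trans
      ((mul_le_of_le_one_right (norm_nonneg _) (norm_transport_le h _ _)).trans ?_)
    exact (norm_duhamel_le h z w s).trans (hM s hs w hw)

/-- The transport is of temperate growth. Its derivative is an integral of products of transports
and of derivatives of the gauge field, so that its smoothness bootstraps; unitarity bounds it. -/
theorem hasTemperateGrowth_transport (h : IsGaugeField A) :
    (fun z : Phase D => transport A z.1 z.2).HasTemperateGrowth := by
  have hb : PolyBounded fun z : Phase D => transport A z.1 z.2 :=
    ⟨0, 1, fun z => by simpa using norm_transport_le h z.1 z.2⟩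
  refine TemperateUpTo.hasTemperateGrowth fun n => ?_
  induction n with
  | zero => exact ⟨continuous_transport h, hb⟩
  | succ n ih =>
    exact .of_hasFDerivAt hb (hasFDerivAt_transport h) (temperateUpTo_transportDeriv h ih).integral

/-- The parallel transport is gauge covariant: the right-hand side solves the transport equation of
the transformed gauge field. -/
theorem transport_gauge (h : IsGaugeField A) {A' : Fin D → Space D → 𝔸} (h' : IsGaugeField A')
    {Ω : Space D → 𝔸} (hd : Differentiable ℝ Ω) (hΩ : ∀ x, Ω x * star (Ω x) = 1)
    (hc : ∀ x v, connection A' x v = Ω x * connection A x v * star (Ω x) +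
      Ω x * fderiv ℝ (fun z => star (Ω z)) x v) (x v : Space D) :
    transport A' x v = Ω x * transport A x v * star (Ω (x + v)) := by
  have hs : Differentiable ℝ fun z => star (Ω z) := fun z => (hd z).star
  have := transport_unique h' x v
    (M := fun t => Ω x * transport A x (t • v) * star (Ω (x + t • v))) ?_ (fun t => ?_) 1
  · simpa using this.symm
  · simp [transport_zero h, hΩ]
  · have h1 : HasDerivAt (fun t : ℝ => x + t • v) v t := by
      simpa using ((hasDerivAt_id t).smul_const v).const_add x
    have h2 := (hs (x + t • v)).hasFDerivAt.comp_hasDerivAt t h1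
    convert! ((hasDerivAt_transport h x v t).const_mul (Ω x)).mul h2 using 1
    have h3 : ∀ y, star (Ω y) * (Ω y * connection A y v * star (Ω y)) =
        connection A y v * star (Ω y) := fun y => by
      rw [← mul_assoc, ← mul_assoc, mul_eq_one_comm.1 (hΩ y), one_mul]
    have h4 : ∀ y b, star (Ω y) * (Ω y * b) = b := fun y b => by
      rw [← mul_assoc, mul_eq_one_comm.1 (hΩ y), one_mul]
    rw [hc, mul_add, mul_assoc _ (star _), h3, mul_assoc _ (star _), h4]
    simp only [mul_assoc, Function.comp_apply]

end TransportSmooth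

/-! ### Matrices as a C⋆-algebra -/

instance (N : ℕ) : IsDedekindFiniteMonoid (Mat N) where
  mul_eq_one_symm {a b} h := by
    have h' : (a : Inner N →ₗ[ℂ] Inner N) * (b : Inner N →ₗ[ℂ] Inner N) = 1 := by
      ext1 v; exact congrArg (fun m : Mat N => m v) h
    have := mul_eq_one_comm.1 h'
    ext1 v
    exact congrArg (fun m : Inner N →ₗ[ℂ] Inner N => m v) this

instance (N : ℕ) : FiniteDimensional ℝ (Mat N) := FiniteDimensional.complexToReal _

section MatTransport

variable {D N : ℕ} {A : Fin D → Space D → Mat N}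

theorem IsGaugeField.of_mat (hA : ∀ μ, (A μ).HasTemperateGrowth)
    (hA' : ∀ μ x, IsSelfAdjoint (A μ x)) : IsGaugeField A := ⟨hA, hA'⟩

theorem IsGaugeField.hasTemperateGrowth_mat (h : IsGaugeField A) :
    Function.HasTemperateGrowth (fun z : Phase D => (transport A z.1 z.2 : Mat N)) :=
  hasTemperateGrowth_transport h

theorem IsGaugeField.hasDerivAt_mat (h : IsGaugeField A) (x v : Space D) (t : ℝ) :
    HasDerivAt (fun s : ℝ => (transport A x (s • v) : Mat N))
      (transport A x (t • v) * connection A (x + t • v) v) t := hasDerivAt_transport h x v t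

theorem IsGaugeField.mul_star_mat (h : IsGaugeField A) (x v : Space D) :
    (transport A x v : Mat N) * star (transport A x v) = 1 := transport_mul_star h x v

theorem IsGaugeField.star_mul_mat (h : IsGaugeField A) (x v : Space D) :
    star (transport A x v : Mat N) * transport A x v = 1 := star_transport_mul h x v

end MatTransport

/-! ### Slices and tensor products of Schwartz functions -/

section Slices

variable {E₁ E₂ : Type} [NormedAddCommGroup E₁] [NormedSpace ℝ E₁]
  [NormedAddCommGroup E₂] [NormedSpace ℝ E₂]
  {F : Type} [NormedAddCommGroup F] [NormedSpace ℝ F] [NormedSpace ℂ F]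

variable (𝕜 : Type) [RCLike 𝕜] [NormedSpace 𝕜 F]

/-- The slice `y ↦ h (x, y)` of a Schwartz function. -/
def sliceLeft (x : E₁) : 𝓢(E₁ × E₂, F) →L[𝕜] 𝓢(E₂, F) :=
  SchwartzMap.compCLM 𝕜 (g := fun y : E₂ => (x, y))
    (HasTemperateGrowth.prodMk (.const x) .id')
    ⟨1, 1, fun y => by
      have : ‖y‖ ≤ ‖(x, y)‖ := le_max_right _ _
      simp only [pow_one, one_mul]
      linarith⟩

@[simp]
theorem sliceLeft_apply (x : E₁) (h : 𝓢(E₁ × E₂, F)) (y : E₂) :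
    sliceLeft 𝕜 x h y = h (x, y) := rfl

/-- The slice `x ↦ h (x, y)` of a Schwartz function. -/
def sliceRight (y : E₂) : 𝓢(E₁ × E₂, F) →L[𝕜] 𝓢(E₁, F) :=
  SchwartzMap.compCLM 𝕜 (g := fun x : E₁ => (x, y))
    (HasTemperateGrowth.prodMk .id' (.const y))
    ⟨1, 1, fun x => by
      have : ‖x‖ ≤ ‖(x, y)‖ := le_max_left _ _
      simp only [pow_one, one_mul]
      linarith⟩

@[simp]
theorem sliceRight_apply (y : E₂) (h : 𝓢(E₁ × E₂, F)) (x : E₁) :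
    sliceRight 𝕜 y h x = h (x, y) := rfl

variable {𝕜}

/-- The derivatives of a slice are the partial derivatives. -/
theorem iteratedFDeriv_sliceLeft (h : 𝓢(E₁ × E₂, F)) (n : ℕ) (x : E₁) (y : E₂) :
    iteratedFDeriv ℝ n (sliceLeft ℝ x h) y =
      (iteratedFDeriv ℝ n h (x, y)).compContinuousLinearMap
        fun _ => ContinuousLinearMap.inr ℝ E₁ E₂ := by
  have hs : ContDiff ℝ ∞ (fun z : E₁ × E₂ => h (z + (x, 0))) :=
    (h.smooth ⊤).comp (contDiff_id.add contDiff_const)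
  have h1 := (ContinuousLinearMap.inr ℝ E₁ E₂).iteratedFDeriv_comp_right hs y (i := n)
    (mod_cast le_top)
  have h2 : (sliceLeft ℝ x h : E₂ → F) =
      (fun z : E₁ × E₂ => h (z + (x, 0))) ∘ ContinuousLinearMap.inr ℝ E₁ E₂ := by
    ext y; simp
  rw [h2, h1, iteratedFDeriv_comp_add_right]
  simp

theorem norm_compContinuousLinearMap_inr_le {n : ℕ}
    (m : ContinuousMultilinearMap ℝ (fun _ : Fin n => E₁ × E₂) F) :
    ‖m.compContinuousLinearMap fun _ => ContinuousLinearMap.inr ℝ E₁ E₂‖ ≤ ‖m‖ := by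
  refine (ContinuousMultilinearMap.norm_compContinuousLinearMap_le _ _).trans ?_
  rw [Finset.prod_const]
  exact mul_le_of_le_one_right (norm_nonneg _)
    (pow_le_one₀ (norm_nonneg _) (ContinuousLinearMap.norm_inr_le_one ..))

/-- Slices decay rapidly in the variable that is held fixed. -/
theorem pow_mul_seminorm_sliceLeft_le (h : 𝓢(E₁ × E₂, F)) (m k n : ℕ) (x : E₁) :
    ‖x‖ ^ m * SchwartzMap.seminorm ℝ k n (sliceLeft ℝ x h) ≤
      SchwartzMap.seminorm ℝ (m + k) n h := by
  rcases eq_or_lt_of_le (pow_nonneg (norm_nonneg x) m) with h0 | h0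
  · rw [← h0, zero_mul]; positivity
  rw [← le_div_iff₀' h0]
  refine SchwartzMap.seminorm_le_bound ℝ k n _ (by positivity) fun y => ?_
  rw [le_div_iff₀' h0, iteratedFDeriv_sliceLeft]
  refine le_trans ?_ (h.le_seminorm ℝ (m + k) n (x, y))
  rw [← mul_assoc, pow_add]
  have h1 : ‖x‖ ≤ ‖(x, y)‖ := le_max_left _ _
  have h2 : ‖y‖ ≤ ‖(x, y)‖ := le_max_right _ _
  have := norm_compContinuousLinearMap_inr_le (iteratedFDeriv ℝ n h (x, y))
  gcongr

/-- Slices are Lipschitz in the variable that is held fixed. -/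
theorem seminorm_sliceLeft_sub_le (h : 𝓢(E₁ × E₂, F)) (k n : ℕ) (x x' : E₁) :
    SchwartzMap.seminorm ℝ k n (sliceLeft ℝ x h - sliceLeft ℝ x' h) ≤
      SchwartzMap.seminorm ℝ k (n + 1) h * ‖x - x'‖ := by
  refine SchwartzMap.seminorm_le_bound ℝ k n _ (by positivity) fun y => ?_
  have hsub : iteratedFDeriv ℝ n (sliceLeft ℝ x h - sliceLeft ℝ x' h) y =
      (iteratedFDeriv ℝ n h (x, y) - iteratedFDeriv ℝ n h (x', y)).compContinuousLinearMap
        fun _ => ContinuousLinearMap.inr ℝ E₁ E₂ := by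
    have : (⇑(sliceLeft ℝ x h - sliceLeft ℝ x' h) : E₂ → F) =
      ⇑(sliceLeft ℝ x h) - ⇑(sliceLeft ℝ x' h) := rfl
    rw [this, iteratedFDeriv_sub_apply ((SchwartzMap.smooth _ n).contDiffAt)
      ((SchwartzMap.smooth _ n).contDiffAt), iteratedFDeriv_sliceLeft, iteratedFDeriv_sliceLeft]
    rfl
  rw [hsub]
  refine (mul_le_mul_of_nonneg_left (norm_compContinuousLinearMap_inr_le _) (by positivity)).trans ?_
  have hd : Differentiable ℝ (iteratedFDeriv ℝ n h) :=
    (h.smooth ⊤).differentiable_iteratedFDeriv (mod_cast ENat.natCast_lt_top n)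
  rcases eq_or_lt_of_le (pow_nonneg (norm_nonneg y) k) with h0 | h0
  · rw [← h0, zero_mul]; positivity
  rw [← le_div_iff₀' h0, mul_div_right_comm]
  refine convex_univ.norm_image_sub_le_of_norm_hasFDerivWithin_le
    (f := fun x => iteratedFDeriv ℝ n h (x, y)) (fun z _ =>
      ((hd (z, y)).hasFDerivAt.comp z (hasFDerivAt_prodMk_left z y)).hasFDerivWithinAt)
      (fun z _ => ?_) (Set.mem_univ _) (Set.mem_univ _)
  refine (ContinuousLinearMap.opNorm_comp_le _ _).trans ?_
  refine (mul_le_of_le_one_right (norm_nonneg _) (ContinuousLinearMap.norm_inl_le_one ..)).trans ?_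
  rw [norm_fderiv_iteratedFDeriv, le_div_iff₀' h0]
  refine le_trans ?_ (h.le_seminorm ℝ k (n + 1) (z, y))
  have h2 : ‖y‖ ≤ ‖(z, y)‖ := le_max_right _ _
  gcongr

theorem continuous_sliceLeft (h : 𝓢(E₁ × E₂, F)) : Continuous fun x => sliceLeft ℝ x h := by
  refine continuous_iff_continuousAt.2 fun x₀ => ?_
  refine ((schwartz_withSeminorms ℝ E₂ F).tendsto_nhds _ _).2 fun i ε hε => ?_
  have hc : Continuous fun x : E₁ => SchwartzMap.seminorm ℝ i.1 (i.2 + 1) h * ‖x - x₀‖ := by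
    fun_prop
  have := hc.continuousAt.eventually_lt (continuousAt_const (x := x₀) (y := ε))
    (by simpa using hε)
  filter_upwards [this] with x hx
  exact (seminorm_sliceLeft_sub_le h i.1 i.2 x x₀).trans_lt hx

/-- Exchange of the two variables. -/
def swapCLM : 𝓢(E₁ × E₂, F) →L[ℝ] 𝓢(E₂ × E₁, F) :=
  compCLMOfContinuousLinearEquiv ℝ (ContinuousLinearEquiv.prodComm ℝ E₂ E₁)

theorem continuous_sliceRight (h : 𝓢(E₁ × E₂, F)) : Continuous fun y => sliceRight ℝ y h :=
  continuous_sliceLeft (swapCLM h)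

/-- The tensor product with a fixed scalar Schwartz function. -/
def tensorCLM (φ : 𝓢(E₁, ℂ)) [SMulCommClass ℝ ℂ F] [IsScalarTower ℝ ℂ F] :
    𝓢(E₂, F) →L[ℂ] 𝓢(E₁ × E₂, F) := by
  refine SchwartzMap.mkCLM (fun f z => φ z.1 • f z.2) (fun f g z => by simp)
    (fun a f z => smul_comm _ _ _) (fun f => ((φ.smooth ⊤).comp contDiff_fst).smul
      ((f.smooth ⊤).comp contDiff_snd)) ?_
  rintro ⟨k, n⟩
  refine ⟨Finset.Iic (k, n), ‖(ContinuousLinearMap.lsmul ℝ ℂ : ℂ →L[ℝ] F →L[ℝ] F)‖ *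
    ∑ i ∈ Finset.range (n + 1), (n.choose i : ℝ) *
      (SchwartzMap.seminorm ℝ k i φ + SchwartzMap.seminorm ℝ 0 i φ), by positivity, fun f z => ?_⟩
  have hφ : ContDiff ℝ ∞ (fun z : E₁ × E₂ => φ z.1) := (φ.smooth ⊤).comp contDiff_fst
  have hf : ContDiff ℝ ∞ (fun z : E₁ × E₂ => f z.2) := (f.smooth ⊤).comp contDiff_snd
  have key : ∀ {E G : Type} [NormedAddCommGroup E] [NormedSpace ℝ E] [NormedAddCommGroup G]
      [NormedSpace ℝ G] (f : 𝓢(E, G)) (L : E₁ × E₂ →L[ℝ] E), ‖L‖ ≤ 1 → ∀ (i : ℕ) (z : E₁ × E₂),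
      ‖iteratedFDeriv ℝ i (fun z => f (L z)) z‖ ≤ ‖iteratedFDeriv ℝ i f (L z)‖ := by
    intro E G _ _ _ _ f L hL i z
    have h := L.iteratedFDeriv_comp_right (f.smooth ⊤) z (i := i) (mod_cast le_top)
    have h2 := ContinuousMultilinearMap.norm_compContinuousLinearMap_le
      (iteratedFDeriv ℝ i f (L z)) (fun _ => L)
    rw [← h] at h2
    refine h2.trans ?_
    rw [Finset.prod_const]
    exact mul_le_of_le_one_right (norm_nonneg _) (pow_le_one₀ (norm_nonneg _) hL)
  have hmul := (ContinuousLinearMap.lsmul ℝ ℂ : ℂ →L[ℝ] F →L[ℝ] F).norm_iteratedFDeriv_le_of_bilinear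
    hφ hf z (n := n) (mod_cast le_top)
  refine (mul_le_mul_of_nonneg_left hmul (by positivity)).trans ?_
  set S := (Finset.Iic (k, n)).sup (schwartzSeminormFamily ℂ E₂ F) f
  have hS : ∀ l ≤ k, ∀ i ≤ n, ‖z.2‖ ^ l * ‖iteratedFDeriv ℝ i f z.2‖ ≤ S := fun l hl i hi =>
    (f.le_seminorm ℂ l i z.2).trans (Seminorm.le_def.1 (Finset.le_sup (f := schwartzSeminormFamily ℂ E₂ F)
      (Finset.mem_Iic.2 (show (l, i) ≤ (k, n) from Prod.mk_le_mk.2 ⟨hl, hi⟩))) f)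
  rw [mul_left_comm, mul_assoc]
  refine mul_le_mul_of_nonneg_left ?_ (norm_nonneg _)
  rw [Finset.mul_sum, Finset.sum_mul]
  refine Finset.sum_le_sum fun i hi => ?_
  have h1 := key φ (ContinuousLinearMap.fst ℝ _ _) (ContinuousLinearMap.norm_fst_le ..) i z
  have h2 := key f (ContinuousLinearMap.snd ℝ _ _) (ContinuousLinearMap.norm_snd_le ..) (n - i) z
  simp only [ContinuousLinearMap.coe_fst', ContinuousLinearMap.coe_snd'] at h1 h2
  have q0 := hS 0 (Nat.zero_le _) (n - i) (Nat.sub_le _ _)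
  have q1 := hS k le_rfl (n - i) (Nat.sub_le _ _)
  have p0 := φ.le_seminorm ℝ 0 i z.1
  have p1 := φ.le_seminorm ℝ k i z.1
  rw [pow_zero, one_mul] at q0 p0
  have hz : ‖z‖ ^ k ≤ ‖z.1‖ ^ k + ‖z.2‖ ^ k := by
    rw [Prod.norm_def]
    rcases max_cases ‖z.1‖ ‖z.2‖ with h | h <;> rw [h.1] <;>
      linarith [pow_nonneg (norm_nonneg z.1) k, pow_nonneg (norm_nonneg z.2) k]
  set a := ‖iteratedFDeriv ℝ i φ z.1‖
  set b := ‖iteratedFDeriv ℝ (n - i) f z.2‖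
  have hS0 : 0 ≤ S := (norm_nonneg _).trans q0
  calc _ ≤ (‖z.1‖ ^ k + ‖z.2‖ ^ k) * ((n.choose i : ℝ) * a * b) := by
        gcongr
    _ = (n.choose i : ℝ) * ((‖z.1‖ ^ k * a) * b + a * (‖z.2‖ ^ k * b)) := by ring
    _ ≤ (n.choose i : ℝ) * (SchwartzMap.seminorm ℝ k i φ * S +
          SchwartzMap.seminorm ℝ 0 i φ * S) := by gcongr
    _ = _ := by ring

@[simp]
theorem tensorCLM_apply (φ : 𝓢(E₁, ℂ)) [SMulCommClass ℝ ℂ F] [IsScalarTower ℝ ℂ F] (f : 𝓢(E₂, F))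
    (z : E₁ × E₂) : tensorCLM φ f z = φ z.1 • f z.2 := rfl

end Slices

open scoped FourierTransform

/-! ### The partial Fourier transform -/

section PartialFourier

variable {E V : Type} [NormedAddCommGroup E] [NormedSpace ℝ E]
  [NormedAddCommGroup V] [InnerProductSpace ℝ V] [FiniteDimensional ℝ V]
  [MeasurableSpace V] [BorelSpace V]
  {F : Type} [NormedAddCommGroup F] [NormedSpace ℝ F] [NormedSpace ℂ F] [IsScalarTower ℝ ℂ F]
  [SMulCommClass ℝ ℂ F]

/-- Slices are bounded, uniformly in the variable that is held fixed, by an integrable function. -/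
theorem exists_integrable_bound {F : Type} [NormedAddCommGroup F] [NormedSpace ℝ F]
    (h : 𝓢(E × V, F)) :
    ∃ b : V → ℝ, Integrable b ∧ ∀ x y, ‖h (x, y)‖ ≤ b y := by
  set r := (volume : Measure V).integrablePower
  set C := 2 ^ r * (SchwartzMap.seminorm ℝ 0 0 h + SchwartzMap.seminorm ℝ r 0 h)
  refine ⟨fun y => C * (1 + ‖y‖) ^ (-(r : ℝ)),
    (Measure.integrable_pow_neg_integrablePower _).const_mul C, fun x y => ?_⟩
  have h0 : ‖h (x, y)‖ ≤ SchwartzMap.seminorm ℝ 0 0 h := h.norm_le_seminorm ℝ _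
  have h1 : ‖y‖ ^ (0 + r) * ‖h (x, y)‖ ≤ SchwartzMap.seminorm ℝ r 0 h := by
    refine le_trans ?_ (h.norm_pow_mul_le_seminorm ℝ r (x, y))
    rw [zero_add]
    have : ‖y‖ ≤ ‖(x, y)‖ := le_max_right _ _
    gcongr
  have := pow_mul_le_of_le_of_pow_mul_le (norm_nonneg y) (norm_nonneg _) h0 h1
  simpa [C] using this

/-- The Fourier kernel `e^{-2πi⟨y, ξ⟩}`. -/
def fourierPhase (ξ y : V) : ℂ := Complex.exp (Complex.I * ((-(2 * Real.pi * inner ℝ y ξ) : ℝ) : ℂ))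

theorem norm_fourierPhase (ξ y : V) : ‖fourierPhase ξ y‖ = 1 := by
  rw [fourierPhase, mul_comm, Complex.norm_exp_ofReal_mul_I]

theorem continuous_fourierPhase (ξ : V) : Continuous (fourierPhase ξ) := by
  unfold fourierPhase; fun_prop

theorem integrable_integrand {F : Type} [NormedAddCommGroup F] [NormedSpace ℝ F] [NormedSpace ℂ F]
    (h : 𝓢(E × V, F)) (z : E × V) :
    Integrable fun y => fourierPhase z.2 y • h (z.1, y) := by
  obtain ⟨b, hb, hle⟩ := exists_integrable_bound h
  refine hb.mono' (((continuous_fourierPhase z.2).smul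
    (h.continuous.comp (Continuous.prodMk_right z.1))).aestronglyMeasurable) (.of_forall fun y => ?_)
  rw [norm_smul, norm_fourierPhase, one_mul]
  exact hle _ _

/-- The Fourier transform on Schwartz space and its inversion formula, for any real structure that is
compatible with the complex one. -/
theorem exists_fourier (F : Type) [NormedAddCommGroup F] [instR : NormedSpace ℝ F]
    [NormedSpace ℂ F] [IsScalarTower ℝ ℂ F] [CompleteSpace F] :
    ∃ T : 𝓢(V, F) →L[ℝ] 𝓢(V, F), (∀ f ξ, T f ξ = ∫ y, fourierPhase ξ y • f y) ∧
      ∀ f y, ∫ ξ, fourierPhase (-y) ξ • T f ξ = f y := by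
  obtain rfl : NormedSpace.complexToReal = instR := NormedSpace.restrictScalars_eq ℝ ℂ
  have key : ∀ (f : V → F) (ξ : V), 𝓕 f ξ = ∫ y, fourierPhase ξ y • f y := fun f ξ => by
    rw [Real.fourier_eq']
    refine integral_congr_ae (.of_forall fun y => ?_)
    simp only [fourierPhase]
    congr 2
    push_cast
    ring
  refine ⟨(FourierTransform.fourierCLE ℝ 𝓢(V, F) : 𝓢(V, F) →L[ℝ] 𝓢(V, F)), fun f ξ => ?_,
    fun f y => ?_⟩
  · rw [← key]; simp [SchwartzMap.fourier_coe]
  · rw [← key]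
    have h2 := congrArg (fun g : 𝓢(V, F) => g y) (FourierTransform.fourierInv_fourier_eq (F := 𝓢(V, F)) f)
    simp only [SchwartzMap.fourierInv_coe, Real.fourierInv_eq_fourier_neg] at h2
    simpa using h2

/-- The partial Fourier transform in the second variable, as a function. -/
def partialFourierFun (h : 𝓢(E × V, F)) (z : E × V) : F :=
  ∫ y, fourierPhase z.2 y • h (z.1, y)

/-- The derivative of `partialFourierFun h` is the partial Fourier transform of this function. -/
def fourierDerivCLM : 𝓢(E × V, F) →L[ℝ] 𝓢(E × V, E × V →L[ℝ] F) :=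
  (SchwartzMap.postcompCLM (𝕜 := ℝ) ((ContinuousLinearMap.compL ℝ (E × V) (E × V) F).flip
      ((ContinuousLinearMap.inl ℝ E V).comp (ContinuousLinearMap.fst ℝ E V)))).comp
    (fderivCLM ℝ (E × V) F) +
  (SchwartzMap.smulRightCLM ℝ F
    (((ContinuousLinearMap.compL ℝ (E × V) V ℝ).flip (ContinuousLinearMap.snd ℝ E V)).comp
      ((innerSL ℝ).comp (ContinuousLinearMap.snd ℝ E V)))).comp
    (SchwartzMap.postcompCLM (𝕜 := ℝ)
      ((ContinuousLinearMap.lsmul ℝ ℂ : ℂ →L[ℝ] F →L[ℝ] F) (-(2 * Real.pi) * Complex.I)))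

theorem fourierDerivCLM_apply (h : 𝓢(E × V, F)) (z w : E × V) :
    fourierDerivCLM h z w = fderiv ℝ h z (w.1, 0) +
      (inner ℝ z.2 w.2 : ℝ) • ((-(2 * Real.pi) * Complex.I : ℂ) • h z) := by
  simp [fourierDerivCLM]

theorem hasFDerivAt_integrand (h : 𝓢(E × V, F)) (y : V) (z : E × V) :
    HasFDerivAt (fun z : E × V => fourierPhase z.2 y • h (z.1, y))
      (fourierPhase z.2 y • fourierDerivCLM h (z.1, y)) z := by
  have h0 : HasFDerivAt (fun z : E × V => inner ℝ y z.2)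
      ((innerSL ℝ y).comp (ContinuousLinearMap.snd ℝ E V)) z :=
    ((innerSL ℝ y).comp (ContinuousLinearMap.snd ℝ E V)).hasFDerivAt
  have h1 : HasFDerivAt (fun z : E × V => fourierPhase z.2 y) _ z :=
    ((Complex.ofRealCLM.hasFDerivAt.comp z ((h0.const_mul (2 * Real.pi)).neg)).const_mul
      Complex.I).cexp
  have h2 : HasFDerivAt (fun z : E × V => h (z.1, y)) _ z :=
    (h.differentiableAt (x := (z.1, y))).hasFDerivAt.comp z
      (f := fun z : E × V => (z.1, y)) (hasFDerivAt_fst.prodMk (hasFDerivAt_const y z))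
  convert! h1.smul h2 using 1
  refine ContinuousLinearMap.ext fun w => ?_
  have e : ∀ (r : ℝ) (v : F), r • v = (r : ℂ) • v := fun r v => (algebraMap_smul ℂ r v).symm
  simp only [smul_apply, fourierDerivCLM_apply, fourierPhase, smul_add, e, smul_smul, add_apply,
    ContinuousLinearMap.smulRight_apply, ContinuousLinearMap.comp_apply]
  simp
  congr 1
  ring

theorem hasFDerivAt_partialFourierFun (h : 𝓢(E × V, F)) (z : E × V) :
    HasFDerivAt (partialFourierFun h) (partialFourierFun (fourierDerivCLM h) z) z := by
  obtain ⟨b, hb, hle⟩ := exists_integrable_bound (fourierDerivCLM h)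
  exact hasFDerivAt_integral_of_dominated_of_fderiv_le (μ := (volume : Measure V))
    (F := fun (z : E × V) y => fourierPhase z.2 y • h (z.1, y))
    (F' := fun z y => fourierPhase z.2 y • fourierDerivCLM h (z.1, y))
    (x₀ := z) (s := Set.univ) (bound := b) univ_mem
    (.of_forall fun z => (integrable_integrand h z).aestronglyMeasurable)
    (integrable_integrand h z) (integrable_integrand (fourierDerivCLM h) z).aestronglyMeasurable
    (.of_forall fun y z _ => by rw [norm_smul, norm_fourierPhase, one_mul]; exact hle _ _) hb
    (.of_forall fun y z _ => hasFDerivAt_integrand h y z)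

theorem continuous_seminorm {F : Type} [NormedAddCommGroup F] [NormedSpace ℝ F] (k n : ℕ) :
    Continuous (SchwartzMap.seminorm ℝ (E := E) (F := F) k n) :=
  (schwartz_withSeminorms ℝ E F).continuous_seminorm (k, n)

theorem continuous_seminorm_comp {X Y : Type} [AddCommGroup X] [Module ℝ X] [TopologicalSpace X]
    [AddCommGroup Y] [Module ℝ Y] [TopologicalSpace Y] (T : X →L[ℝ] Y) {q : Seminorm ℝ Y}
    (hq : Continuous q) : Continuous (q.comp (T : X →ₗ[ℝ] Y)) := hq.comp T.continuous

theorem coe_finsetSum_seminorm {X ι : Type} [AddCommGroup X] [Module ℝ X] (s : Finset ι)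
    (p : ι → Seminorm ℝ X) : ⇑(∑ i ∈ s, p i) = ∑ i ∈ s, ⇑(p i) :=
  map_sum (FunLike.coeAddMonoidHom (Seminorm ℝ X) X ℝ) p s

/-- A continuous seminorm of the slices is, together with any power of the fixed variable, bounded
by a continuous seminorm. -/
theorem exists_seminorm_slice_le {E' F : Type} [NormedAddCommGroup E'] [NormedSpace ℝ E']
    [NormedAddCommGroup F] [NormedSpace ℝ F] [NormedSpace ℂ F]
    (q : Seminorm ℝ 𝓢(E', F)) (hq : Continuous q) (m : ℕ) :
    ∃ q' : Seminorm ℝ 𝓢(E × E', F), Continuous q' ∧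
      ∀ h x, ‖x‖ ^ m * q (sliceLeft ℝ x h) ≤ q' h := by
  obtain ⟨s, C, -, hC⟩ := Seminorm.bound_of_continuous (schwartz_withSeminorms ℝ E' F) q hq
  refine ⟨C • ∑ i ∈ s, SchwartzMap.seminorm ℝ (m + i.1) i.2, ?_, fun h x => ?_⟩
  · have : (⇑(C • ∑ i ∈ s, SchwartzMap.seminorm ℝ (m + i.1) i.2 : Seminorm ℝ 𝓢(E × E', F))) =
        fun h => C • ∑ i ∈ s, SchwartzMap.seminorm ℝ (m + i.1) i.2 h := by
      ext h
      rw [smul_apply, coe_finsetSum_seminorm, Finset.sum_apply]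
    rw [this]
    exact (continuous_finsetSum _ fun i _ => continuous_seminorm (m + i.1) i.2).const_smul C
  · have h1 : q (sliceLeft ℝ x h) ≤ C * ∑ i ∈ s, SchwartzMap.seminorm ℝ i.1 i.2 (sliceLeft ℝ x h) := by
      refine (hC _).trans ?_
      have := Seminorm.finset_sup_le_sum (schwartzSeminormFamily ℝ E' F) s (sliceLeft ℝ x h)
      rw [coe_finsetSum_seminorm, Finset.sum_apply] at this
      exact mul_le_mul_of_nonneg_left this C.2
    refine (mul_le_mul_of_nonneg_left h1 (by positivity)).trans ?_
    rw [smul_apply, coe_finsetSum_seminorm, Finset.sum_apply, NNReal.smul_def, smul_eq_mul, mul_left_comm]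
    refine mul_le_mul_of_nonneg_left ?_ C.2
    rw [Finset.mul_sum]
    exact Finset.sum_le_sum fun i _ => pow_mul_seminorm_sliceLeft_le h m i.1 i.2 x

theorem norm_pow_le_add {E' : Type} [NormedAddCommGroup E'] (z : E × E') (k : ℕ) :
    ‖z‖ ^ k ≤ ‖z.1‖ ^ k + ‖z.2‖ ^ k := by
  rw [Prod.norm_def]
  rcases max_cases ‖z.1‖ ‖z.2‖ with h | h <;> rw [h.1] <;>
    linarith [pow_nonneg (norm_nonneg z.1) k, pow_nonneg (norm_nonneg z.2) k]

theorem contDiff_partialFourierFun (n : ℕ) : ∀ {F : Type} [NormedAddCommGroup F] [NormedSpace ℝ F]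
    [NormedSpace ℂ F] [IsScalarTower ℝ ℂ F] [SMulCommClass ℝ ℂ F] (h : 𝓢(E × V, F)),
    ContDiff ℝ n (partialFourierFun h) := by
  induction n with
  | zero =>
    intro F _ _ _ _ _ h
    rw [Nat.cast_zero, contDiff_zero]
    exact continuous_iff_continuousAt.2 fun z => (hasFDerivAt_partialFourierFun h z).continuousAt
  | succ n ih =>
    intro F _ _ _ _ _ h
    exact_mod_cast contDiff_succ_iff_hasFDerivAt.2
      ⟨_, ih (fourierDerivCLM h), hasFDerivAt_partialFourierFun h⟩

/-- Continuity of the partial Fourier transform. At order `0` the Fourier transform of the slices is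
estimated, with powers of the fixed variable; higher orders reduce to this for the function
`fourierDerivCLM h`, with values in a larger space. -/
theorem exists_seminorm_partialFourierFun_le (k n : ℕ) : ∀ {F : Type} [NormedAddCommGroup F]
    [NormedSpace ℝ F] [NormedSpace ℂ F] [IsScalarTower ℝ ℂ F] [SMulCommClass ℝ ℂ F]
    [CompleteSpace F],
    ∃ q : Seminorm ℝ 𝓢(E × V, F), Continuous q ∧
      ∀ h z, ‖z‖ ^ k * ‖iteratedFDeriv ℝ n (partialFourierFun h) z‖ ≤ q h := by
  induction n with
  | zero =>
    intro F _ _ _ _ _ _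
    obtain ⟨T, hT, -⟩ := exists_fourier (V := V) F
    obtain ⟨q₁, hq₁, h₁⟩ := exists_seminorm_slice_le (E := E)
      _ (continuous_seminorm_comp T (continuous_seminorm 0 0)) k
    obtain ⟨q₂, hq₂, h₂⟩ := exists_seminorm_slice_le (E := E)
      _ (continuous_seminorm_comp T (continuous_seminorm k 0)) 0
    refine ⟨q₁ + q₂, hq₁.add hq₂, fun h z => ?_⟩
    have e : partialFourierFun h z = T (sliceLeft ℝ z.1 h) z.2 := (hT (sliceLeft ℝ z.1 h) z.2).symm
    rw [norm_iteratedFDeriv_zero, e]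
    refine (mul_le_mul_of_nonneg_right (norm_pow_le_add z k) (norm_nonneg _)).trans ?_
    rw [add_mul]
    refine add_le_add ((mul_le_mul_of_nonneg_left ((T (sliceLeft ℝ z.1 h)).norm_le_seminorm ℝ z.2)
      (by positivity)).trans (h₁ h z.1)) (le_trans ?_ (h₂ h z.1))
    rw [pow_zero, one_mul]
    exact (T (sliceLeft ℝ z.1 h)).norm_pow_mul_le_seminorm ℝ k z.2
  | succ n ih =>
    intro F _ _ _ _ _ _
    obtain ⟨q, hq, h⟩ := ih (F := E × V →L[ℝ] F)
    refine ⟨_, continuous_seminorm_comp fourierDerivCLM hq, fun f z => ?_⟩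
    have e : fderiv ℝ (partialFourierFun f) = partialFourierFun (fourierDerivCLM f) :=
      funext fun z => (hasFDerivAt_partialFourierFun f z).fderiv
    rw [← norm_iteratedFDeriv_fderiv, e]
    exact h _ z

variable [CompleteSpace F]

/-- The partial Fourier transform `(x, ξ) ↦ ∫ dy e^{-2πi⟨y, ξ⟩} h(x, y)`. -/
def partialFourier : 𝓢(E × V, F) →L[ℂ] 𝓢(E × V, F) :=
  let T : 𝓢(E × V, F) →L[ℝ] 𝓢(E × V, F) := by
    refine SchwartzMap.mkCLM partialFourierFun (fun f g z => ?_) (fun a f z => ?_)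
      (fun f => contDiff_infty.2 fun n => contDiff_partialFourierFun n f) fun n => ?_
    · simp only [partialFourierFun, add_apply, smul_add]
      exact integral_add (integrable_integrand f z) (integrable_integrand g z)
    · simp only [partialFourierFun, smul_apply, RingHom.id_apply]
      rw [← integral_smul]
      exact integral_congr_ae (.of_forall fun y => smul_comm _ _ _)
    · obtain ⟨q, hq, h⟩ := exists_seminorm_partialFourierFun_le (E := E) (V := V) (F := F) n.1 n.2
      obtain ⟨s, C, -, hC⟩ := Seminorm.bound_of_continuous (schwartz_withSeminorms ℝ (E × V) F) q hq
      exact ⟨s, C, C.2, fun f z => (h f z).trans (hC f)⟩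
  { toFun := T
    map_add' := T.map_add
    map_smul' := fun a f => by
      ext z
      change partialFourierFun (a • f) z = a • partialFourierFun f z
      simp only [partialFourierFun, smul_apply]
      rw [← integral_smul]
      exact integral_congr_ae (.of_forall fun y => smul_comm _ _ _)
    cont := T.continuous }

theorem partialFourier_apply (h : 𝓢(E × V, F)) (z : E × V) :
    partialFourier h z = ∫ y, fourierPhase z.2 y • h (z.1, y) := rfl

/-- Reflection of the second variable. -/
def reflectSnd : 𝓢(E × V, F) →L[ℂ] 𝓢(E × V, F) :=
  compCLMOfContinuousLinearEquiv ℂ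
    ((ContinuousLinearEquiv.refl ℝ E).prodCongr (ContinuousLinearEquiv.neg ℝ))

@[simp]
theorem reflectSnd_apply (h : 𝓢(E × V, F)) (z : E × V) : reflectSnd h z = h (z.1, -z.2) := rfl

/-- The inverse of the partial Fourier transform: the transform, reflected in the frequency. -/
def partialFourierInv : 𝓢(E × V, F) →L[ℂ] 𝓢(E × V, F) := reflectSnd.comp partialFourier

theorem partialFourierInv_apply (h : 𝓢(E × V, F)) (z : E × V) :
    partialFourierInv h z = ∫ y, fourierPhase (-z.2) y • h (z.1, y) := rfl

theorem partialFourierInv_partialFourier (h : 𝓢(E × V, F)) :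
    partialFourierInv (partialFourier h) = h := by
  ext z
  obtain ⟨T, hT, hT'⟩ := exists_fourier (V := V) F
  have := hT' (sliceLeft ℝ z.1 h) z.2
  simp only [hT] at this
  exact this

theorem partialFourier_partialFourierInv (h : 𝓢(E × V, F)) :
    partialFourier (partialFourierInv h) = h := by
  refine Eq.trans ?_ (partialFourierInv_partialFourier h)
  ext z
  rw [partialFourierInv_apply, partialFourier_apply, ← integral_neg_eq_self]
  refine integral_congr_ae (.of_forall fun y => ?_)
  simp [partialFourierInv, fourierPhase]

/-- Integration over the second variable: the partial Fourier transform at frequency zero. -/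
def partialIntegral : 𝓢(E × V, F) →L[ℂ] 𝓢(E, F) := (sliceRight ℂ 0).comp partialFourier

theorem partialIntegral_apply (h : 𝓢(E × V, F)) (x : E) :
    partialIntegral h x = ∫ y, h (x, y) := by
  change partialFourier h (x, 0) = _
  simp [partialFourier_apply, fourierPhase]

end PartialFourier

open scoped BoundedContinuousFunction

/-! ### Continuous functionals and partial integrals -/

section Exchange

variable {E V : Type} [NormedAddCommGroup E] [NormedSpace ℝ E]
  [NormedAddCommGroup V] [InnerProductSpace ℝ V] [FiniteDimensional ℝ V]
  [MeasurableSpace V] [BorelSpace V]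

/-- The values of a continuous linear map on the slices of a Schwartz function are integrable. -/
theorem integrable_sliceRight {F B : Type} [NormedAddCommGroup F] [NormedSpace ℝ F]
    [NormedSpace ℂ F] [NormedAddCommGroup B] [NormedSpace ℂ B]
    (J : 𝓢(E, F) →L[ℂ] B) (H : 𝓢(E × V, F)) :
    Integrable fun v => J (sliceRight ℂ v H) := by
  have hc : Continuous fun v => J (sliceRight ℂ v H) :=
    J.continuous.comp (continuous_sliceRight H)
  set q : Seminorm ℝ 𝓢(E, F) := ((normSeminorm ℂ B).comp (J : 𝓢(E, F) →ₗ[ℂ] B)).restrictScalars ℝ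
  have hq : Continuous q := continuous_norm.comp J.continuous
  set r := (volume : Measure V).integrablePower
  obtain ⟨q₀, -, h₀⟩ := exists_seminorm_slice_le (E := V) q hq 0
  obtain ⟨q₁, -, h₁⟩ := exists_seminorm_slice_le (E := V) q hq r
  set C := 2 ^ r * (q₀ (swapCLM H) + q₁ (swapCLM H))
  refine ((Measure.integrable_pow_neg_integrablePower _).const_mul C).mono'
    hc.aestronglyMeasurable (.of_forall fun v => ?_)
  have e₀ := h₀ (swapCLM H) v
  have e₁ := h₁ (swapCLM H) v
  change _ * ‖J (sliceRight ℂ v H)‖ ≤ _ at e₀ e₁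
  have := pow_mul_le_of_le_of_pow_mul_le (k := 0) (l := r) (norm_nonneg v) (norm_nonneg _)
    (f := ‖J (sliceRight ℂ v H)‖) (by simpa using e₀) (by simpa using e₁)
  simpa [C] using this

/-- Differentiation under a partial integral, with the differentiated integrand as a Schwartz
function. -/
theorem fderivCLM_partialIntegral {F : Type} [NormedAddCommGroup F] [NormedSpace ℝ F]
    [NormedSpace ℂ F] [IsScalarTower ℝ ℂ F] [SMulCommClass ℝ ℂ F] [CompleteSpace F]
    (H : 𝓢(E × V, F)) :
    ∃ H' : 𝓢(E × V, E →L[ℝ] F), (∀ v, sliceRight ℂ v H' = fderivCLM ℂ E F (sliceRight ℂ v H)) ∧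
      partialIntegral H' = fderivCLM ℂ E F (partialIntegral H) := by
  set L : (E × V →L[ℝ] F) →L[ℝ] (E →L[ℝ] F) :=
    (ContinuousLinearMap.compL ℝ E (E × V) F).flip (ContinuousLinearMap.inl ℝ E V) with hL
  set H' : 𝓢(E × V, E →L[ℝ] F) := SchwartzMap.postcompCLM (𝕜 := ℝ) L (fourierDerivCLM H) with hH'
  have hH'a : ∀ z, H' z = (fderiv ℝ H z).comp (ContinuousLinearMap.inl ℝ E V) := fun z => by
    ext w
    change fourierDerivCLM H z (w, 0) = _
    rw [fourierDerivCLM_apply]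
    simp
  refine ⟨H', fun v => ?_, ?_⟩
  · ext1 x
    rw [sliceRight_apply, hH'a, fderivCLM_apply]
    exact ((H.differentiableAt (x := (x, v))).hasFDerivAt.comp x
      (hasFDerivAt_prodMk_left x v)).fderiv.symm
  · ext1 x
    rw [fderivCLM_apply, partialIntegral_apply]
    have h1 : HasFDerivAt (partialIntegral H)
        ((partialFourierFun (fourierDerivCLM H) (x, 0)).comp (ContinuousLinearMap.inl ℝ E V)) x :=
      HasFDerivAt.comp (g := partialFourierFun H) (f := fun x : E => (x, (0 : V))) x
        (hasFDerivAt_partialFourierFun H (x, 0)) (hasFDerivAt_prodMk_left x (0 : V))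
    rw [h1.fderiv]
    change _ = L (∫ y, fourierPhase (0 : V) y • fourierDerivCLM H (x, y))
    refine Eq.trans ?_ (ContinuousLinearMap.integral_comp_comm (𝕜 := ℝ) L
      (integrable_integrand (fourierDerivCLM H) (x, 0)))
    refine integral_congr_ae (.of_forall fun y => ?_)
    simp [fourierPhase, hH']

/-- The Schwartz seminorms are dominated by norms of linear maps into Banach spaces that commute
with partial integration. -/
theorem exists_dominating_clm (k n : ℕ) : ∀ (F : Type) [NormedAddCommGroup F] [NormedSpace ℝ F]
    [NormedSpace ℂ F] [IsScalarTower ℝ ℂ F] [SMulCommClass ℝ ℂ F] [CompleteSpace F],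
    ∃ (B : Type) (_ : NormedAddCommGroup B) (_ : NormedSpace ℂ B) (_ : CompleteSpace B)
      (J : 𝓢(E, F) →L[ℂ] B),
      (∀ k' ≤ k, ∀ n' ≤ n, ∀ f, SchwartzMap.seminorm ℝ k' n' f ≤ ‖J f‖) ∧
      ∀ H : 𝓢(E × V, F), J (partialIntegral H) = ∫ v, J (sliceRight ℂ v H) := by
  induction n with
  | zero =>
    -- the weighted sup norm `sup (1 + ‖z‖) ^ k ‖f z‖` is the norm of a map to bounded functions
    intro F _ instR _ _ _ _
    obtain rfl : NormedSpace.complexToReal = instR := NormedSpace.restrictScalars_eq ℝ ℂ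
    have hbd : ∀ (f : 𝓢(E, F)) z, ‖((1 + ‖z‖) ^ k : ℝ) • f z‖ ≤
        2 ^ k * ((Finset.Iic (k, 0)).sup fun m => SchwartzMap.seminorm ℂ m.1 m.2) f := fun f z => by
      rw [norm_smul, Real.norm_of_nonneg (by positivity)]
      simpa using one_add_le_sup_seminorm_apply (𝕜 := ℂ) (m := (k, 0)) (k := k) (n := 0) le_rfl
        le_rfl f z
    set J : 𝓢(E, F) →L[ℂ] (E →ᵇ F) := SchwartzMap.mkCLMtoNormedSpace
      (fun f => BoundedContinuousFunction.ofNormedAddCommGroup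
        (fun z => ((1 + ‖z‖) ^ k : ℝ) • f z)
        ((continuous_const.add continuous_norm).pow k |>.smul f.continuous) _ (hbd f))
      (fun f g => by ext z; simp)
      (fun a f => by ext z; exact smul_comm _ _ _)
      ⟨Finset.Iic (k, 0), 2 ^ k, by positivity, fun f =>
        (BoundedContinuousFunction.norm_le (by positivity)).2 (hbd f)⟩ with hJ
    have hJa : ∀ f z, J f z = ((1 + ‖z‖) ^ k : ℝ) • f z := fun f z => rfl
    refine ⟨E →ᵇ F, inferInstance, inferInstance, inferInstance, J, fun k' hk n' hn f => ?_,
      fun H => ?_⟩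
    · obtain rfl : n' = 0 := by omega
      refine SchwartzMap.seminorm_le_bound ℝ k' 0 _ (norm_nonneg _) fun z => ?_
      rw [norm_iteratedFDeriv_zero]
      refine le_trans ?_ ((J f).norm_coe_le_norm z)
      rw [hJa, norm_smul, Real.norm_of_nonneg (by positivity)]
      gcongr
      calc ‖z‖ ^ k' ≤ (1 + ‖z‖) ^ k' := by gcongr; linarith [norm_nonneg z]
        _ ≤ (1 + ‖z‖) ^ k := pow_le_pow_right₀ (by linarith [norm_nonneg z]) hk
    · ext z
      have h1 := (BoundedContinuousFunction.evalCLM ℂ z).integral_comp_comm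
        (integrable_sliceRight J H)
      simp only [BoundedContinuousFunction.evalCLM_apply, hJa, sliceRight_apply] at h1
      rw [← h1, hJa, partialIntegral_apply, integral_smul]
  | succ n ih =>
    -- a derivative is dealt with by pairing the maps for `f` and for `fderiv f`
    intro F _ _ _ _ _ _
    obtain ⟨B₁, i₁, j₁, k₁, J₁, hle₁, h₁⟩ := ih F
    obtain ⟨B₂, i₂, j₂, k₂, J₂, hle₂, h₂⟩ := ih (E →L[ℝ] F)
    refine ⟨B₁ × B₂, inferInstance, inferInstance, inferInstance,
      J₁.prod (J₂.comp (fderivCLM ℂ E F)), fun k' hk n' hn f => ?_, fun H => ?_⟩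
    · rcases Nat.lt_or_ge n n' with h | h
      · obtain rfl : n' = n + 1 := by omega
        refine le_trans ?_ (le_max_right _ _)
        refine le_trans ?_ (hle₂ k' hk n le_rfl (fderivCLM ℂ E F f))
        refine SchwartzMap.seminorm_le_bound ℝ k' (n + 1) _ (by positivity) fun z => ?_
        rw [← norm_iteratedFDeriv_fderiv]
        exact (fderivCLM ℂ E F f).le_seminorm ℝ k' n z
      · exact (hle₁ k' hk n' h f).trans (le_max_left _ _)
    · obtain ⟨H', hs, hI⟩ := fderivCLM_partialIntegral H
      refine Prod.ext ?_ ?_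
      · rw [fst_integral (integrable_sliceRight _ H)]
        exact h₁ H
      · rw [snd_integral (integrable_sliceRight _ H)]
        change J₂ (fderivCLM ℂ E F (partialIntegral H)) = ∫ v, J₂ (fderivCLM ℂ E F (sliceRight ℂ v H))
        rw [← hI, h₂ H']
        simp only [hs]

/-- A continuous functional may be applied under a partial integral. Schwartz space is not a normed
space, so the Bochner integral is formed in a Banach space through which the functional factors. -/
theorem map_partialIntegral {F : Type} [NormedAddCommGroup F] [NormedSpace ℝ F]
    [NormedSpace ℂ F] [IsScalarTower ℝ ℂ F] [SMulCommClass ℝ ℂ F] [CompleteSpace F]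
    (T : 𝓢(E, F) →L[ℂ] ℂ) (H : 𝓢(E × V, F)) :
    T (partialIntegral H) = ∫ v, T (sliceRight ℂ v H) := by
  set q : Seminorm ℝ 𝓢(E, F) := ((normSeminorm ℂ ℂ).comp (T : 𝓢(E, F) →ₗ[ℂ] ℂ)).restrictScalars ℝ
  have hq : Continuous q := continuous_norm.comp T.continuous
  obtain ⟨s, C, -, hC⟩ := Seminorm.bound_of_continuous (schwartz_withSeminorms ℝ E F) q hq
  obtain ⟨B, _, _, _, J, hle, hJ⟩ := exists_dominating_clm (E := E) (V := V)
    (s.sup Prod.fst) (s.sup Prod.snd) F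
  have hT : ∀ f, ‖T f‖ ≤ C * ‖J f‖ := fun f => by
    refine (hC f).trans (mul_le_mul_of_nonneg_left ?_ C.2)
    refine Seminorm.finset_sup_apply_le (norm_nonneg _) fun i hi => ?_
    exact hle _ (Finset.le_sup (f := Prod.fst) hi) _ (Finset.le_sup (f := Prod.snd) hi) f
  -- `T` factors through the range of `J`, and the factor extends to all of `B`
  set J₀ : 𝓢(E, F) →ₗ[ℂ] B := (J : 𝓢(E, F) →ₗ[ℂ] B)
  have hker : LinearMap.ker J₀ ≤ LinearMap.ker (T : 𝓢(E, F) →ₗ[ℂ] ℂ) := fun f hf => by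
    have : J f = 0 := hf
    have h2 := hT f
    rw [this, norm_zero, mul_zero] at h2
    exact norm_le_zero_iff.1 h2
  set T₀ : LinearMap.range J₀ →ₗ[ℂ] ℂ :=
    ((LinearMap.ker J₀).liftQ (T : 𝓢(E, F) →ₗ[ℂ] ℂ) hker).comp J₀.quotKerEquivRange.symm.toLinearMap
  have hT₀ : ∀ f, T₀ ⟨J f, f, rfl⟩ = T f := fun f => by
    have : J₀.quotKerEquivRange.symm ⟨J f, f, rfl⟩ = (LinearMap.ker J₀).mkQ f := by
      rw [LinearEquiv.symm_apply_eq]; rfl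
    change (LinearMap.ker J₀).liftQ _ hker (J₀.quotKerEquivRange.symm ⟨J f, f, rfl⟩) = _
    rw [this]; rfl
  obtain ⟨T₁, hT₁, -⟩ := exists_extension_norm_eq (𝕜 := ℂ) (LinearMap.range J₀)
    (T₀.mkContinuous C (by rintro ⟨-, f, rfl⟩; exact (congrArg norm (hT₀ f)).le.trans (hT f)))
  have key : ∀ f, T₁ (J f) = T f := fun f => (hT₁ ⟨J f, f, rfl⟩).trans (hT₀ f)
  rw [← key, hJ, ← T₁.integral_comp_comm (integrable_sliceRight J H)]
  simp only [key]

end Exchange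

/-! ### Density of tensor products -/

theorem hasTemperateGrowth_inner {X V : Type} [NormedAddCommGroup X] [NormedSpace ℝ X]
    [NormedAddCommGroup V] [InnerProductSpace ℝ V] {f g : X → V} (hf : f.HasTemperateGrowth)
    (hg : g.HasTemperateGrowth) : (fun x => inner ℝ (f x) (g x)).HasTemperateGrowth :=
  (innerSL ℝ (E := V)).bilinear_hasTemperateGrowth hf hg

theorem hasTemperateGrowth_fst {X Y : Type} [NormedAddCommGroup X] [NormedSpace ℝ X]
    [NormedAddCommGroup Y] [NormedSpace ℝ Y] : (Prod.fst : X × Y → X).HasTemperateGrowth :=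
  (ContinuousLinearMap.fst ℝ X Y).hasTemperateGrowth

theorem hasTemperateGrowth_snd {X Y : Type} [NormedAddCommGroup X] [NormedSpace ℝ X]
    [NormedAddCommGroup Y] [NormedSpace ℝ Y] : (Prod.snd : X × Y → Y).HasTemperateGrowth :=
  (ContinuousLinearMap.snd ℝ X Y).hasTemperateGrowth

section TensorDensity

variable {E V : Type} [NormedAddCommGroup E] [NormedSpace ℝ E]
  [NormedAddCommGroup V] [InnerProductSpace ℝ V] [FiniteDimensional ℝ V]
  [MeasurableSpace V] [BorelSpace V]

theorem exists_schwartz_eq_one (V : Type) [NormedAddCommGroup V] [InnerProductSpace ℝ V]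
    [FiniteDimensional ℝ V] : ∃ g : 𝓢(V, ℂ), g 0 = 1 := by
  let b : ContDiffBump (0 : V) := ⟨1, 2, one_pos, one_lt_two⟩
  have h1 : HasCompactSupport (fun x => (b x : ℂ)) :=
    b.hasCompactSupport.comp_left (g := Complex.ofReal) Complex.ofReal_zero
  refine ⟨h1.toSchwartzMap (Complex.ofRealCLM.contDiff.comp b.contDiff), ?_⟩
  exact congrArg Complex.ofReal (b.one_of_mem_closedBall (Metric.mem_closedBall_self zero_le_one))

/-- Fourier inversion writes `g(y) h(x, y)` as an integral over `η` of the products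
`F₂h(x, η) · e^{2πi⟨η, y⟩} g(y)`, where `F₂h` is the partial Fourier transform in the second
variable. -/
theorem map_mul_eq_zero_of_tensor (T : 𝓢(E × V, ℂ) →L[ℂ] ℂ)
    (hT : ∀ (t : 𝓢(E × V, ℂ)) (φ : 𝓢(E, ℂ)) (g : 𝓢(V, ℂ)), (∀ z, t z = φ z.1 * g z.2) → T t = 0)
    (h t : 𝓢(E × V, ℂ)) (g : 𝓢(V, ℂ)) (ht : ∀ z, t z = g z.2 * h z) : T t = 0 := by
  -- the exchange `((x, y), η) ↦ ((x, η), y)`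
  set e : (E × V) × V →L[ℝ] (E × V) × V :=
    ((((ContinuousLinearMap.fst ℝ E V).comp (ContinuousLinearMap.fst ℝ (E × V) V)).prod
      (ContinuousLinearMap.snd ℝ (E × V) V)).prod
      ((ContinuousLinearMap.snd ℝ E V).comp (ContinuousLinearMap.fst ℝ (E × V) V))) with he
  set H₀ : 𝓢((E × V) × V, ℂ) := SchwartzMap.compCLM ℂ (g := e) e.hasTemperateGrowth
    ⟨1, 1, fun z => by
      have : ‖z‖ = ‖e z‖ := by
        simp only [he, Prod.norm_def, ContinuousLinearMap.prod_apply,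
          ContinuousLinearMap.comp_apply, ContinuousLinearMap.coe_fst', ContinuousLinearMap.coe_snd']
        rw [max_assoc, max_assoc, max_comm ‖z.1.2‖]
      simp only [pow_one, one_mul]
      linarith⟩ (tensorCLM (partialFourier h) g) with hH₀
  have hp : (fun z : (E × V) × V => fourierPhase (-z.1.2) z.2).HasTemperateGrowth :=
    hasTemperateGrowth_cexp (f := fun z : (E × V) × V => -(2 * Real.pi * inner ℝ z.2 (-z.1.2)))
      (((Function.HasTemperateGrowth.const (2 * Real.pi)).mul (hasTemperateGrowth_inner
        hasTemperateGrowth_snd (hasTemperateGrowth_snd.comp hasTemperateGrowth_fst).neg)).neg)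
  have hH : ∀ x y η, SchwartzMap.smulLeftCLM ℂ (fun z : (E × V) × V => fourierPhase (-z.1.2) z.2) H₀
      ((x, y), η) = fourierPhase (-y) η * (partialFourier h (x, η) * g y) := fun x y η => by
    rw [SchwartzMap.smulLeftCLM_apply_apply hp]; rfl
  set H := SchwartzMap.smulLeftCLM ℂ (fun z : (E × V) × V => fourierPhase (-z.1.2) z.2) H₀
  have h1 : partialIntegral H = t := by
    ext ⟨x, y⟩
    have h2 : partialFourierInv (partialFourier h) (x, y) = h (x, y) := by
      rw [partialFourierInv_partialFourier]
    rw [partialIntegral_apply, ht, ← h2, partialFourierInv_apply, ← integral_const_mul]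
    refine integral_congr_ae (.of_forall fun η => ?_)
    simp only [hH, smul_eq_mul]
    ring
  rw [← h1, map_partialIntegral]
  refine integral_eq_zero_of_ae (.of_forall fun η => ?_)
  have hpη : (fun y : V => fourierPhase (-y) η).HasTemperateGrowth :=
    hasTemperateGrowth_cexp (f := fun y : V => -(2 * Real.pi * inner ℝ η (-y)))
      (((Function.HasTemperateGrowth.const (2 * Real.pi)).mul (hasTemperateGrowth_inner
        (.const η) (Function.HasTemperateGrowth.id'.neg))).neg)
  refine hT _ (sliceRight ℂ η (partialFourier h))
    (SchwartzMap.smulLeftCLM ℂ (fun y : V => fourierPhase (-y) η) g) fun z => ?_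
  rw [SchwartzMap.smulLeftCLM_apply_apply hpη, sliceRight_apply, hH, sliceRight_apply, smul_eq_mul]
  ring

/-- The tensor products of Schwartz functions span a dense subspace: a continuous functional that
vanishes on them is zero. -/
theorem eq_zero_of_tensor (T : 𝓢(E × V, ℂ) →L[ℂ] ℂ)
    (hT : ∀ (t : 𝓢(E × V, ℂ)) (φ : 𝓢(E, ℂ)) (g : 𝓢(V, ℂ)), (∀ z, t z = φ z.1 * g z.2) → T t = 0) :
    T = 0 := by
  ext h
  -- the slice of `K((x, y), ε) = g(ε y) h(x, y) χ(ε)` at `ε ≠ 0` is `h` times a Schwartz function of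
  -- `y`; at `ε = 0` it is `h`
  obtain ⟨g, hg⟩ := exists_schwartz_eq_one V
  obtain ⟨χ, hχ⟩ := exists_schwartz_eq_one ℝ
  have hp : (fun z : (E × V) × ℝ => g (z.2 • z.1.2)).HasTemperateGrowth :=
    g.hasTemperateGrowth.comp (f := fun z : (E × V) × ℝ => z.2 • z.1.2)
      ((ContinuousLinearMap.lsmul ℝ ℝ).bilinear_hasTemperateGrowth hasTemperateGrowth_snd
        (hasTemperateGrowth_snd.comp hasTemperateGrowth_fst))
  set K : 𝓢((E × V) × ℝ, ℂ) := SchwartzMap.smulLeftCLM ℂ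
    (fun z : (E × V) × ℝ => g (z.2 • z.1.2)) (tensorCLM h χ)
  have hK : ∀ z ε, K (z, ε) = g (ε • z.2) * (h z * χ ε) := fun z ε => by
    simp only [K]
    rw [SchwartzMap.smulLeftCLM_apply_apply hp]; rfl
  have hc : Continuous fun ε => T (sliceRight ℂ ε K) :=
    T.continuous.comp (continuous_sliceRight K)
  have h0 : ∀ ε ≠ 0, T (sliceRight ℂ ε K) = 0 := fun ε hε => by
    refine map_mul_eq_zero_of_tensor T hT h _ (χ ε • SchwartzMap.compCLMOfContinuousLinearEquiv ℂ
      (ContinuousLinearEquiv.smulLeft (Units.mk0 ε hε)) g) fun z => ?_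
    rw [sliceRight_apply, hK]
    change _ = (χ ε * g (ε • z.2)) * h z
    ring
  have h1 : T (sliceRight ℂ 0 K) = 0 := by
    have hcl : IsClosed {ε : ℝ | T (sliceRight ℂ ε K) = 0} := isClosed_eq hc continuous_const
    have hd : Dense ({0}ᶜ : Set ℝ) := dense_compl_singleton 0
    exact hcl.closure_subset_iff.2 (fun ε hε => h0 ε hε) (hd 0)
  have h2 : sliceRight ℂ 0 K = h := by
    ext z
    rw [sliceRight_apply, hK]
    simp [hg, hχ]
  rw [h2] at h1
  simpa using h1

end TensorDensity

/-! ### Weak density of Schwartz functions in tempered distributions -/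

section WeakDensity

variable {E : Type} [NormedAddCommGroup E] [NormedSpace ℝ E] [MeasureSpace E] [BorelSpace E]
  [SecondCountableTopology E] [(volume : Measure E).HasTemperateGrowth]
  [(volume : Measure E).IsOpenPosMeasure]

theorem eq_zero_of_integral_mul_eq_zero (φ : 𝓢(E, ℂ)) (h : ∀ g : 𝓢(E, ℂ), ∫ z, φ z * g z = 0) :
    φ = 0 := by
  -- test with the complex conjugate of `φ`
  set g : 𝓢(E, ℂ) := SchwartzMap.postcompCLM (𝕜 := ℝ) (Complex.conjCLE : ℂ →L[ℝ] ℂ) φ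
  have h1 : ∫ z, ‖φ z‖ ^ 2 = 0 := by
    have h2 := h g
    have h3 : ∀ z, φ z * g z = ((‖φ z‖ ^ 2 : ℝ) : ℂ) := fun z => by
      push_cast
      exact Complex.mul_conj' _
    simp only [h3] at h2
    rw [integral_complex_ofReal] at h2
    exact_mod_cast h2
  have h2 : Integrable fun z => ‖φ z‖ ^ 2 := by
    have := (φ.memLp 2 volume).integrable_norm_pow (by norm_num)
    simpa using this
  rw [integral_eq_zero_iff_of_nonneg (fun z => by positivity) h2] at h1
  have h3 := (Continuous.ae_eq_iff_eq (volume : Measure E) (by fun_prop) continuous_const).1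
    (h1 : (fun z => ‖φ z‖ ^ 2) =ᵐ[volume] fun _ => 0)
  ext z
  have h4 : ‖φ z‖ ^ 2 = 0 := congrFun h3 z
  simpa using h4

/-- A tempered distribution agrees with a Schwartz function on any finite set of test functions. -/
theorem exists_schwartz_eq_on_finite {F : Type} [NormedAddCommGroup F] [NormedSpace ℂ F] [CompleteSpace F]
    (T : 𝓢'(E, F)) {S : Set 𝓢(E, ℂ)} (hS : S.Finite) :
    ∃ g : 𝓢(E, F), ∀ φ ∈ S, toTemperedDistributionCLM E F volume g φ = T φ := by
  set M := Submodule.span ℂ S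
  have : FiniteDimensional ℂ M := FiniteDimensional.span_of_finite ℂ hS
  set B : 𝓢(E, ℂ) →ₗ[ℂ] Module.Dual ℂ M := LinearMap.mk₂ ℂ
    (fun g (φ : M) => toTemperedDistributionCLM E ℂ volume g φ.1)
    (fun g g' φ => by rw [map_add]; rfl) (fun a g φ => by rw [map_smul]; rfl)
    (fun g φ φ' => by rw [Submodule.coe_add, map_add])
    (fun a g φ => by rw [Submodule.coe_smul, map_smul]) with hB
  -- Schwartz functions separate the points of the finite-dimensional span `M`, so that they realize
  -- every functional on it
  have hinj : Function.Injective B.flip := by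
    rw [injective_iff_map_eq_zero]
    intro φ hφ
    refine Subtype.ext (eq_zero_of_integral_mul_eq_zero φ.1 fun g => ?_)
    have := LinearMap.congr_fun hφ g
    rw [LinearMap.flip_apply] at this
    simpa [hB] using this
  have hsurj : Function.Surjective B := LinearMap.flip_injective_iff₂.1 hinj
  set b := Module.finBasis ℂ M
  choose g hg using fun i => hsurj (b.coord i)
  refine ⟨∑ i, SchwartzMap.postcompCLM (𝕜 := ℝ)
    (((ContinuousLinearMap.id ℂ ℂ).smulRight (T (b i).1)).restrictScalars ℝ) (g i), fun φ hφ => ?_⟩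
  have h1 : φ = ((∑ i, b.repr ⟨φ, Submodule.subset_span hφ⟩ i • b i : M) : 𝓢(E, ℂ)) := by
    rw [b.sum_repr]
  have h2 : ∀ i, toTemperedDistributionCLM E F volume (SchwartzMap.postcompCLM (𝕜 := ℝ)
      (((ContinuousLinearMap.id ℂ ℂ).smulRight (T (b i).1)).restrictScalars ℝ) (g i)) φ =
        b.repr ⟨φ, Submodule.subset_span hφ⟩ i • T (b i).1 := fun i => by
    have h3 : toTemperedDistributionCLM E ℂ volume (g i) φ =
        b.repr ⟨φ, Submodule.subset_span hφ⟩ i :=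
      LinearMap.congr_fun (hg i) ⟨φ, Submodule.subset_span hφ⟩
    have h4 : ∫ z, φ z • g i z = b.repr ⟨φ, Submodule.subset_span hφ⟩ i :=
      (toTemperedDistributionCLM_apply_apply volume (g i) φ).symm.trans h3
    refine (toTemperedDistributionCLM_apply_apply volume _ φ).trans ?_
    rw [← h4, ← integral_smul_const]
    refine integral_congr_ae (.of_forall fun z => ?_)
    simp [smul_smul]
  rw [map_sum]
  have h4 : ∀ (s : Finset (Fin (Module.finrank ℂ M))) (u : _ → 𝓢'(E, F)),
    (∑ i ∈ s, u i) φ = ∑ i ∈ s, u i φ := fun s u => by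
      exact map_sum (PointwiseConvergenceCLM.evalCLM (RingHom.id ℂ) F φ) u s
  rw [h4]
  simp only [h2]
  conv_rhs => rw [h1, Submodule.coe_sum, map_sum]
  exact Finset.sum_congr rfl fun i _ => by rw [Submodule.coe_smul, map_smul]

/-- Schwartz functions are dense for the topology of pointwise convergence. -/
theorem dense_schwartz (F : Type) [NormedAddCommGroup F] [NormedSpace ℂ F] [CompleteSpace F] :
    DenseRange (toTemperedDistributionCLM E F volume) := by
  intro T
  rw [mem_closure_iff_nhds]
  intro U hU
  have h1 : (fun u => T + u) ⁻¹' U ∈ 𝓝 (0 : 𝓢'(E, F)) :=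
    (continuous_const.add continuous_id).continuousAt.preimage_mem_nhds (by simpa using hU)
  obtain ⟨⟨S, W⟩, ⟨hS, hW⟩, hsub⟩ := PointwiseConvergenceCLM.hasBasis_nhds_zero.mem_iff.1 h1
  obtain ⟨g, hg⟩ := exists_schwartz_eq_on_finite T (S := S) hS
  refine ⟨toTemperedDistributionCLM E F volume g, ?_, g, rfl⟩
  have h2 := hsub (a := toTemperedDistributionCLM E F volume g - T) fun φ hφ => by
    have : (toTemperedDistributionCLM E F volume g - T) φ = 0 := by
      change toTemperedDistributionCLM E F volume g φ - T φ = 0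
      rw [hg φ hφ, sub_self]
    rw [this]
    exact mem_of_mem_nhds hW
  simpa using h2

end WeakDensity

/-! ### Differentiability of slices -/

section SliceDeriv

variable {E F : Type} [NormedAddCommGroup E] [NormedSpace ℝ E]
  [NormedAddCommGroup F] [NormedSpace ℝ F] [NormedSpace ℂ F]

theorem lineDerivOp_comm (f : 𝓢(E, F)) (v w : E) : ∂_{v} (∂_{w} f) = ∂_{w} (∂_{v} f) := by
  ext x
  have hd : Differentiable ℝ (fderiv ℝ f) :=
    ((f.smooth ⊤).fderiv_right (m := 1) (by norm_cast)).differentiable (by norm_num)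
  have key : ∀ v w : E, ∂_{v} (∂_{w} f) x = fderiv ℝ (fderiv ℝ f) x v w := fun v w => by
    rw [lineDerivOp_apply_eq_fderiv]
    have : (⇑(∂_{w} f : 𝓢(E, F)) : E → F) = fun y => fderiv ℝ f y w :=
      funext fun y => lineDerivOp_apply_eq_fderiv w f y
    rw [this, fderiv_clm_apply (hd x) (differentiableAt_const w)]
    simp
  rw [key, key]
  exact ((f.smooth ⊤).contDiffAt.isSymmSndFDerivAt (by
    rw [minSmoothness_of_isRCLikeNormedField]
    exact WithTop.coe_le_coe.2 (le_top : (2 : ℕ∞) ≤ ⊤))) v w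

theorem lineDerivOp_iteratedLineDerivOp {n : ℕ} (f : 𝓢(E, F)) (v : E) (m : Fin n → E) :
    ∂_{v} (∂^{m} f) = ∂^{m} (∂_{v} f) := by
  induction n with
  | zero => rfl
  | succ n ih =>
    rw [LineDeriv.iteratedLineDerivOp_succ_left, LineDeriv.iteratedLineDerivOp_succ_left,
      lineDerivOp_comm, ih]

/-- A directional derivative may be taken before the iterated derivative. -/
theorem fderiv_iteratedFDeriv_apply (n : ℕ) (f : 𝓢(E, F)) (x v : E) :
    fderiv ℝ (iteratedFDeriv ℝ n f) x v = iteratedFDeriv ℝ n (∂_{v} f : 𝓢(E, F)) x := by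
  ext m
  rw [← iteratedLineDerivOp_eq_iteratedFDeriv, ← lineDerivOp_iteratedLineDerivOp]
  have h := iteratedFDeriv_succ_apply_left (𝕜 := ℝ) (f := f) (x := x) (Fin.cons v m : Fin (n + 1) → E)
  rw [Fin.cons_zero, Fin.tail_cons] at h
  rw [← h, ← iteratedLineDerivOp_eq_iteratedFDeriv, LineDeriv.iteratedLineDerivOp_succ_left,
    Fin.cons_zero, Fin.tail_cons]

/-- Taylor's estimate of second order for the slices, in the Schwartz seminorms. -/
theorem seminorm_sliceLeft_sub_sub_le (H : 𝓢(ℝ × E, F)) (k n : ℕ) (s : ℝ) :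
    SchwartzMap.seminorm ℝ k n (sliceLeft ℝ s H - sliceLeft ℝ 0 H -
        s • sliceLeft ℝ 0 (∂_{((1 : ℝ), (0 : E))} H)) ≤
      SchwartzMap.seminorm ℝ k (n + 1) (∂_{((1 : ℝ), (0 : E))} H) * s ^ 2 := by
  set H' : 𝓢(ℝ × E, F) := ∂_{((1 : ℝ), (0 : E))} H with hH'
  refine SchwartzMap.seminorm_le_bound ℝ k n _ (by positivity) fun y => ?_
  have hsub : ∀ a b : 𝓢(E, F), iteratedFDeriv ℝ n (a - b : 𝓢(E, F)) y =
      iteratedFDeriv ℝ n a y - iteratedFDeriv ℝ n b y := fun a b =>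
    iteratedFDeriv_sub_apply ((SchwartzMap.smooth _ n).contDiffAt)
      ((SchwartzMap.smooth _ n).contDiffAt)
  have hsmul : iteratedFDeriv ℝ n (s • sliceLeft ℝ 0 H' : 𝓢(E, F)) y =
      s • iteratedFDeriv ℝ n (sliceLeft ℝ 0 H') y :=
    iteratedFDeriv_const_smul_apply ((SchwartzMap.smooth _ n).contDiffAt)
  set R : ContinuousMultilinearMap ℝ (fun _ : Fin n => ℝ × E) F →L[ℝ]
      ContinuousMultilinearMap ℝ (fun _ : Fin n => E) F :=
    ContinuousMultilinearMap.compContinuousLinearMapL (fun _ : Fin n => ContinuousLinearMap.inr ℝ ℝ E)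
  have hd : Differentiable ℝ (iteratedFDeriv ℝ n H) :=
    (H.smooth ⊤).differentiable_iteratedFDeriv (mod_cast ENat.natCast_lt_top n)
  have hg : ∀ t, HasDerivAt (fun t => iteratedFDeriv ℝ n (sliceLeft ℝ t H) y)
      (iteratedFDeriv ℝ n (sliceLeft ℝ t H') y) t := fun t => by
    have h1 : HasDerivAt (fun t : ℝ => (t, y)) ((1 : ℝ), (0 : E)) t :=
      (hasDerivAt_id t).prodMk (hasDerivAt_const t y)
    have h2 := (hd (t, y)).hasFDerivAt.comp_hasDerivAt t h1
    rw [fderiv_iteratedFDeriv_apply] at h2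
    have h3 := R.hasFDerivAt.comp_hasDerivAt t h2
    simp only [iteratedFDeriv_sliceLeft]
    exact h3
  have hbound : ∀ t ∈ Set.uIcc 0 s,
      ‖iteratedFDeriv ℝ n (sliceLeft ℝ t H') y - iteratedFDeriv ℝ n (sliceLeft ℝ 0 H') y‖ * ‖y‖ ^ k ≤
        SchwartzMap.seminorm ℝ k (n + 1) H' * |s| := fun t ht => by
    rw [← hsub, mul_comm]
    refine ((sliceLeft ℝ t H' - sliceLeft ℝ 0 H').le_seminorm ℝ k n y).trans ?_
    refine (seminorm_sliceLeft_sub_le H' k n t 0).trans ?_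
    have : |t| ≤ |s| := by simpa using Set.abs_sub_left_of_mem_uIcc ht
    rw [sub_zero, Real.norm_eq_abs]
    gcongr
  rcases eq_or_lt_of_le (pow_nonneg (norm_nonneg y) k) with h0 | h0
  · rw [← h0, zero_mul]; positivity
  rw [hsub, hsub, hsmul, ← le_div_iff₀' h0]
  have hmv := (convex_uIcc (0 : ℝ) s).norm_image_sub_le_of_norm_hasDerivWithin_le
    (f := fun t => iteratedFDeriv ℝ n (sliceLeft ℝ t H) y -
      t • iteratedFDeriv ℝ n (sliceLeft ℝ 0 H') y)
    (f' := fun t => iteratedFDeriv ℝ n (sliceLeft ℝ t H') y -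
      iteratedFDeriv ℝ n (sliceLeft ℝ 0 H') y)
    (C := SchwartzMap.seminorm ℝ k (n + 1) H' * |s| / ‖y‖ ^ k)
    (fun t _ => by
      have h4 := (hg t).sub ((hasDerivAt_id t).smul_const (iteratedFDeriv ℝ n (sliceLeft ℝ 0 H') y))
      rw [one_smul] at h4
      exact h4.hasDerivWithinAt)
    (fun t ht => (le_div_iff₀ h0).2 (hbound t ht)) Set.left_mem_uIcc Set.right_mem_uIcc
  rw [zero_smul, sub_zero, sub_zero, Real.norm_eq_abs] at hmv
  rw [sub_right_comm]
  refine hmv.trans (le_of_eq ?_)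
  rw [← sq_abs s]
  ring

/-- The slices of a Schwartz function are differentiable, in the topology of Schwartz space, in the
variable that is held fixed. -/
theorem tendsto_slope_sliceLeft (H : 𝓢(ℝ × E, F)) :
    Tendsto (fun s : ℝ => s⁻¹ • (sliceLeft ℝ s H - sliceLeft ℝ 0 H)) (𝓝[≠] 0)
      (𝓝 (sliceLeft ℝ 0 (∂_{((1 : ℝ), (0 : E))} H))) := by
  refine ((schwartz_withSeminorms ℝ E F).tendsto_nhds _ _).2 fun i ε hε => ?_
  have hc : Continuous fun s : ℝ =>
      SchwartzMap.seminorm ℝ i.1 (i.2 + 1) (∂_{((1 : ℝ), (0 : E))} H) * |s| := by fun_prop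
  have := (hc.continuousAt (x := 0)).eventually_lt (continuousAt_const (x := (0 : ℝ)) (y := ε))
    (by simpa using hε)
  filter_upwards [this.filter_mono nhdsWithin_le_nhds, self_mem_nhdsWithin] with s hs hs0
  refine lt_of_le_of_lt ?_ hs
  have e : s⁻¹ • (sliceLeft ℝ s H - sliceLeft ℝ 0 H) - sliceLeft ℝ 0 (∂_{((1 : ℝ), (0 : E))} H) =
      s⁻¹ • (sliceLeft ℝ s H - sliceLeft ℝ 0 H -
        s • sliceLeft ℝ 0 (∂_{((1 : ℝ), (0 : E))} H)) := by
    rw [smul_sub _ _ (s • _), smul_smul, inv_mul_cancel₀ hs0, one_smul]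
  change SchwartzMap.seminorm ℝ i.1 i.2 _ ≤ _
  rw [e, map_smul_eq_mul, norm_inv, Real.norm_eq_abs]
  have h1 := seminorm_sliceLeft_sub_sub_le H i.1 i.2 s
  have h2 : 0 < |s| := abs_pos.2 hs0
  rw [inv_mul_le_iff₀ h2]
  refine h1.trans (le_of_eq ?_)
  rw [← sq_abs s]
  ring

end SliceDeriv

/-! ### One-parameter groups of translations with a multiplier -/

section Groups

variable {D N : ℕ}

theorem mulOp_apply {B : Space D → Mat N} (hB : B.HasTemperateGrowth) (f : Wave D N)
    (z : Space D) : mulOp B f z = B z (f z) := by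
  rw [mulOp, dif_pos hB]; rfl

/-- Wave functions as square integrable functions. -/
def waveL2 : Wave D N →L[ℂ] Lp (Inner N) 2 (volume : Measure (Space D)) :=
  toLpCLM ℂ (Inner N) 2 volume

theorem waveL2_injective : Function.Injective (waveL2 (D := D) (N := N)) :=
  SchwartzMap.injective_toLp 2 volume

theorem norm_waveL2 (f : Wave D N) : ‖waveL2 f‖ = (eLpNorm f 2 volume).toReal :=
  SchwartzMap.norm_toLp

/-- The orbits of a one-parameter group satisfy the equation `V' = T V` in `L²`. -/
theorem hasDerivAt_waveL2 {T : Op D N} {V : ℝ → Op D N} (h : IsOneParameterGroup T V)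
    (f : Wave D N) (s : ℝ) : HasDerivAt (fun s => waveL2 (V s f)) (waveL2 (T (V s f))) s := by
  rw [hasDerivAt_iff_tendsto_slope_zero]
  refine ((waveL2.continuous.tendsto _).comp (h.generator (V s f))).congr fun t => ?_
  rw [Function.comp_apply, map_smul, map_sub, Complex.coe_smul, add_comm s t, h.map_add]
  rfl

/-- The generator of a group of isometries is antisymmetric, so that the squared `L²` distance of
the orbits of two groups with this generator is constant. -/
theorem IsOneParameterGroup.eq_of_isometry {T : Op D N} {V V' : ℝ → Op D N}
    (h : IsOneParameterGroup T V) (h' : IsOneParameterGroup T V')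
    (hV : ∀ s f, ‖waveL2 (V s f)‖ = ‖waveL2 f‖) : V' = V := by
  have anti : ∀ g : Wave D N,
      inner ℂ (waveL2 g) (waveL2 (T g)) + inner ℂ (waveL2 (T g)) (waveL2 g) = 0 := fun g => by
    have h1 := (hasDerivAt_waveL2 h g 0).inner ℂ (hasDerivAt_waveL2 h g 0)
    have h2 : (fun s => inner ℂ (waveL2 (V s g)) (waveL2 (V s g))) =
        fun _ => ((‖waveL2 g‖ ^ 2 : ℝ) : ℂ) := funext fun s => by
      rw [inner_self_eq_norm_sq_to_K, hV]; norm_cast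
    rw [h2] at h1
    have h3 := h1.unique (hasDerivAt_const _ _)
    simpa [h.map_zero] using h3
  funext s
  ext1 f
  have hd : ∀ s, HasDerivAt (fun s => waveL2 (V' s f - V s f)) (waveL2 (T (V' s f - V s f))) s :=
    fun s => by
      simp only [map_sub]
      exact (hasDerivAt_waveL2 h' f s).sub (hasDerivAt_waveL2 h f s)
  have hc : ∀ s, HasDerivAt (fun s => inner ℂ (waveL2 (V' s f - V s f)) (waveL2 (V' s f - V s f)))
      0 s := fun s => by
    rw [← anti (V' s f - V s f)]
    exact (hd s).inner ℂ (hd s)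
  have h0 := is_const_of_deriv_eq_zero (fun s => (hc s).differentiableAt) (fun s => (hc s).deriv) s 0
  rw [h.map_zero, h'.map_zero, sub_self, _root_.map_zero, inner_zero_left,
    inner_self_eq_zero] at h0
  exact sub_eq_zero.1 (waveL2_injective (h0.trans (_root_.map_zero _).symm))

theorem opExp_eq {T : Op D N} {V : ℝ → Op D N} (hT : HasExp T) (h : IsOneParameterGroup T V) :
    opExp T = V 1 := by
  rw [opExp, dif_pos hT, hT.unique hT.choose_spec.1 h]

theorem hasDerivAt_mat_apply {M : ℝ → Mat N} {f : ℝ → Inner N} {M' : Mat N} {f' : Inner N} {s : ℝ}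
    (hM : HasDerivAt M M' s) (hf : HasDerivAt f f' s) :
    HasDerivAt (fun s => M s (f s)) (M s f' + M' (f s)) s := by
  set B : Mat N →L[ℝ] Inner N →L[ℝ] Inner N :=
    ContinuousLinearMap.restrictScalarsL ℂ (Inner N) (Inner N) ℝ ℝ
  have h1 := (B.hasFDerivAt.comp_hasDerivAt s hM).clm_apply hf
  rw [add_comm] at h1
  exact h1

section Cocycle

variable {c : Space D} {M : ℝ → Space D → Mat N} {T : Op D N}
  (hM : Function.HasTemperateGrowth (fun p : ℝ × Space D => M p.1 p.2))

/-- The operator `f ↦ M s z (f (z + s c))`. -/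
def cocycleOp (c : Space D) (M : ℝ → Space D → Mat N) (s : ℝ) : Op D N :=
  (mulOp (M s)).comp (SchwartzMap.compSubConstCLM ℂ (-(s • c)))

include hM

theorem cocycleOp_apply (s : ℝ) (f : Wave D N) (z : Space D) :
    cocycleOp c M s f z = M s z (f (z + s • c)) := by
  have hs : (M s).HasTemperateGrowth :=
    hM.comp (HasTemperateGrowth.prodMk (.const s) .id')
  rw [cocycleOp, ContinuousLinearMap.comp_apply, mulOp_apply hs, compSubConstCLM_apply,
    sub_neg_eq_add]

theorem isOneParameterGroup_cocycleOp (h0 : ∀ z, M 0 z = 1)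
    (hadd : ∀ s t z, M (s + t) z = M s z * M t (z + s • c))
    (hT : ∀ f z, HasDerivAt (fun s : ℝ => M s z (f (z + s • c))) (T f z) 0) :
    IsOneParameterGroup T (cocycleOp c M) where
  map_zero := by
    ext1 f; ext1 z
    rw [cocycleOp_apply hM, h0, zero_smul, add_zero]; rfl
  map_add s t := by
    ext1 f; ext1 z
    rw [cocycleOp_apply hM, hadd, ContinuousLinearMap.comp_apply, cocycleOp_apply hM,
      cocycleOp_apply hM, add_smul, add_assoc]
    rfl
  generator f := by
    -- near `s = 0` the orbit consists of the slices of a Schwartz function on `ℝ × ℝ ^ D`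
    let b : ContDiffBump (0 : ℝ) := ⟨1, 2, one_pos, one_lt_two⟩
    have hb : HasCompactSupport (fun x => (b x : ℂ)) :=
      b.hasCompactSupport.comp_left (g := Complex.ofReal) Complex.ofReal_zero
    set χ : 𝓢(ℝ, ℂ) := hb.toSchwartzMap (Complex.ofRealCLM.contDiff.comp b.contDiff)
    have hχ : ∀ᶠ s in 𝓝 (0 : ℝ), χ s = 1 := by
      filter_upwards [Metric.closedBall_mem_nhds (0 : ℝ) one_pos] with s hs
      exact congrArg Complex.ofReal (b.one_of_mem_closedBall hs)
    set e : (ℝ × Space D) →L[ℝ] ℝ × Space D := (ContinuousLinearMap.fst ℝ ℝ (Space D)).prod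
      (ContinuousLinearMap.snd ℝ ℝ (Space D) +
        (ContinuousLinearMap.fst ℝ ℝ (Space D)).smulRight c)
    set e' : (ℝ × Space D) →L[ℝ] ℝ × Space D := (ContinuousLinearMap.fst ℝ ℝ (Space D)).prod
      (ContinuousLinearMap.snd ℝ ℝ (Space D) -
        (ContinuousLinearMap.fst ℝ ℝ (Space D)).smulRight c)
    set E : (ℝ × Space D) ≃L[ℝ] ℝ × Space D := ContinuousLinearEquiv.equivOfInverse e e'
      (fun p => by simp [e, e']) (fun p => by simp [e, e'])
    set H : 𝓢(ℝ × Space D, Inner N) :=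
      SchwartzMap.bilinLeftCLM (ContinuousLinearMap.id ℂ (Mat N)).flip hM
        (compCLMOfContinuousLinearEquiv ℂ E (tensorCLM χ f))
    have hH : ∀ s z, H (s, z) = M s z (χ s • f (z + s • c)) := fun s z => rfl
    have hs : ∀ s, χ s = 1 → sliceLeft ℝ s H = cocycleOp c M s f := fun s hs => by
      ext1 z
      rw [sliceLeft_apply, hH, hs, one_smul, cocycleOp_apply hM]
    have hz : f = sliceLeft ℝ 0 H := by
      rw [hs 0 hχ.self_of_nhds]
      ext1 z
      rw [cocycleOp_apply hM, h0, zero_smul, add_zero]; rfl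
    have hlim : sliceLeft ℝ 0 (∂_{((1 : ℝ), (0 : Space D))} H) = T f := by
      ext1 z
      have h1 : HasDerivAt (fun t : ℝ => (t, z)) ((1 : ℝ), (0 : Space D)) 0 :=
        (hasDerivAt_id 0).prodMk (hasDerivAt_const 0 z)
      have h2 := (H.differentiableAt (x := (0, z))).hasFDerivAt.comp_hasDerivAt 0 h1
      refine h2.unique ((hT f z).congr_of_eventuallyEq ?_)
      filter_upwards [hχ] with s hs
      simp [hH, hs]
    rw [← hlim]
    refine (tendsto_slope_sliceLeft H).congr' ?_
    filter_upwards [hχ.filter_mono nhdsWithin_le_nhds] with s h1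
    rw [hs s h1, ← hz]
    ext1 z
    simp only [smul_apply, Complex.coe_smul]

theorem norm_waveL2_cocycleOp (hnorm : ∀ s z v, ‖M s z v‖ = ‖v‖) (s : ℝ) (f : Wave D N) :
    ‖waveL2 (cocycleOp c M s f)‖ = ‖waveL2 f‖ := by
  rw [norm_waveL2, norm_waveL2]
  congr 1
  have h1 : eLpNorm (cocycleOp c M s f) 2 volume = eLpNorm (f ∘ fun z => z + s • c) 2 volume :=
    eLpNorm_congr_norm_ae (.of_forall fun z => by rw [cocycleOp_apply hM, hnorm]; rfl)
  rw [h1]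
  exact eLpNorm_comp_measurePreserving f.continuous.aestronglyMeasurable
    (measurePreserving_add_right volume (s • c))

/-- A unitary cocycle `M` over the translations along `c` generates the one-parameter group
`f ↦ M s z (f (z + s c))`, and no other group has the same generator. -/
theorem hasExp_of_cocycle (h0 : ∀ z, M 0 z = 1)
    (hadd : ∀ s t z, M (s + t) z = M s z * M t (z + s • c)) (hnorm : ∀ s z v, ‖M s z v‖ = ‖v‖)
    (hT : ∀ f z, HasDerivAt (fun s : ℝ => M s z (f (z + s • c))) (T f z) 0) :
    HasExp T ∧ ∀ f z, opExp T f z = M 1 z (f (z + c)) := by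
  have h := isOneParameterGroup_cocycleOp hM h0 hadd hT
  have hE : HasExp T := ⟨_, h, fun V' h' => h.eq_of_isometry h' (norm_waveL2_cocycleOp hM hnorm)⟩
  refine ⟨hE, fun f z => ?_⟩
  rw [opExp_eq hE h, cocycleOp_apply hM, one_smul]

end Cocycle

end Groups

/-! ### The exponentials of the covariant momentum and of the position -/

section Exponentials

variable {D N : ℕ} {A : Fin D → Space D → Mat N}

theorem norm_apply_of_star_mul {U : Mat N} (h : star U * U = 1) (v : Inner N) : ‖U v‖ = ‖v‖ :=
  (ContinuousLinearMap.norm_map_iff_adjoint_comp_self U).2 h v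

theorem dotOp_covMomentum_apply (hA : ∀ μ, (A μ).HasTemperateGrowth) (c p : Space D)
    (f : Wave D N) (z : Space D) :
    (Complex.I • dotOp c (covMomentum A) p) f z =
      fderiv ℝ f z c + connection A z c (f z) - (Complex.I * (inner ℝ c p : ℝ)) • f z := by
  have h1 : fderiv ℝ f z c = ∑ μ, ((c μ : ℝ) : ℂ) • fderiv ℝ f z (EuclideanSpace.single μ 1) := by
    have : c = ∑ μ, c μ • EuclideanSpace.single μ (1 : ℝ) := by
      ext i; simp [Finset.sum_apply, Pi.single_apply]
    conv_lhs => rw [this, map_sum]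
    exact Finset.sum_congr rfl fun μ _ => by rw [map_smul, Complex.coe_smul]
  have h2 : ∀ μ, covMomentum A μ f z =
      -Complex.I • fderiv ℝ f z (EuclideanSpace.single μ 1) - A μ z (f z) := fun μ => by
    rw [← mulOp_apply (hA μ)]; rfl
  have h3 : dotOp c (covMomentum A) p f z = ∑ μ, ((c μ : ℝ) : ℂ) •
      (covMomentum A μ f z - ((p μ : ℝ) : ℂ) • f z) := by
    rw [dotOp, _root_.sum_apply, _root_.sum_apply]
    rfl
  have h4 : connection A z c (f z) = -(Complex.I • ∑ μ, ((c μ : ℝ) : ℂ) • A μ z (f z)) := by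
    rw [connection, neg_apply, smul_apply, _root_.sum_apply]
    rfl
  have h5 : ((inner ℝ c p : ℝ) : ℂ) • f z = ∑ μ, ((c μ : ℝ) : ℂ) • ((p μ : ℝ) : ℂ) • f z := by
    rw [PiLp.inner_apply, Complex.ofReal_sum, Finset.sum_smul]
    refine Finset.sum_congr rfl fun μ _ => ?_
    rw [smul_smul]
    congr 1
    simp [mul_comm]
  rw [smul_apply, smul_apply, h3, h1, h4, mul_smul, h5]
  simp only [h2, smul_sub, Finset.sum_sub_distrib, Finset.smul_sum, ← sub_eq_add_neg]
  congr 2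
  refine Finset.sum_congr rfl fun μ _ => ?_
  rw [smul_smul, smul_smul]
  congr 1
  linear_combination (-(c μ : ℂ)) * Complex.I_mul_I

/-- The exponential of `i c·(π - p)` is the translation by `c` followed by the parallel transport
along `c` and the phase `e^{-ic·p}`. -/
theorem hasExp_dotOp_covMomentum (h : IsGaugeField A) (c p : Space D) :
    HasExp (Complex.I • dotOp c (covMomentum A) p) ∧
      ∀ (f : Wave D N) (z : Space D), opExp (Complex.I • dotOp c (covMomentum A) p) f z =
        Complex.exp (Complex.I * ((-inner ℝ c p : ℝ) : ℂ)) • (transport A z c : Mat N) (f (z + c)) := by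
  have hphase : Function.HasTemperateGrowth (fun x : ℝ × Space D =>
      Complex.exp (Complex.I * ((-(x.1 * inner ℝ c p) : ℝ) : ℂ))) :=
    hasTemperateGrowth_cexp (f := fun x : ℝ × Space D => -(x.1 * inner ℝ c p))
      ((hasTemperateGrowth_fst.mul (.const (inner ℝ c p))).neg)
  have htr : Function.HasTemperateGrowth (fun x : ℝ × Space D => (transport A x.2 (x.1 • c) : Mat N)) :=
    h.hasTemperateGrowth_mat.comp (f := fun x : ℝ × Space D => (x.2, x.1 • c))
      (HasTemperateGrowth.prodMk hasTemperateGrowth_snd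
        ((ContinuousLinearMap.fst ℝ ℝ (Space D)).smulRight c).hasTemperateGrowth)
  have key := hasExp_of_cocycle (c := c) (T := Complex.I • dotOp c (covMomentum A) p)
    (M := fun s z => Complex.exp (Complex.I * ((-(s * inner ℝ c p) : ℝ) : ℂ)) •
      (transport A z (s • c) : Mat N)) ?_ (fun z => ?_) (fun s t z => ?_) (fun s z v => ?_)
      (fun f z => ?_)
  · refine ⟨key.1, fun f z => ?_⟩
    rw [key.2 f z]
    simp only [one_mul, one_smul]
    rfl
  · exact (ContinuousLinearMap.lsmul ℝ ℂ : ℂ →L[ℝ] Mat N →L[ℝ] Mat N).bilinear_hasTemperateGrowth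
      hphase htr
  · have := transport_zero h z
    simp [this]
  · have h1 : (transport A z ((s + t) • c) : Mat N) =
        transport A z (s • c) * transport A (z + s • c) (t • c) := transport_add_smul h z c s t
    rw [h1, smul_mul_assoc, mul_smul_comm, smul_smul, ← Complex.exp_add]
    congr 2
    push_cast
    ring
  · change ‖Complex.exp _ • (transport A z (s • c) : Mat N) v‖ = _
    rw [norm_smul, mul_comm Complex.I, Complex.norm_exp_ofReal_mul_I, one_mul,
      norm_apply_of_star_mul (h.star_mul_mat z (s • c))]
  · have hl : HasDerivAt (fun s : ℝ => z + s • c) c 0 := by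
      simpa using ((hasDerivAt_id (0 : ℝ)).smul_const c).const_add z
    have hf : HasDerivAt (fun s : ℝ => f (z + s • c)) (fderiv ℝ f z c) 0 := by
      have h1 : HasFDerivAt f (fderiv ℝ f z) (z + (0 : ℝ) • c) := by
        rw [zero_smul, add_zero]; exact f.differentiableAt.hasFDerivAt
      exact h1.comp_hasDerivAt 0 hl
    have ht := hasDerivAt_mat_apply (h.hasDerivAt_mat z c 0) hf
    have h0 : (transport A z ((0 : ℝ) • c) : Mat N) = 1 := by
      rw [zero_smul]; exact transport_zero h z
    rw [h0, zero_smul, add_zero, one_mul] at ht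
    have he : HasDerivAt (fun s : ℝ => Complex.exp (Complex.I * ((-(s * inner ℝ c p) : ℝ) : ℂ)))
        (-(Complex.I * (inner ℝ c p : ℝ))) 0 := by
      have h2 : HasDerivAt (fun s : ℝ => -(s * inner ℝ c p)) (-inner ℝ c p) 0 := by
        simpa using ((hasDerivAt_id' (0 : ℝ)).mul_const (inner ℝ c p)).fun_neg
      simpa using (h2.ofReal_comp.const_mul Complex.I).cexp
    rw [dotOp_covMomentum_apply h.temperate]
    refine (he.fun_smul ht).congr_deriv ?_
    rw [h0, zero_smul, add_zero, one_apply_eq_self, one_apply_eq_self, zero_mul, neg_zero, Complex.ofReal_zero,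
      mul_zero, Complex.exp_zero, one_smul, neg_smul, ← sub_eq_add_neg]

/-- The exponential of `i q·(x̂ - x)` is a phase: the cocycle over the trivial translation. -/
theorem hasExp_dotOp_position (q x : Space D) :
    HasExp (Complex.I • dotOp (N := N) q position x) ∧
      ∀ (f : Wave D N) (z : Space D), opExp (Complex.I • dotOp q position x) f z =
        Complex.exp (Complex.I * ((inner ℝ q (z - x) : ℝ) : ℂ)) • f z := by
  have hin : Function.HasTemperateGrowth (fun y : ℝ × Space D => y.1 * inner ℝ q (y.2 - x)) :=
    hasTemperateGrowth_fst.mul (hasTemperateGrowth_inner (.const q)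
      (hasTemperateGrowth_snd.sub (.const x)))
  have hT : ∀ (f : Wave D N) z, (Complex.I • dotOp q position x) f z =
      (Complex.I * (inner ℝ q (z - x) : ℝ)) • f z := fun f z => by
    have h1 : ∀ μ, position μ f z = ((z μ : ℝ) : ℂ) • f z := fun μ => by
      have hp : Function.HasTemperateGrowth (fun x : Space D => ((x μ : ℝ) : ℂ)) :=
        (Complex.ofRealCLM.comp (EuclideanSpace.proj μ : Space D →L[ℝ] ℝ)).hasTemperateGrowth
      exact SchwartzMap.smulLeftCLM_apply_apply hp f z
    have h3 : dotOp q position x f z = ∑ μ, ((q μ : ℝ) : ℂ) •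
        (position μ f z - ((x μ : ℝ) : ℂ) • f z) := by
      rw [dotOp, _root_.sum_apply, _root_.sum_apply]
      rfl
    rw [smul_apply, smul_apply, h3, mul_smul, PiLp.inner_apply, Complex.ofReal_sum, Finset.sum_smul]
    congr 1
    refine Finset.sum_congr rfl fun μ _ => ?_
    rw [h1, ← sub_smul, smul_smul]
    congr 1
    simp [mul_comm]
  have key := hasExp_of_cocycle (c := 0) (T := Complex.I • dotOp (N := N) q position x)
    (M := fun s z => Complex.exp (Complex.I * ((s * inner ℝ q (z - x) : ℝ) : ℂ)) •
      (1 : Mat N)) ?_ (fun z => ?_) (fun s t z => ?_) (fun s z v => ?_) (fun f z => ?_)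
  · refine ⟨key.1, fun f z => ?_⟩
    rw [key.2 f z]
    simp only [one_mul, add_zero]
    rfl
  · exact (ContinuousLinearMap.lsmul ℝ ℂ : ℂ →L[ℝ] Mat N →L[ℝ] Mat N).bilinear_hasTemperateGrowth
      (hasTemperateGrowth_cexp hin) (.const 1)
  · simp
  · rw [smul_mul_assoc, one_mul, smul_smul, ← Complex.exp_add]
    congr 2
    push_cast
    simp
    ring
  · change ‖Complex.exp _ • v‖ = _
    rw [norm_smul, mul_comm Complex.I, Complex.norm_exp_ofReal_mul_I, one_mul]
  · rw [hT]
    have h2 : HasDerivAt (fun s : ℝ => s * inner ℝ q (z - x)) (inner ℝ q (z - x)) 0 := by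
      simpa using (hasDerivAt_id (0 : ℝ)).mul_const (inner ℝ q (z - x))
    have he : HasDerivAt (fun s : ℝ => Complex.exp (Complex.I * ((s * inner ℝ q (z - x) : ℝ) : ℂ)))
        (Complex.I * (inner ℝ q (z - x) : ℝ)) 0 := by
      simpa using (h2.ofReal_comp.const_mul Complex.I).cexp
    have h3 := he.smul_const (f z)
    simpa using h3

theorem dotOp_smul (r : ℝ) (c p : Space D) (T : Fin D → Op D N) :
    dotOp (r • c) T p = (r : ℂ) • dotOp c T p := by
  simp only [dotOp, Finset.smul_sum, smul_smul, PiLp.smul_apply, smul_eq_mul, Complex.ofReal_mul]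

theorem wignerExp_generator (y : Space D) :
    -(Complex.I / 2) • dotOp y (covMomentum A) 0 =
      Complex.I • dotOp (-(1 / 2 : ℝ) • y) (covMomentum A) 0 := by
  rw [dotOp_smul, smul_smul]
  congr 1
  push_cast
  ring

theorem weylExp_generator (y p : Space D) :
    (Complex.I / 2) • dotOp y (covMomentum A) p =
      Complex.I • dotOp ((1 / 2 : ℝ) • y) (covMomentum A) p := by
  rw [dotOp_smul, smul_smul]
  congr 1
  push_cast
  ring

theorem wignerExp_apply (h : IsGaugeField A) (y : Space D) (f : Wave D N) (z : Space D) :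
    wignerExp A y f z =
      (transport A z (-(1 / 2 : ℝ) • y) : Mat N) (f (z + -(1 / 2 : ℝ) • y)) := by
  rw [wignerExp, wignerExp_generator, (hasExp_dotOp_covMomentum h _ _).2]
  simp

end Exponentials

/-! ### Operators with a Schwartz kernel -/

section Entries

variable {N : ℕ}

@[simp]
theorem matUnit_apply (i j : Fin N) (v : Inner N) : matUnit i j v = v j • EuclideanSpace.single i 1 :=
  rfl

theorem sum_smul_single (v : Inner N) : ∑ i, v i • EuclideanSpace.single i (1 : ℂ) = v := by
  ext i; simp [Finset.sum_apply, Pi.single_apply]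

theorem mat_ext {m m' : Mat N} (h : ∀ i j, entry m i j = entry m' i j) : m = m' := by
  ext v i
  rw [← sum_smul_single v]
  simp only [map_sum, map_smul]
  have : ∀ j, m (EuclideanSpace.single j 1) = m' (EuclideanSpace.single j 1) := fun j => by
    ext i; exact h i j
  simp only [this]

/-- The matrix entry as a linear functional. -/
def entryCLM (i j : Fin N) : Mat N →L[ℂ] ℂ :=
  (EuclideanSpace.proj i : Inner N →L[ℂ] ℂ).comp
    (ContinuousLinearMap.apply ℂ (Inner N) (EuclideanSpace.single j (1 : ℂ)))

@[simp]
theorem entryCLM_apply (i j : Fin N) (m : Mat N) : entryCLM i j m = entry m i j := rfl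

theorem entry_matUnit (i j k l : Fin N) :
    entry (matUnit i j) k l = if k = i ∧ l = j then 1 else 0 := by
  simp only [entry, matUnit_apply, PiLp.smul_apply, PiLp.single_apply, smul_eq_mul]
  by_cases h1 : k = i <;> by_cases h2 : j = l <;> simp [h1, h2, eq_comm]

theorem sum_entry_smul_matUnit (m : Mat N) : ∑ i, ∑ j, entry m i j • matUnit i j = m := by
  refine mat_ext fun k l => ?_
  rw [← entryCLM_apply]
  simp only [map_sum, map_smul, entryCLM_apply, entry_matUnit, smul_eq_mul, ite_and]
  simp

theorem apply_eq_sum (m : Mat N) (v : Inner N) :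
    m v = ∑ i, ∑ j, entry m i j • v j • EuclideanSpace.single i (1 : ℂ) := by
  conv_lhs => rw [← sum_entry_smul_matUnit m]
  simp only [_root_.sum_apply, smul_apply, matUnit_apply]

end Entries

section Kernels

variable {D N : ℕ}

/-- The function `(x, x') ↦ k(x, x') f(x')`, continuously in `f`. -/
def kernelMulCLM (k : 𝓢(Phase D, Mat N)) : Wave D N →L[ℂ] 𝓢(Phase D, Inner N) :=
  (SchwartzMap.compCLM ℂ (g := fun z : Phase D => (z, z.2))
    (HasTemperateGrowth.prodMk .id' hasTemperateGrowth_snd)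
    ⟨1, 1, fun z => by
      have : ‖z‖ ≤ ‖(z, z.2)‖ := le_max_left _ _
      simp only [pow_one, one_mul]
      linarith⟩).comp
    (∑ i, ∑ j, (tensorCLM (SchwartzMap.postcompCLM (𝕜 := ℂ) (entryCLM i j) k)).comp
      (SchwartzMap.postcompCLM (𝕜 := ℂ) (matUnit i j)))

theorem kernelMulCLM_apply (k : 𝓢(Phase D, Mat N)) (f : Wave D N) (z : Phase D) :
    kernelMulCLM k f z = k z (f z.2) := by
  rw [apply_eq_sum]
  change ((∑ i, ∑ j, (tensorCLM (SchwartzMap.postcompCLM (𝕜 := ℂ) (entryCLM i j) k)).comp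
      (SchwartzMap.postcompCLM (𝕜 := ℂ) (matUnit i j))) f) (z, z.2) = _
  simp only [_root_.sum_apply]
  rfl

/-- The operator with a given Schwartz kernel. -/
def kernelOp (k : 𝓢(Phase D, Mat N)) : Op D N := partialIntegral.comp (kernelMulCLM k)

theorem hasSchwartzKernel_kernelOp (k : 𝓢(Phase D, Mat N)) : HasSchwartzKernel (kernelOp k) k := by
  intro f x
  rw [kernelOp, ContinuousLinearMap.comp_apply, partialIntegral_apply]
  simp only [kernelMulCLM_apply]

theorem HasSchwartzKernel.eq_kernelOp {X : Op D N} {k : 𝓢(Phase D, Mat N)}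
    (h : HasSchwartzKernel X k) : X = kernelOp k := by
  ext1 f; ext1 x
  rw [h f x, hasSchwartzKernel_kernelOp k f x]

theorem integrable_kernel_apply (k : 𝓢(Phase D, Mat N)) (f : Wave D N) (x : Space D) :
    Integrable fun x' => k (x, x') (f x') := by
  refine ((sliceLeft ℂ x (kernelMulCLM k f)).integrable (μ := volume)).congr
    (.of_forall fun x' => ?_)
  exact kernelMulCLM_apply k f (x, x')

@[simp]
theorem vecWave_apply (g : 𝓢(Space D, ℂ)) (v : Inner N) (x : Space D) :
    vecWave g v x = g x • v := rfl

/-- Each slice of the kernel is determined by testing with vector multiples of scalar functions. -/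
theorem HasSchwartzKernel.unique {X : Op D N} {k k' : 𝓢(Phase D, Mat N)}
    (h : HasSchwartzKernel X k) (h' : HasSchwartzKernel X k') : k = k' := by
  ext1 ⟨x, x'⟩
  refine mat_ext fun i j => ?_
  set K : 𝓢(Phase D, Mat N) → 𝓢(Space D, ℂ) := fun k =>
    SchwartzMap.postcompCLM (𝕜 := ℂ) (entryCLM i j) (sliceLeft ℂ x k) with hK
  have e : ∀ (k : 𝓢(Phase D, Mat N)), HasSchwartzKernel X k → ∀ g : 𝓢(Space D, ℂ),
      ∫ x', g x' * K k x' = (X (vecWave g (EuclideanSpace.single j 1)) x) i := fun k h g => by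
    rw [h]
    have h2 := (EuclideanSpace.proj i : Inner N →L[ℂ] ℂ).integral_comp_comm
      (integrable_kernel_apply k (vecWave g (EuclideanSpace.single j 1)) x)
    refine Eq.trans (integral_congr_ae (.of_forall fun x' => ?_)) h2
    simp [hK, entry]
  have h0 : K k - K k' = 0 := eq_zero_of_integral_mul_eq_zero _ fun g => by
    have h1 : ∀ k, Integrable fun x' => g x' * K k x' := fun k => by
      refine ((SchwartzMap.smulLeftCLM ℂ g (K k)).integrable (μ := volume)).congr
        (.of_forall fun x' => ?_)
      exact SchwartzMap.smulLeftCLM_apply_apply g.hasTemperateGrowth _ _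
    have h2 := integral_sub (h1 k) (h1 k')
    rw [e k h, e k' h', sub_self] at h2
    refine Eq.trans (integral_congr_ae (.of_forall fun x' => ?_)) h2
    exact (mul_comm _ _).trans (mul_sub (g x') (K k x') (K k' x'))
  exact congrArg (fun g : 𝓢(Space D, ℂ) => g x') (sub_eq_zero.1 h0)

theorem HasSchwartzKernel.braket_eq {X : Op D N} {k : 𝓢(Phase D, Mat N)}
    (h : HasSchwartzKernel X k) (x x' : Space D) : braket X x x' = k (x, x') := by
  have hex : ∃ k, HasSchwartzKernel X k := ⟨k, h⟩
  rw [braket, dif_pos hex, hex.choose_spec.unique h]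

end Kernels

/-! ### The Wigner transform of Schwartz kernels -/

section PhaseIntegral

variable {E V : Type} [NormedAddCommGroup E] [NormedSpace ℝ E]
  [NormedAddCommGroup V] [InnerProductSpace ℝ V] [FiniteDimensional ℝ V]
  [MeasurableSpace V] [BorelSpace V]
  {F : Type} [NormedAddCommGroup F] [NormedSpace ℝ F] [NormedSpace ℂ F] [IsScalarTower ℝ ℂ F]
  [SMulCommClass ℝ ℂ F] [CompleteSpace F]

/-- Scaling of the second variable. -/
def scaleSnd (r : ℝˣ) : 𝓢(E × V, F) →L[ℂ] 𝓢(E × V, F) :=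
  compCLMOfContinuousLinearEquiv ℂ
    ((ContinuousLinearEquiv.refl ℝ E).prodCongr (ContinuousLinearEquiv.smulLeft r))

/-- The number `2π` as a unit. -/
def twoPi : ℝˣ := Units.mk0 (2 * Real.pi) (by positivity)

/-- The partial Fourier integral `(x, p) ↦ ∫ dy e^{ip·y} h(x, y)`. -/
def phaseIntegral : 𝓢(E × V, F) →L[ℂ] 𝓢(E × V, F) := (scaleSnd twoPi⁻¹).comp partialFourierInv

/-- The inverse of `phaseIntegral`. -/
def phaseIntegralInv : 𝓢(E × V, F) →L[ℂ] 𝓢(E × V, F) := partialFourier.comp (scaleSnd twoPi)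

theorem fourierPhase_neg_inv_twoPi (p y : V) :
    fourierPhase (-(((twoPi⁻¹ : ℝˣ) : ℝ) • p)) y =
      Complex.exp (Complex.I * ((inner ℝ p y : ℝ) : ℂ)) := by
  have h : -(2 * Real.pi * inner ℝ y (-(((twoPi⁻¹ : ℝˣ) : ℝ) • p))) = inner ℝ p y := by
    rw [inner_neg_right, inner_smul_right, real_inner_comm]
    simp only [twoPi, Units.val_inv_eq_inv_val, Units.val_mk0]
    field_simp
  rw [fourierPhase, h]

theorem phaseIntegral_apply (h : 𝓢(E × V, F)) (x : E) (p : V) :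
    phaseIntegral h (x, p) =
      ∫ y, Complex.exp (Complex.I * ((inner ℝ p y : ℝ) : ℂ)) • h (x, y) := by
  change partialFourierInv h (x, ((twoPi⁻¹ : ℝˣ) : ℝ) • p) = _
  rw [partialFourierInv_apply]
  simp only [fourierPhase_neg_inv_twoPi]

theorem integrable_phaseIntegral (h : 𝓢(E × V, F)) (x : E) (p : V) :
    Integrable fun y => Complex.exp (Complex.I * ((inner ℝ p y : ℝ) : ℂ)) • h (x, y) := by
  have := integrable_integrand h (x, -(((twoPi⁻¹ : ℝˣ) : ℝ) • p))
  simpa only [fourierPhase_neg_inv_twoPi] using this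

theorem phaseIntegralInv_phaseIntegral (h : 𝓢(E × V, F)) :
    phaseIntegralInv (phaseIntegral h) = h := by
  have : scaleSnd twoPi (phaseIntegral h) = partialFourierInv h := by
    ext1 z
    change partialFourierInv h (z.1, ((twoPi⁻¹ : ℝˣ) : ℝ) • (twoPi : ℝ) • z.2) = _
    rw [smul_smul, Units.inv_mul, one_smul]
  change partialFourier (scaleSnd twoPi (phaseIntegral h)) = h
  rw [this, partialFourier_partialFourierInv]

theorem phaseIntegral_phaseIntegralInv (h : 𝓢(E × V, F)) :
    phaseIntegral (phaseIntegralInv h) = h := by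
  change scaleSnd twoPi⁻¹ (partialFourierInv (partialFourier (scaleSnd twoPi h))) = h
  rw [partialFourierInv_partialFourier]
  ext1 z
  change h (z.1, (twoPi : ℝ) • ((twoPi⁻¹ : ℝˣ) : ℝ) • z.2) = h z
  rw [smul_smul, Units.mul_inv, one_smul]

end PhaseIntegral

section Midpoint

variable {D : ℕ}

/-- The coordinates `(u, y)`, with midpoint `u` and difference `y`, of the pair
`(u - y/2, u + y/2)`. -/
def midEquiv : Phase D ≃L[ℝ] Phase D :=
  ContinuousLinearEquiv.equivOfInverse
    ((ContinuousLinearMap.fst ℝ (Space D) (Space D) +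
        -(1 / 2 : ℝ) • ContinuousLinearMap.snd ℝ (Space D) (Space D)).prod
      (ContinuousLinearMap.fst ℝ (Space D) (Space D) +
        (1 / 2 : ℝ) • ContinuousLinearMap.snd ℝ (Space D) (Space D)))
    (((1 / 2 : ℝ) • (ContinuousLinearMap.fst ℝ (Space D) (Space D) +
        ContinuousLinearMap.snd ℝ (Space D) (Space D))).prod
      (ContinuousLinearMap.snd ℝ (Space D) (Space D) -
        ContinuousLinearMap.fst ℝ (Space D) (Space D)))
    (fun z => by ext i <;> simp <;> ring) (fun z => by ext i <;> simp <;> ring)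

theorem midEquiv_apply (u y : Space D) :
    midEquiv (u, y) = (u + -(1 / 2 : ℝ) • y, u + (1 / 2 : ℝ) • y) := rfl

end Midpoint

section Wigner

variable {D N : ℕ} {A : Fin D → Space D → Mat N}

/-- Multiplication of matrix-valued Schwartz functions from both sides. -/
def sandwichCLM {E : Type} [NormedAddCommGroup E] [NormedSpace ℝ E] {B C : E → Mat N}
    (hB : B.HasTemperateGrowth) (hC : C.HasTemperateGrowth) : 𝓢(E, Mat N) →L[ℂ] 𝓢(E, Mat N) :=
  (SchwartzMap.bilinLeftCLM (ContinuousLinearMap.mul ℂ (Mat N)) hC).comp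
    (SchwartzMap.bilinLeftCLM (ContinuousLinearMap.mul ℂ (Mat N)).flip hB)

theorem sandwichCLM_apply {E : Type} [NormedAddCommGroup E] [NormedSpace ℝ E] {B C : E → Mat N}
    (hB : B.HasTemperateGrowth) (hC : C.HasTemperateGrowth) (k : 𝓢(E, Mat N)) (z : E) :
    sandwichCLM hB hC k z = B z * k z * C z := rfl

theorem IsGaugeField.hasTemperateGrowth_comp (h : IsGaugeField A) {E : Type}
    [NormedAddCommGroup E] [NormedSpace ℝ E] {f g : E → Space D} (hf : f.HasTemperateGrowth)
    (hg : g.HasTemperateGrowth) :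
    Function.HasTemperateGrowth (fun z : E => (transport A (f z) (g z) : Mat N)) :=
  h.hasTemperateGrowth_mat.comp (f := fun z : E => (f z, g z)) (HasTemperateGrowth.prodMk hf hg)

theorem hasTemperateGrowth_smul_snd (r : ℝ) :
    (fun z : Phase D => r • z.2).HasTemperateGrowth :=
  (r • ContinuousLinearMap.snd ℝ (Space D) (Space D)).hasTemperateGrowth

/-- The transport from `u - y/2` to `u`. -/
def transportLeft (A : Fin D → Space D → Mat N) (z : Phase D) : Mat N :=
  transport A z.1 (-(1 / 2 : ℝ) • z.2)

/-- The transport from `u` to `u + y/2`. -/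
def transportRight (A : Fin D → Space D → Mat N) (z : Phase D) : Mat N :=
  transport A (z.1 + (1 / 2 : ℝ) • z.2) (-(1 / 2 : ℝ) • z.2)

/-- The transport from `u` to `u - y/2`. -/
def transportLeftInv (A : Fin D → Space D → Mat N) (z : Phase D) : Mat N :=
  transport A (z.1 + -(1 / 2 : ℝ) • z.2) ((1 / 2 : ℝ) • z.2)

/-- The transport from `u + y/2` to `u`. -/
def transportRightInv (A : Fin D → Space D → Mat N) (z : Phase D) : Mat N :=
  transport A z.1 ((1 / 2 : ℝ) • z.2)

theorem star_transportLeft (h : IsGaugeField A) (z : Phase D) :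
    star (transportLeft A z) = transportLeftInv A z := by
  have h1 := star_transport h z.1 (-(1 / 2 : ℝ) • z.2)
  rw [← neg_smul, neg_neg] at h1
  exact h1

theorem star_transportRight (h : IsGaugeField A) (z : Phase D) :
    star (transportRight A z) = transportRightInv A z := by
  have h1 := star_transport h (z.1 + (1 / 2 : ℝ) • z.2) (-(1 / 2 : ℝ) • z.2)
  rw [← neg_smul, neg_neg, add_assoc, ← add_smul, add_neg_cancel, zero_smul, add_zero] at h1
  exact h1

theorem IsGaugeField.temperate_left (h : IsGaugeField A) :
    (transportLeft A).HasTemperateGrowth :=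
  h.hasTemperateGrowth_comp (f := fun z : Phase D => z.1) (g := fun z => -(1 / 2 : ℝ) • z.2)
    hasTemperateGrowth_fst (hasTemperateGrowth_smul_snd _)

theorem IsGaugeField.temperate_right (h : IsGaugeField A) :
    (transportRight A).HasTemperateGrowth :=
  h.hasTemperateGrowth_comp (f := fun z : Phase D => z.1 + (1 / 2 : ℝ) • z.2)
    (g := fun z => -(1 / 2 : ℝ) • z.2)
    (hasTemperateGrowth_fst.add (hasTemperateGrowth_smul_snd _)) (hasTemperateGrowth_smul_snd _)

theorem IsGaugeField.temperate_leftInv (h : IsGaugeField A) :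
    (transportLeftInv A).HasTemperateGrowth :=
  h.hasTemperateGrowth_comp (f := fun z : Phase D => z.1 + -(1 / 2 : ℝ) • z.2)
    (g := fun z => (1 / 2 : ℝ) • z.2)
    (hasTemperateGrowth_fst.add (hasTemperateGrowth_smul_snd _)) (hasTemperateGrowth_smul_snd _)

theorem IsGaugeField.temperate_rightInv (h : IsGaugeField A) :
    (transportRightInv A).HasTemperateGrowth :=
  h.hasTemperateGrowth_comp (f := fun z : Phase D => z.1) (g := fun z => (1 / 2 : ℝ) • z.2)
    hasTemperateGrowth_fst (hasTemperateGrowth_smul_snd _)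

theorem left_mul_leftInv (h : IsGaugeField A) (z : Phase D) :
    transportLeft A z * transportLeftInv A z = 1 := by
  rw [← star_transportLeft h]; exact h.mul_star_mat _ _

theorem leftInv_mul_left (h : IsGaugeField A) (z : Phase D) :
    transportLeftInv A z * transportLeft A z = 1 := by
  rw [← star_transportLeft h]; exact h.star_mul_mat _ _

theorem right_mul_rightInv (h : IsGaugeField A) (z : Phase D) :
    transportRight A z * transportRightInv A z = 1 := by
  rw [← star_transportRight h]; exact h.mul_star_mat _ _

theorem rightInv_mul_right (h : IsGaugeField A) (z : Phase D) :
    transportRightInv A z * transportRight A z = 1 := by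
  rw [← star_transportRight h]; exact h.star_mul_mat _ _

/-- The map from kernels to symbols: change to midpoint and difference, transport to the midpoint,
and Fourier integral over the difference. -/
def wignerCLM (h : IsGaugeField A) : 𝓢(Phase D, Mat N) →L[ℂ] 𝓢(Phase D, Mat N) :=
  phaseIntegral.comp ((sandwichCLM h.temperate_left h.temperate_right).comp
    (compCLMOfContinuousLinearEquiv ℂ midEquiv))

/-- The map from symbols to kernels. -/
def wignerInvCLM (h : IsGaugeField A) : 𝓢(Phase D, Mat N) →L[ℂ] 𝓢(Phase D, Mat N) :=
  (compCLMOfContinuousLinearEquiv ℂ midEquiv.symm).comp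
    ((sandwichCLM h.temperate_leftInv h.temperate_rightInv).comp phaseIntegralInv)

theorem wignerInvCLM_wignerCLM (h : IsGaugeField A) (k : 𝓢(Phase D, Mat N)) :
    wignerInvCLM h (wignerCLM h k) = k := by
  rw [wignerInvCLM, wignerCLM]
  simp only [ContinuousLinearMap.comp_apply, phaseIntegralInv_phaseIntegral]
  ext1 z
  change transportLeftInv A (midEquiv.symm z) * (transportLeft A (midEquiv.symm z) *
    k (midEquiv (midEquiv.symm z)) * transportRight A (midEquiv.symm z)) *
    transportRightInv A (midEquiv.symm z) = k z
  rw [ContinuousLinearEquiv.apply_symm_apply, mul_assoc, mul_assoc (_ * _), right_mul_rightInv h,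
    mul_one, ← mul_assoc, leftInv_mul_left h, one_mul]

theorem wignerCLM_wignerInvCLM (h : IsGaugeField A) (a : 𝓢(Phase D, Mat N)) :
    wignerCLM h (wignerInvCLM h a) = a := by
  have : (sandwichCLM h.temperate_left h.temperate_right) (compCLMOfContinuousLinearEquiv ℂ midEquiv
      (wignerInvCLM h a)) = phaseIntegralInv a := by
    ext1 z
    change transportLeft A z * (transportLeftInv A (midEquiv.symm (midEquiv z)) *
      phaseIntegralInv a (midEquiv.symm (midEquiv z)) *
      transportRightInv A (midEquiv.symm (midEquiv z))) * transportRight A z = phaseIntegralInv a z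
    rw [ContinuousLinearEquiv.symm_apply_apply, mul_assoc, mul_assoc (_ * _), rightInv_mul_right h,
      mul_one, ← mul_assoc, left_mul_leftInv h, one_mul]
  rw [wignerCLM]
  simp only [ContinuousLinearMap.comp_apply, this, phaseIntegral_phaseIntegralInv]

/-- The kernel of `e^{-iyπ/2} X e^{-iyπ/2}`. -/
theorem exists_sandwich_kernel (h : IsGaugeField A) {X : Op D N} {k : 𝓢(Phase D, Mat N)}
    (hk : HasSchwartzKernel X k) (y : Space D) :
    ∃ k' : 𝓢(Phase D, Mat N),
      HasSchwartzKernel ((wignerExp A y).comp (X.comp (wignerExp A y))) k' ∧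
      ∀ x, k' (x, x) = transportLeft A (x, y) * k (midEquiv (x, y)) * transportRight A (x, y) := by
  have hl : Function.HasTemperateGrowth (fun z : Phase D =>
      (transport A z.1 (-(1 / 2 : ℝ) • y) : Mat N)) :=
    h.hasTemperateGrowth_mat.comp (f := fun z : Phase D => (z.1, -(1 / 2 : ℝ) • y))
      (HasTemperateGrowth.prodMk hasTemperateGrowth_fst (.const _))
  have hr : Function.HasTemperateGrowth (fun z : Phase D =>
      (transport A (z.2 + (1 / 2 : ℝ) • y) (-(1 / 2 : ℝ) • y) : Mat N)) :=
    h.hasTemperateGrowth_mat.comp (f := fun z : Phase D =>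
      (z.2 + (1 / 2 : ℝ) • y, -(1 / 2 : ℝ) • y))
      (HasTemperateGrowth.prodMk (hasTemperateGrowth_snd.add (.const _)) (.const _))
  refine ⟨sandwichCLM hl hr
    (SchwartzMap.compSubConstCLM ℂ (-(-(1 / 2 : ℝ) • y, (1 / 2 : ℝ) • y)) k), fun f x => ?_,
    fun x => ?_⟩
  · change wignerExp A y (X (wignerExp A y f)) x = _
    rw [wignerExp_apply h, hk]
    have h1 := (transport A x (-(1 / 2 : ℝ) • y) : Mat N).integral_comp_comm
      (integrable_kernel_apply k (wignerExp A y f) (x + -(1 / 2 : ℝ) • y))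
    rw [← h1, ← integral_add_right_eq_self _ ((1 / 2 : ℝ) • y)]
    refine integral_congr_ae (.of_forall fun x' => ?_)
    simp only [wignerExp_apply h, sandwichCLM_apply, compSubConstCLM_apply, sub_neg_eq_add,
      Prod.mk_add_mk]
    rw [add_assoc x', ← add_smul, add_neg_cancel, zero_smul, add_zero]
    rfl
  · rw [sandwichCLM_apply, compSubConstCLM_apply, sub_neg_eq_add, Prod.mk_add_mk]
    rfl

theorem wignerIntegrand_eq (h : IsGaugeField A) {X : Op D N} {k : 𝓢(Phase D, Mat N)}
    (hk : HasSchwartzKernel X k) (x p y : Space D) :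
    wignerIntegrand A X x p y = Complex.exp (Complex.I * ((inner ℝ p y : ℝ) : ℂ)) •
      sandwichCLM h.temperate_left h.temperate_right
        (compCLMOfContinuousLinearEquiv ℂ midEquiv k) (x, y) := by
  obtain ⟨k', hk', hd⟩ := exists_sandwich_kernel h hk y
  rw [wignerIntegrand, hk'.braket_eq, hd]
  rfl

theorem wignerTransform_eq (h : IsGaugeField A) {X : Op D N} {k : 𝓢(Phase D, Mat N)}
    (hk : HasSchwartzKernel X k) (x p : Space D) :
    wignerTransform A X x p = wignerCLM h k (x, p) := by
  rw [wignerTransform, wignerCLM, ContinuousLinearMap.comp_apply, phaseIntegral_apply]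
  exact integral_congr_ae (.of_forall fun y => wignerIntegrand_eq h hk x p y)

theorem integrable_wignerIntegrand (h : IsGaugeField A) {X : Op D N} {k : 𝓢(Phase D, Mat N)}
    (hk : HasSchwartzKernel X k) (x p : Space D) : Integrable (wignerIntegrand A X x p) :=
  (integrable_phaseIntegral _ x p).congr
    (.of_forall fun y => (wignerIntegrand_eq h hk x p y).symm)

/-- Every Schwartz symbol comes from exactly one operator with a Schwartz kernel. -/
theorem existsUnique_wignerTransform (h : IsGaugeField A) (a : 𝓢(Phase D, Mat N)) :
    ∃! X : Op D N, (∃ k, HasSchwartzKernel X k) ∧ ∀ x p, wignerTransform A X x p = a (x, p) := by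
  refine ⟨kernelOp (wignerInvCLM h a), ⟨⟨_, hasSchwartzKernel_kernelOp _⟩, fun x p => ?_⟩, ?_⟩
  · rw [wignerTransform_eq h (hasSchwartzKernel_kernelOp _), wignerCLM_wignerInvCLM]
  · rintro X ⟨⟨k, hk⟩, hX⟩
    have : wignerCLM h k = a := by
      ext1 ⟨x, p⟩
      rw [← hX, wignerTransform_eq h hk]
    rw [hk.eq_kernelOp, ← this, wignerInvCLM_wignerCLM]

end Wigner

/-! ### The Weyl integral of a Schwartz symbol -/

section Inversion

variable {E V : Type} [NormedAddCommGroup E] [NormedSpace ℝ E]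
  [NormedAddCommGroup V] [InnerProductSpace ℝ V] [FiniteDimensional ℝ V]
  [MeasurableSpace V] [BorelSpace V]
  {F : Type} [NormedAddCommGroup F] [NormedSpace ℝ F] [NormedSpace ℂ F] [IsScalarTower ℝ ℂ F]
  [SMulCommClass ℝ ℂ F] [CompleteSpace F]

theorem norm_cexp_I_mul (r : ℝ) : ‖Complex.exp (Complex.I * (r : ℂ))‖ = 1 := by
  rw [mul_comm, Complex.norm_exp_ofReal_mul_I]

/-- Fourier inversion in the normalization of phase space. -/
theorem integral_phaseIntegral (h : 𝓢(E × V, F)) (x : E) (u : V) :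
    ∫ q, Complex.exp (Complex.I * ((-inner ℝ q u : ℝ) : ℂ)) • phaseIntegral h (x, q) =
      ((2 * Real.pi) ^ Module.finrank ℝ V : ℝ) • h (x, u) := by
  have h1 := Measure.integral_comp_smul (volume : Measure V)
    (fun q => Complex.exp (Complex.I * ((-inner ℝ q u : ℝ) : ℂ)) • phaseIntegral h (x, q))
    (2 * Real.pi)
  have h2 : ∫ ξ, (fun q => Complex.exp (Complex.I * ((-inner ℝ q u : ℝ) : ℂ)) •
      phaseIntegral h (x, q)) ((2 * Real.pi) • ξ) = h (x, u) := by
    conv_rhs => rw [← phaseIntegralInv_phaseIntegral h]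
    refine integral_congr_ae (.of_forall fun ξ => ?_)
    simp only [inner_smul_left, fourierPhase]
    rfl
  rw [h2, abs_of_pos (by positivity)] at h1
  rw [h1, smul_smul, mul_inv_cancel₀ (by positivity), one_smul]

end Inversion

section Oscillatory

variable {D : ℕ}

/-- The integral over phase space is invariant under the passage to midpoint and difference. -/
theorem integral_comp_midEquiv {F : Type} [NormedAddCommGroup F] [NormedSpace ℝ F]
    (H : 𝓢(Phase D, F)) : ∫ z, H (midEquiv z) = ∫ z, H z := by
  have hi : Integrable fun z : Space D × Space D => H z := H.integrable
  have hm : Integrable fun z : Space D × Space D => H (midEquiv z) :=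
    (compCLMOfContinuousLinearEquiv ℝ midEquiv H).integrable
  -- the shear `(z, y) ↦ (z, z + y)`
  have hs : Integrable fun z : Space D × Space D => H (z.1, z.1 + z.2) :=
    (measurePreserving_prod_add (volume : Measure (Space D)) volume).integrable_comp_of_integrable hi
  calc ∫ z : Space D × Space D, H (midEquiv z) = ∫ y, ∫ u, H (midEquiv (u, y)) :=
        integral_prod_symm _ hm
    _ = ∫ y, ∫ z, H (z, z + y) := by
        refine integral_congr_ae (.of_forall fun y => ?_)
        simp only [midEquiv_apply]
        rw [← integral_add_right_eq_self (fun z => H (z, z + y)) (-(1 / 2 : ℝ) • y)]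
        refine integral_congr_ae (.of_forall fun u => ?_)
        change H _ = H _
        congr 2
        rw [add_assoc]
        congr 1
        module
    _ = ∫ z, ∫ y, H (z, z + y) := (integral_prod_symm _ hs).symm.trans (integral_prod _ hs)
    _ = ∫ z, ∫ b, H (z, b) := by
        refine integral_congr_ae (.of_forall fun z => ?_)
        exact integral_add_left_eq_self (fun b => H (z, b)) z
    _ = ∫ z : Space D × Space D, H z := (integral_prod _ hi).symm

variable {W G F : Type}
  [NormedAddCommGroup W] [NormedSpace ℝ W] [NormedSpace ℂ W] [IsScalarTower ℝ ℂ W]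
  [SMulCommClass ℝ ℂ W] [CompleteSpace W]
  [NormedAddCommGroup G] [NormedSpace ℝ G] [NormedSpace ℂ G] [IsScalarTower ℝ ℂ G]
  [SMulCommClass ℝ ℂ G] [CompleteSpace G]
  [NormedAddCommGroup F] [NormedSpace ℂ F] [CompleteSpace F]

/-- An oscillating product of integrable functions of different variables is integrable. -/
theorem integrable_smul_apply_prod {X Y : Type} [MeasurableSpace X] [MeasurableSpace Y]
    [TopologicalSpace X] [TopologicalSpace Y] [SecondCountableTopology X]
    [SecondCountableTopology Y] [OpensMeasurableSpace X] [OpensMeasurableSpace Y]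
    {μ : Measure X} {ν : Measure Y} [SFinite μ] [SFinite ν] (ev : W →L[ℂ] G →L[ℂ] F)
    {T : X → W} {a : Y → G} {c : X × Y → ℂ}
    (hT : Integrable T μ) (ha : Integrable a ν) (hTc : Continuous T) (hac : Continuous a)
    (hc : Continuous c) (hc1 : ∀ w, ‖c w‖ ≤ 1) :
    Integrable (fun w : X × Y => c w • ev (T w.1) (a w.2)) (μ.prod ν) := by
  have h1 : Integrable (fun w : X × Y => ‖ev‖ * (‖T w.1‖ * ‖a w.2‖)) (μ.prod ν) :=
    (hT.norm.mul_prod ha.norm).const_mul _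
  have h2 : Continuous fun w : X × Y => c w • ev (T w.1) (a w.2) :=
    hc.smul ((ev.continuous.comp (hTc.comp continuous_fst)).clm_apply (hac.comp continuous_snd))
  refine h1.mono' h2.aestronglyMeasurable (.of_forall fun w => ?_)
  rw [norm_smul, ← mul_assoc]
  exact (mul_le_of_le_one_left (norm_nonneg _) (hc1 w)).trans (ev.le_opNorm₂ _ _)

theorem integrable_cexp_smul {X : Type} [MeasurableSpace X] [TopologicalSpace X]
    [SecondCountableTopology X] [OpensMeasurableSpace X] {μ : Measure X} {f : X → W} {θ : X → ℝ}
    (hf : Integrable f μ) (hfc : Continuous f) (hθ : Continuous θ) :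
    Integrable (fun x => Complex.exp (Complex.I * (θ x : ℂ)) • f x) μ := by
  have hc : Continuous fun x => Complex.exp (Complex.I * (θ x : ℂ)) := by fun_prop
  refine hf.norm.mono' (hc.smul hfc).aestronglyMeasurable (.of_forall fun x => ?_)
  rw [norm_smul, norm_cexp_I_mul, one_mul]

/-- The partial Fourier integral in the first variable. -/
def midpointTransform (Θ : 𝓢(Phase D, W)) : 𝓢(Phase D, W) :=
  swapCLM (phaseIntegral (swapCLM Θ))

/-- The partial Fourier integral `(x, p) ↦ ∫ dy e^{-ip·y} Θ(x, y)` in the second variable. -/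
def differenceTransform (Θ : 𝓢(Phase D, W)) : 𝓢(Phase D, W) :=
  reflectSnd (phaseIntegral Θ)

theorem midpointTransform_apply (Θ : 𝓢(Phase D, W)) (q y : Space D) :
    midpointTransform Θ (q, y) =
      ∫ u, Complex.exp (Complex.I * ((inner ℝ q u : ℝ) : ℂ)) • Θ (u, y) :=
  phaseIntegral_apply (swapCLM Θ) y q

theorem differenceTransform_apply (Θ : 𝓢(Phase D, W)) (x p : Space D) :
    differenceTransform Θ (x, p) =
      ∫ y, Complex.exp (Complex.I * ((-inner ℝ y p : ℝ) : ℂ)) • Θ (x, y) := by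
  refine (phaseIntegral_apply Θ x (-p)).trans ?_
  simp only [inner_neg_left, real_inner_comm]

theorem continuous_phase (x p : Space D) :
    Continuous fun w : Phase D => -(inner ℝ w.2 p + inner ℝ w.1 x) := by fun_prop

theorem integrable_midpointTransform (Θ : 𝓢(Phase D, W)) (x p : Space D) :
    Integrable fun w : Phase D =>
      Complex.exp (Complex.I * ((-(inner ℝ w.2 p + inner ℝ w.1 x) : ℝ) : ℂ)) •
        midpointTransform Θ w :=
  integrable_cexp_smul (midpointTransform Θ).integrable (midpointTransform Θ).continuous
    (continuous_phase x p)

/-- Fourier inversion in the first variable. -/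
theorem integral_midpointTransform (Θ : 𝓢(Phase D, W)) (x p : Space D) :
    ∫ w : Phase D, Complex.exp (Complex.I * ((-(inner ℝ w.2 p + inner ℝ w.1 x) : ℝ) : ℂ)) •
        midpointTransform Θ w = ((2 * Real.pi) ^ D : ℝ) • differenceTransform Θ (x, p) := by
  refine (integral_prod_symm _ (integrable_midpointTransform Θ x p)).trans ?_
  rw [differenceTransform_apply, ← integral_smul]
  refine integral_congr_ae (.of_forall fun y => ?_)
  have h1 := integral_phaseIntegral (swapCLM Θ) y x
  rw [finrank_euclideanSpace_fin] at h1
  change _ = ((2 * Real.pi) ^ D : ℝ) • _ • (swapCLM Θ) (y, x)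
  rw [smul_comm, ← h1, ← integral_smul]
  refine integral_congr_ae (.of_forall fun q => ?_)
  change _ = _ • _ • midpointTransform Θ (q, y)
  simp only [smul_smul, ← Complex.exp_add]
  congr 2
  push_cast
  ring

/-- Parseval's formula in the momentum, for fixed position. -/
theorem integral_differenceTransform_apply (ev : W →L[ℂ] G →L[ℂ] F) (Θ : 𝓢(Phase D, W))
    (κ : 𝓢(Phase D, G)) (x : Space D) :
    ∫ p, ev (differenceTransform Θ (x, p)) (phaseIntegral κ (x, p)) =
      ((2 * Real.pi) ^ D : ℝ) • ∫ y, ev (Θ (x, y)) (κ (x, y)) := by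
  set T := sliceLeft ℂ x Θ
  set a := sliceLeft ℂ x (phaseIntegral κ)
  have hθ : Continuous fun w : Space D × Space D => -inner ℝ w.1 w.2 := by fun_prop
  have hint : Integrable (fun w : Space D × Space D =>
      Complex.exp (Complex.I * ((-inner ℝ w.1 w.2 : ℝ) : ℂ)) • ev (T w.1) (a w.2))
      (volume.prod volume) :=
    integrable_smul_apply_prod ev T.integrable a.integrable T.continuous a.continuous
      (by fun_prop) fun w => (norm_cexp_I_mul _).le
  have h1 : ∀ p, ev (differenceTransform Θ (x, p)) (phaseIntegral κ (x, p)) =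
      ∫ y, Complex.exp (Complex.I * ((-inner ℝ y p : ℝ) : ℂ)) • ev (T y) (a p) := fun p => by
    have hc : Continuous fun y : Space D => -inner ℝ y p := by fun_prop
    have h2 := (ev.flip (phaseIntegral κ (x, p))).integral_comp_comm
      (integrable_cexp_smul (T.integrable (μ := volume)) T.continuous hc)
    rw [differenceTransform_apply]
    refine h2.symm.trans (integral_congr_ae (.of_forall fun y => ?_))
    simp only [map_smul]
    rfl
  simp only [h1]
  rw [← integral_integral_swap hint, ← integral_smul]
  refine integral_congr_ae (.of_forall fun y => ?_)
  have h3 := integral_phaseIntegral κ x y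
  rw [finrank_euclideanSpace_fin] at h3
  have hc : Continuous fun p : Space D => -inner ℝ p y := by fun_prop
  have h5 := (ev (T y)).integral_comp_comm
    (integrable_cexp_smul (a.integrable (μ := volume)) a.continuous hc)
  have h6 : ev (T y) (((2 * Real.pi) ^ D : ℝ) • κ (x, y)) =
      ((2 * Real.pi) ^ D : ℝ) • ev (T y) (κ (x, y)) := by
    have e1 : ∀ (r : ℝ) (v : G), r • v = (r : ℂ) • v := fun r v => (algebraMap_smul ℂ r v).symm
    rw [e1, map_smul, Complex.coe_smul]
  refine Eq.trans ?_ (h5.trans ((congrArg (ev (T y)) h3).trans h6))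
  refine integral_congr_ae (.of_forall fun p => ?_)
  simp only [map_smul, real_inner_comm]

theorem integrable_ev (ev : W →L[ℂ] G →L[ℂ] F) (Θ : 𝓢(Phase D, W)) (κ : 𝓢(Phase D, G)) :
    Integrable (fun z : Space D × Space D => ev (Θ z) (κ z)) (volume.prod volume) :=
  (SchwartzMap.bilinLeftCLM ev κ.hasTemperateGrowth Θ).integrable (μ := (volume : Measure (Phase D)))

/-- Parseval's formula on phase space. -/
theorem integral_differenceTransform (ev : W →L[ℂ] G →L[ℂ] F) (Θ : 𝓢(Phase D, W))
    (κ : 𝓢(Phase D, G)) :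
    ∫ z : Phase D, ev (differenceTransform Θ z) (phaseIntegral κ z) =
      ((2 * Real.pi) ^ D : ℝ) • ∫ z : Phase D, ev (Θ z) (κ z) := by
  refine (integral_prod _ (integrable_ev ev (differenceTransform Θ) (phaseIntegral κ))).trans ?_
  simp only [integral_differenceTransform_apply]
  rw [integral_smul]
  congr 1
  exact (integral_prod _ (integrable_ev ev Θ κ)).symm

/-- Fourier inversion in the first variable, for matrix elements. -/
theorem integral_ev_midpointTransform (ev : W →L[ℂ] G →L[ℂ] F) (Θ : 𝓢(Phase D, W)) (m : G)
    (x p : Space D) :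
    Integrable (fun w : Phase D =>
      Complex.exp (Complex.I * ((-(inner ℝ w.2 p + inner ℝ w.1 x) : ℝ) : ℂ)) •
        ev (midpointTransform Θ w) m) ∧
    ∫ w : Phase D, Complex.exp (Complex.I * ((-(inner ℝ w.2 p + inner ℝ w.1 x) : ℝ) : ℂ)) •
        ev (midpointTransform Θ w) m =
      ((2 * Real.pi) ^ D : ℝ) • ev (differenceTransform Θ (x, p)) m := by
  have h2 := (ev.flip m).integral_comp_comm (integrable_midpointTransform Θ x p)
  have h3 := (ev.flip m).integrable_comp (integrable_midpointTransform Θ x p)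
  rw [integral_midpointTransform] at h2
  have e1 : ∀ (r : ℝ) (v : W), r • v = (r : ℂ) • v := fun r v => (algebraMap_smul ℂ r v).symm
  rw [e1, map_smul, Complex.coe_smul] at h2
  simp only [map_smul] at h2 h3
  exact ⟨h3, h2⟩

/-- The oscillatory integral that pairs a symbol with `Θ`. -/
theorem integral_midpointTransform_apply (ev : W →L[ℂ] G →L[ℂ] F) (Θ : 𝓢(Phase D, W))
    (κ : 𝓢(Phase D, G)) :
    Integrable (fun w : Phase D × Phase D =>
      Complex.exp (Complex.I * ((-(inner ℝ w.1.2 w.2.2 + inner ℝ w.1.1 w.2.1) : ℝ) : ℂ)) •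
        ev (midpointTransform Θ w.1) (phaseIntegral κ w.2)) ∧
    ∫ w : Phase D × Phase D,
      Complex.exp (Complex.I * ((-(inner ℝ w.1.2 w.2.2 + inner ℝ w.1.1 w.2.1) : ℝ) : ℂ)) •
        ev (midpointTransform Θ w.1) (phaseIntegral κ w.2) =
      ((2 * Real.pi) ^ (2 * D) : ℝ) • ∫ z : Phase D, ev (Θ z) (κ z) := by
  have hint : Integrable (fun w : Phase D × Phase D =>
      Complex.exp (Complex.I * ((-(inner ℝ w.1.2 w.2.2 + inner ℝ w.1.1 w.2.1) : ℝ) : ℂ)) •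
        ev (midpointTransform Θ w.1) (phaseIntegral κ w.2)) (volume.prod volume) :=
    integrable_smul_apply_prod ev (midpointTransform Θ).integrable (phaseIntegral κ).integrable
      (midpointTransform Θ).continuous (phaseIntegral κ).continuous (by fun_prop)
      fun w => (norm_cexp_I_mul _).le
  refine ⟨hint, (integral_prod_symm _ hint).trans ?_⟩
  have h1 := fun z : Phase D =>
    (integral_ev_midpointTransform ev Θ (phaseIntegral κ z) z.1 z.2).2
  simp only [h1]
  rw [integral_smul]
  rw [integral_differenceTransform, smul_smul, ← pow_add, ← two_mul]

end Oscillatory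

section Hom

variable (G F E : Type) [NormedAddCommGroup G] [NormedSpace ℂ G] [NormedAddCommGroup F]
  [NormedSpace ℂ F] [NormedAddCommGroup E] [NormedSpace ℂ E]

/-- Bounded operators between normed spaces, with the operator norm. -/
abbrev Hom := G →L[ℂ] F

/-- The evaluation of operators. -/
def homEval : Hom G F →L[ℂ] G →L[ℂ] F := ContinuousLinearMap.id ℂ _

/-- The composition of operators. -/
def homComp : Hom G F →L[ℂ] (F →L[ℂ] F) →L[ℂ] Hom G F := (ContinuousLinearMap.compL ℂ G F F).flip

/-- The action of vectors on operators. -/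
def homApply : E →L[ℂ] Hom (E →L[ℂ] F) F := ContinuousLinearMap.apply ℂ F

end Hom

section Weyl

variable {D N : ℕ} {A : Fin D → Space D → Mat N}

/-- The operator-valued function
`Θ(u, y) m = φ(u - y/2) U(u - y/2, u) m U(u, u + y/2) ψ(u + y/2)`. -/
def weylTheta (h : IsGaugeField A) (φ : 𝓢(Space D, ℂ)) (ψ : Wave D N) :
    𝓢(Phase D, Hom (Mat N) (Inner N)) :=
  SchwartzMap.bilinLeftCLM (homComp (Mat N) (Inner N)) h.temperate_leftInv
    (SchwartzMap.postcompCLM (𝕜 := ℂ) (homApply (Inner N) (Inner N))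
      (SchwartzMap.bilinLeftCLM (ContinuousLinearMap.id ℂ (Mat N)).flip h.temperate_rightInv
        (compCLMOfContinuousLinearEquiv ℂ midEquiv (tensorCLM φ ψ))))

theorem weylTheta_apply (h : IsGaugeField A) (φ : 𝓢(Space D, ℂ)) (ψ : Wave D N) (u y : Space D)
    (m : Mat N) :
    weylTheta h φ ψ (u, y) m = transportLeftInv A (u, y) (m (transportRightInv A (u, y)
      (φ (u + -(1 / 2 : ℝ) • y) • ψ (u + (1 / 2 : ℝ) • y)))) := rfl

theorem hasExp_weyl (h : IsGaugeField A) (y p : Space D) :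
    HasExp ((Complex.I / 2) • dotOp y (covMomentum A) p) := by
  rw [weylExp_generator]; exact (hasExp_dotOp_covMomentum h _ _).1

theorem hasExp_wigner (h : IsGaugeField A) (y : Space D) :
    HasExp (-(Complex.I / 2) • dotOp y (covMomentum A) 0) := by
  rw [wignerExp_generator]; exact (hasExp_dotOp_covMomentum h _ _).1

/-- The Weyl integrand, evaluated at `u - y/2`. The two exponentials of the momentum translate to
`u` and on to `u + y/2`, so that `u` is the midpoint, where `e^{iq·(x̂ - x)}` acts; the phases in
`x` and `p` split off. -/
theorem weylIntegrand_apply (h : IsGaugeField A) (q y x p : Space D) (m : Mat N) (ψ : Wave D N)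
    (u : Space D) :
    weylIntegrand A q y x p m ψ (u + -(1 / 2 : ℝ) • y) =
      Complex.exp (Complex.I * ((-(inner ℝ y p + inner ℝ q x) : ℝ) : ℂ)) •
      Complex.exp (Complex.I * ((inner ℝ q u : ℝ) : ℂ)) •
        transportLeftInv A (u, y) (m (transportRightInv A (u, y) (ψ (u + (1 / 2 : ℝ) • y)))) := by
  have hu : u + -(1 / 2 : ℝ) • y + (1 / 2 : ℝ) • y = u := by
    rw [add_assoc, ← add_smul, neg_add_cancel, zero_smul, add_zero]
  have hm : (fun _ : Space D => m).HasTemperateGrowth := .const m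
  rw [weylIntegrand, weylExp_generator]
  simp only [ContinuousLinearMap.comp_apply]
  rw [(hasExp_dotOp_covMomentum h _ _).2, hu, (hasExp_dotOp_position q x).2, mulOp_apply hm,
    (hasExp_dotOp_covMomentum h _ _).2]
  simp only [map_smul, smul_smul, ← Complex.exp_add]
  have e : Complex.I * ((-inner ℝ ((1 / 2 : ℝ) • y) p : ℝ) : ℂ) +
      (Complex.I * ((inner ℝ q (u - x) : ℝ) : ℂ) +
        Complex.I * ((-inner ℝ ((1 / 2 : ℝ) • y) p : ℝ) : ℂ)) =
      Complex.I * ((-(inner ℝ y p + inner ℝ q x) : ℝ) : ℂ) +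
        Complex.I * ((inner ℝ q u : ℝ) : ℂ) := by
    rw [← mul_add, ← mul_add, ← mul_add, real_inner_smul_left, inner_sub_right]
    push_cast
    ring
  rw [← add_assoc] at e ⊢
  rw [e]
  rfl

/-- A matrix element of the Weyl integrand is a phase in `(x, p)` times a Fourier transform in the
midpoint. -/
theorem pair_weylIntegrand (h : IsGaugeField A) (q y x p : Space D) (m : Mat N) (ψ : Wave D N)
    (φ : 𝓢(Space D, ℂ)) : pair φ (weylIntegrand A q y x p m ψ) =
      Complex.exp (Complex.I * ((-(inner ℝ y p + inner ℝ q x) : ℝ) : ℂ)) •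
        homEval (Mat N) (Inner N) (midpointTransform (weylTheta h φ ψ) (q, y)) m := by
  rw [pair, ← integral_add_right_eq_self _ (-(1 / 2 : ℝ) • y), midpointTransform_apply]
  have h1 := ((homEval (Mat N) (Inner N)).flip m).integral_comp_comm
    (integrable_phaseIntegral (swapCLM (weylTheta h φ ψ)) y q)
  refine Eq.trans ?_ (congrArg _ h1)
  rw [← integral_smul]
  refine integral_congr_ae (.of_forall fun u => ?_)
  change φ (u + -(1 / 2 : ℝ) • y) • weylIntegrand A q y x p m ψ (u + -(1 / 2 : ℝ) • y) =
    Complex.exp (Complex.I * ((-(inner ℝ y p + inner ℝ q x) : ℝ) : ℂ)) •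
      (homEval (Mat N) (Inner N)).flip m
        (Complex.exp (Complex.I * ((inner ℝ q u : ℝ) : ℂ)) • weylTheta h φ ψ (u, y))
  rw [map_smul]
  change _ = _ • _ • weylTheta h φ ψ (u, y) m
  rw [weylIntegrand_apply h, weylTheta_apply, map_smul, map_smul, map_smul]
  simp only [smul_smul]
  congr 1
  ring

/-- The integral over `(q, y)` of the matrix elements of the Weyl integrand converges absolutely and
is, as a function of `(x, p)`, a Schwartz function. -/
theorem integral_pair_weylIntegrand (h : IsGaugeField A) (ψ : Wave D N) (φ : 𝓢(Space D, ℂ))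
    (x p : Space D) (m : Mat N) :
    Integrable (fun w : Phase D => pair φ (weylIntegrand A w.1 w.2 x p m ψ)) ∧
    ∫ w : Phase D, pair φ (weylIntegrand A w.1 w.2 x p m ψ) =
      ((2 * Real.pi) ^ D : ℝ) •
        homEval (Mat N) (Inner N) (differenceTransform (weylTheta h φ ψ) (x, p)) m := by
  simp only [pair_weylIntegrand h]
  exact integral_ev_midpointTransform (homEval (Mat N) (Inner N)) (weylTheta h φ ψ) m x p

/-- The function `(x, x') ↦ φ(x) k(x, x') ψ(x')`, whose integral is a matrix element of the operator
with kernel `k`. -/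
def matrixElement (φ : 𝓢(Space D, ℂ)) (k : 𝓢(Phase D, Mat N)) (ψ : Wave D N) :
    𝓢(Phase D, Inner N) :=
  SchwartzMap.smulLeftCLM (Inner N) (fun z : Phase D => φ z.1) (kernelMulCLM k ψ)

theorem matrixElement_apply (φ : 𝓢(Space D, ℂ)) (k : 𝓢(Phase D, Mat N)) (ψ : Wave D N)
    (z : Phase D) : matrixElement φ k ψ z = φ z.1 • k z (ψ z.2) := by
  have hφ : Function.HasTemperateGrowth (fun z : Phase D => φ z.1) :=
    φ.hasTemperateGrowth.comp hasTemperateGrowth_fst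
  rw [matrixElement, SchwartzMap.smulLeftCLM_apply_apply hφ, kernelMulCLM_apply]

/-- The transports in `weylTheta` cancel those in the Wigner transform. -/
theorem integral_weylTheta_apply (h : IsGaugeField A) (ψ : Wave D N) (φ : 𝓢(Space D, ℂ))
    (k : 𝓢(Phase D, Mat N)) :
    ∫ z : Phase D, homEval (Mat N) (Inner N) (weylTheta h φ ψ z)
      (sandwichCLM h.temperate_left h.temperate_right
        (compCLMOfContinuousLinearEquiv ℂ midEquiv k) z) =
      ∫ z, matrixElement φ k ψ z := by
  have h1 : ∀ z : Phase D, homEval (Mat N) (Inner N) (weylTheta h φ ψ z)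
      (sandwichCLM h.temperate_left h.temperate_right
        (compCLMOfContinuousLinearEquiv ℂ midEquiv k) z) =
      matrixElement φ k ψ (midEquiv z) := fun z => by
    have e1 : ∀ v, transportLeftInv A z (transportLeft A z v) = v := fun v =>
      congrArg (fun m : Mat N => m v) (leftInv_mul_left h z)
    have e2 : ∀ v, transportRight A z (transportRightInv A z v) = v := fun v =>
      congrArg (fun m : Mat N => m v) (right_mul_rightInv h z)
    rw [matrixElement_apply]
    change transportLeftInv A z (transportLeft A z (k (midEquiv z) (transportRight A z
      (transportRightInv A z (φ (midEquiv z).1 • ψ (midEquiv z).2))))) = _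
    rw [e1, e2, map_smul]
  simp only [h1]
  rw [integral_comp_midEquiv]

/-- The matrix elements of an operator in terms of its kernel. -/
theorem integral_matrixElement (ψ : Wave D N) (φ : 𝓢(Space D, ℂ)) {X : Op D N}
    {k : 𝓢(Phase D, Mat N)} (hk : HasSchwartzKernel X k) :
    ∫ z, matrixElement φ k ψ z = pair φ (X ψ) := by
  have hi : Integrable (fun z : Space D × Space D => matrixElement φ k ψ z) (volume.prod volume) :=
    (matrixElement φ k ψ).integrable (μ := (volume : Measure (Phase D)))
  refine (integral_prod _ hi).trans ?_
  change _ = ∫ z, φ z • X ψ z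
  refine integral_congr_ae (.of_forall fun z => ?_)
  simp only [matrixElement_apply, hk ψ z]
  exact integral_smul _ _

/-- The Weyl integral inverts the Wigner transform on operators with a Schwartz kernel. -/
theorem isWeylIntegral (h : IsGaugeField A) {X : Op D N} {k : 𝓢(Phase D, Mat N)}
    (hk : HasSchwartzKernel X k) : IsWeylIntegral A (wignerTransform A X) X := by
  intro ψ φ
  set κ := sandwichCLM h.temperate_left h.temperate_right
    (compCLMOfContinuousLinearEquiv ℂ midEquiv k) with hκ
  have ha : ∀ x p, wignerTransform A X x p = phaseIntegral κ (x, p) := fun x p =>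
    wignerTransform_eq h hk x p
  simp only [pair_weylIntegrand h, ha]
  have key := integral_midpointTransform_apply (homEval (Mat N) (Inner N)) (weylTheta h φ ψ) κ
  refine ⟨key.1, ?_⟩
  refine Eq.trans ?_ (congrArg _ key.2.symm)
  rw [integral_weylTheta_apply, integral_matrixElement ψ φ hk, smul_smul, inv_mul_cancel₀ (by positivity), one_smul]

end Weyl

/-! ### Symbols of tempered kernels -/

section Symmetry

variable {D : ℕ} {W G F : Type}
  [NormedAddCommGroup W] [NormedSpace ℝ W] [NormedSpace ℂ W] [IsScalarTower ℝ ℂ W]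
  [SMulCommClass ℝ ℂ W] [CompleteSpace W]
  [NormedAddCommGroup G] [NormedSpace ℝ G] [NormedSpace ℂ G] [IsScalarTower ℝ ℂ G]
  [SMulCommClass ℝ ℂ G] [CompleteSpace G]
  [NormedAddCommGroup F] [NormedSpace ℂ F] [CompleteSpace F]

/-- The partial Fourier integral is symmetric with respect to the pairing `∫ ev (Θ z) (κ z) dz`. -/
theorem integral_phaseIntegral_symm (ev : W →L[ℂ] G →L[ℂ] F) (Θ : 𝓢(Phase D, W))
    (κ : 𝓢(Phase D, G)) :
    ∫ z : Phase D, ev (Θ z) (phaseIntegral κ z) = ∫ z : Phase D, ev (phaseIntegral Θ z) (κ z) := by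
  refine (integral_prod _ (integrable_ev ev Θ (phaseIntegral κ))).trans
    (Eq.trans ?_ (integral_prod _ (integrable_ev ev (phaseIntegral Θ) κ)).symm)
  refine integral_congr_ae (.of_forall fun x => ?_)
  set T := sliceLeft ℂ x Θ
  set a := sliceLeft ℂ x κ
  have hθ : Continuous fun w : Space D × Space D => inner ℝ w.1 w.2 := by fun_prop
  have hint : Integrable (fun w : Space D × Space D =>
      Complex.exp (Complex.I * ((inner ℝ w.1 w.2 : ℝ) : ℂ)) • ev (T w.1) (a w.2))
      (volume.prod volume) :=
    integrable_smul_apply_prod ev T.integrable a.integrable T.continuous a.continuous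
      (by fun_prop) fun w => (norm_cexp_I_mul _).le
  have h1 : ∀ p, ev (T p) (phaseIntegral κ (x, p)) =
      ∫ y, Complex.exp (Complex.I * ((inner ℝ p y : ℝ) : ℂ)) • ev (T p) (a y) := fun p => by
    rw [phaseIntegral_apply]
    refine ((ev (T p)).integral_comp_comm (integrable_phaseIntegral κ x p)).symm.trans ?_
    simp only [map_smul]
    rfl
  have h2 : ∀ y, ev (phaseIntegral Θ (x, y)) (a y) =
      ∫ p, Complex.exp (Complex.I * ((inner ℝ p y : ℝ) : ℂ)) • ev (T p) (a y) := fun y => by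
    rw [phaseIntegral_apply]
    refine ((ev.flip (a y)).integral_comp_comm (integrable_phaseIntegral Θ x y)).symm.trans ?_
    refine integral_congr_ae (.of_forall fun p => ?_)
    simp only [map_smul, real_inner_comm]
    rfl
  change ∫ p, ev (T p) (phaseIntegral κ (x, p)) = ∫ y, ev (phaseIntegral Θ (x, y)) (a y)
  simp only [h1, h2]
  exact integral_integral_swap hint

theorem integral_sum_four {α ι : Type} [Fintype ι] [MeasurableSpace α] {μ : Measure α}
    [NormedSpace ℝ F] {f : ι → ι → ι → ι → α → F} (hf : ∀ i j k l, Integrable (f i j k l) μ) :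
    ∫ z, ∑ i, ∑ j, ∑ k, ∑ l, f i j k l z ∂μ = ∑ i, ∑ j, ∑ k, ∑ l, ∫ z, f i j k l z ∂μ := by
  rw [integral_finsetSum _ fun i _ => integrable_finsetSum _ fun j _ =>
    integrable_finsetSum _ fun k _ => integrable_finsetSum _ fun l _ => hf i j k l]
  refine Finset.sum_congr rfl fun i _ => ?_
  rw [integral_finsetSum _ fun j _ =>
    integrable_finsetSum _ fun k _ => integrable_finsetSum _ fun l _ => hf i j k l]
  refine Finset.sum_congr rfl fun j _ => ?_
  rw [integral_finsetSum _ fun k _ => integrable_finsetSum _ fun l _ => hf i j k l]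
  refine Finset.sum_congr rfl fun k _ => ?_
  rw [integral_finsetSum _ fun l _ => hf i j k l]

end Symmetry

section Distributions

variable {D N : ℕ}

/-- Schwartz functions as tempered distributions on phase space. -/
abbrev toDist (k : 𝓢(Phase D, Mat N)) : 𝓢'(Phase D, Mat N) :=
  SchwartzMap.toTemperedDistributionCLM (Phase D) (Mat N) volume k

theorem toDist_apply (k : 𝓢(Phase D, Mat N)) (φ : 𝓢(Phase D, ℂ)) :
    toDist k φ = ∫ z, φ z • k z := toTemperedDistributionCLM_apply_apply volume k φ

/-- Weakly continuous maps on tempered distributions are determined by their values on Schwartz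
functions. -/
theorem eq_of_forall_toDist {M : Type} [TopologicalSpace M] [T2Space M]
    {f g : 𝓢'(Phase D, Mat N) → M} (hf : Continuous f) (hg : Continuous g)
    (h : ∀ k, f (toDist k) = g (toDist k)) : f = g :=
  (dense_schwartz (E := Phase D) (Mat N)).equalizer hf hg (funext h)

theorem sum_dist_apply {E F ι : Type} [NormedAddCommGroup E] [NormedSpace ℝ E]
    [NormedAddCommGroup F] [NormedSpace ℂ F] (s : Finset ι) (u : ι → 𝓢'(E, F)) (φ : 𝓢(E, ℂ)) :
    (∑ i ∈ s, u i) φ = ∑ i ∈ s, u i φ :=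
  map_sum (PointwiseConvergenceCLM.evalCLM (RingHom.id ℂ) F φ) u s

/-- The product `B T C` of a distribution with matrix functions, expanded in matrix units so that
only products of test functions with scalar functions occur. -/
def sandwichDist (B C : Phase D → Mat N) : 𝓢'(Phase D, Mat N) →L[ℂ] 𝓢'(Phase D, Mat N) :=
  ∑ i, ∑ j, ∑ k, ∑ l,
    (PointwiseConvergenceCLM.postcomp 𝓢(Phase D, ℂ)
      (ContinuousLinearMap.mulLeftRight ℂ (Mat N) (matUnit i j) (matUnit k l))).comp
    (PointwiseConvergenceCLM.precomp (Mat N)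
      (SchwartzMap.smulLeftCLM ℂ (fun w : Phase D => entry (B w) i j * entry (C w) k l)))

theorem sandwichDist_apply (B C : Phase D → Mat N) (T : 𝓢'(Phase D, Mat N)) (φ : 𝓢(Phase D, ℂ)) :
    sandwichDist B C T φ = ∑ i, ∑ j, ∑ k, ∑ l, matUnit i j *
      T (SchwartzMap.smulLeftCLM ℂ (fun w : Phase D => entry (B w) i j * entry (C w) k l) φ) *
        matUnit k l := by
  simp only [sandwichDist, _root_.sum_apply]
  rfl

theorem hasTemperateGrowth_entry {E : Type} [NormedAddCommGroup E] [NormedSpace ℝ E]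
    {B : E → Mat N} (hB : B.HasTemperateGrowth) (i j : Fin N) :
    (fun w => entry (B w) i j).HasTemperateGrowth :=
  ((entryCLM i j).restrictScalars ℝ).hasTemperateGrowth.comp hB

/-- The product of distributions with matrix functions extends that of Schwartz functions. -/
theorem sandwichDist_toDist {B C : Phase D → Mat N} (hB : B.HasTemperateGrowth)
    (hC : C.HasTemperateGrowth) (k : 𝓢(Phase D, Mat N)) :
    sandwichDist B C (toDist k) = toDist (sandwichCLM hB hC k) := by
  ext1 φ
  rw [sandwichDist_apply]
  set χ : Fin N → Fin N → Fin N → Fin N → 𝓢(Phase D, ℂ) := fun i j p l =>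
    SchwartzMap.smulLeftCLM ℂ (fun w : Phase D => entry (B w) i j * entry (C w) p l) φ with hχ
  have hval : ∀ i j p l z, χ i j p l z = (entry (B z) i j * entry (C z) p l) * φ z :=
    fun i j p l z => SchwartzMap.smulLeftCLM_apply_apply
      ((hasTemperateGrowth_entry hB i j).mul (hasTemperateGrowth_entry hC p l)) φ z
  have hi : ∀ i j p l, Integrable fun z => χ i j p l z • k z := fun i j p l =>
    (SchwartzMap.smulLeftCLM (Mat N) (χ i j p l) k).integrable.congr (.of_forall fun z =>
      SchwartzMap.smulLeftCLM_apply_apply (χ i j p l).hasTemperateGrowth k z)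
  have hint : ∀ i j p l, Integrable fun z => matUnit i j * (χ i j p l z • k z) * matUnit p l :=
    fun i j p l => (ContinuousLinearMap.mulLeftRight ℂ (Mat N) (matUnit i j)
      (matUnit p l)).integrable_comp (hi i j p l)
  have hmul : ∀ i j p l, matUnit i j * toDist k (χ i j p l) * matUnit p l =
      ∫ z, matUnit i j * (χ i j p l z • k z) * matUnit p l := fun i j p l => by
    rw [toDist_apply]
    exact ((ContinuousLinearMap.mulLeftRight ℂ (Mat N) (matUnit i j)
      (matUnit p l)).integral_comp_comm (hi i j p l)).symm
  refine (Finset.sum_congr rfl fun i _ => Finset.sum_congr rfl fun j _ => Finset.sum_congr rfl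
    fun p _ => Finset.sum_congr rfl fun l _ => hmul i j p l).trans ?_
  rw [← integral_sum_four hint, toDist_apply]
  refine integral_congr_ae (.of_forall fun z => ?_)
  simp only [hval, sandwichCLM_apply]
  conv_rhs => rw [← sum_entry_smul_matUnit (B z)]
  simp only [Finset.sum_mul, Finset.smul_sum]
  refine Finset.sum_congr rfl fun i _ => Finset.sum_congr rfl fun j _ => ?_
  conv_rhs => rw [← sum_entry_smul_matUnit (C z)]
  simp only [Finset.mul_sum, Finset.smul_sum]
  refine Finset.sum_congr rfl fun p _ => Finset.sum_congr rfl fun l _ => ?_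
  simp only [mul_smul_comm, smul_mul_assoc, smul_smul]
  congr 1
  ring

/-- The partial Fourier integral is symmetric. -/
theorem integral_smul_phaseIntegral (φ : 𝓢(Phase D, ℂ)) (κ : 𝓢(Phase D, Mat N)) :
    ∫ z : Phase D, φ z • phaseIntegral κ z = ∫ z : Phase D, phaseIntegral φ z • κ z :=
  integral_phaseIntegral_symm (ContinuousLinearMap.lsmul ℂ ℂ : ℂ →L[ℂ] Mat N →L[ℂ] Mat N) φ κ

theorem toDist_phaseIntegral (k : 𝓢(Phase D, Mat N)) :
    PointwiseConvergenceCLM.precomp (Mat N) phaseIntegral (toDist k) =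
      toDist (phaseIntegral k) := by
  ext1 φ
  exact (toDist_apply k _).trans ((integral_smul_phaseIntegral φ k).symm.trans (toDist_apply _ φ).symm)

theorem toDist_phaseIntegralInv (k : 𝓢(Phase D, Mat N)) :
    PointwiseConvergenceCLM.precomp (Mat N) phaseIntegralInv (toDist k) =
      toDist (phaseIntegralInv k) := by
  ext1 φ
  refine (toDist_apply k _).trans (Eq.trans ?_ (toDist_apply _ φ).symm)
  have h := integral_smul_phaseIntegral (phaseIntegralInv φ) (phaseIntegralInv k)
  rwa [phaseIntegral_phaseIntegralInv, phaseIntegral_phaseIntegralInv] at h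

/-- The transpose of the inverse of `midEquiv` extends the composition with `midEquiv`, since the map
preserves the volume. -/
theorem toDist_comp_midEquiv (k : 𝓢(Phase D, Mat N)) :
    PointwiseConvergenceCLM.precomp (Mat N) (compCLMOfContinuousLinearEquiv ℂ midEquiv.symm)
      (toDist k) = toDist (compCLMOfContinuousLinearEquiv ℂ midEquiv k) := by
  ext1 φ
  refine (toDist_apply k _).trans (Eq.trans ?_ (toDist_apply _ φ).symm)
  set H : 𝓢(Phase D, Mat N) := SchwartzMap.smulLeftCLM (Mat N)
    (compCLMOfContinuousLinearEquiv ℂ midEquiv.symm φ) k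
  have hH : ∀ z, H z = φ (midEquiv.symm z) • k z := fun z =>
    SchwartzMap.smulLeftCLM_apply_apply (SchwartzMap.hasTemperateGrowth _) _ _
  refine Eq.trans ?_ ((integral_comp_midEquiv H).symm.trans ?_)
  · exact integral_congr_ae (.of_forall fun z => (hH z).symm)
  · refine integral_congr_ae (.of_forall fun z => (hH _).trans ?_)
    rw [ContinuousLinearEquiv.symm_apply_apply]
    rfl

theorem toDist_comp_midEquiv_symm (k : 𝓢(Phase D, Mat N)) :
    PointwiseConvergenceCLM.precomp (Mat N) (compCLMOfContinuousLinearEquiv ℂ midEquiv)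
      (toDist k) = toDist (compCLMOfContinuousLinearEquiv ℂ midEquiv.symm k) := by
  have h := toDist_comp_midEquiv (compCLMOfContinuousLinearEquiv ℂ midEquiv.symm k)
  have e : compCLMOfContinuousLinearEquiv ℂ midEquiv
      (compCLMOfContinuousLinearEquiv ℂ midEquiv.symm k) = k := by
    ext1 z
    exact congrArg k (ContinuousLinearEquiv.symm_apply_apply _ z)
  rw [e] at h
  rw [← h]
  ext1 φ
  refine congrArg (toDist (compCLMOfContinuousLinearEquiv ℂ midEquiv.symm k)) ?_
  ext1 z
  exact congrArg φ (ContinuousLinearEquiv.apply_symm_apply _ z)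

end Distributions

section Symbols

variable {D N : ℕ} {A : Fin D → Space D → Mat N}

/-- The map from tempered kernels to tempered symbols: the transpose of the steps of `wignerCLM`. -/
def wignerDist (A : Fin D → Space D → Mat N) : 𝓢'(Phase D, Mat N) →L[ℂ] 𝓢'(Phase D, Mat N) :=
  (PointwiseConvergenceCLM.precomp (Mat N) phaseIntegral).comp
    ((sandwichDist (transportLeft A) (transportRight A)).comp
      (PointwiseConvergenceCLM.precomp (Mat N)
        (compCLMOfContinuousLinearEquiv ℂ midEquiv.symm)))

/-- The map from tempered symbols to tempered kernels. -/
def wignerInvDist (A : Fin D → Space D → Mat N) : 𝓢'(Phase D, Mat N) →L[ℂ] 𝓢'(Phase D, Mat N) :=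
  (PointwiseConvergenceCLM.precomp (Mat N) (compCLMOfContinuousLinearEquiv ℂ midEquiv)).comp
    ((sandwichDist (transportLeftInv A) (transportRightInv A)).comp
      (PointwiseConvergenceCLM.precomp (Mat N) phaseIntegralInv))

theorem wignerDist_toDist (h : IsGaugeField A) (k : 𝓢(Phase D, Mat N)) :
    wignerDist A (toDist k) = toDist (wignerCLM h k) := by
  simp only [wignerDist, wignerCLM, ContinuousLinearMap.comp_apply]
  rw [toDist_comp_midEquiv, sandwichDist_toDist h.temperate_left h.temperate_right,
    toDist_phaseIntegral]

theorem wignerInvDist_toDist (h : IsGaugeField A) (k : 𝓢(Phase D, Mat N)) :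
    wignerInvDist A (toDist k) = toDist (wignerInvCLM h k) := by
  simp only [wignerInvDist, wignerInvCLM, ContinuousLinearMap.comp_apply]
  rw [toDist_phaseIntegralInv, sandwichDist_toDist h.temperate_leftInv h.temperate_rightInv,
    toDist_comp_midEquiv_symm]

theorem wignerInvDist_wignerDist (h : IsGaugeField A) (K : 𝓢'(Phase D, Mat N)) :
    wignerInvDist A (wignerDist A K) = K :=
  congrFun (eq_of_forall_toDist ((wignerInvDist A).continuous.comp (wignerDist A).continuous)
    continuous_id fun k => by
      simp only [Function.comp_apply]
      rw [wignerDist_toDist h, wignerInvDist_toDist h, wignerInvCLM_wignerCLM, id]) K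

theorem wignerDist_wignerInvDist (h : IsGaugeField A) (K : 𝓢'(Phase D, Mat N)) :
    wignerDist A (wignerInvDist A K) = K :=
  congrFun (eq_of_forall_toDist ((wignerDist A).continuous.comp (wignerInvDist A).continuous)
    continuous_id fun k => by
      simp only [Function.comp_apply]
      rw [wignerInvDist_toDist h, wignerDist_toDist h, wignerCLM_wignerInvCLM, id]) K

theorem extendsWigner_wignerDist (h : IsGaugeField A) : ExtendsWigner A (wignerDist A) := by
  intro X k hk φ
  simp only [wignerTransform_eq h hk]
  exact (congrArg (fun T : 𝓢'(Phase D, Mat N) => T φ) (wignerDist_toDist h k)).trans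
    (toDist_apply _ _)

theorem ExtendsWigner.eq_wignerDist (h : IsGaugeField A)
    {W : 𝓢'(Phase D, Mat N) →L[ℂ] 𝓢'(Phase D, Mat N)} (hW : ExtendsWigner A W) :
    W = wignerDist A := by
  have : ⇑W = ⇑(wignerDist A) := eq_of_forall_toDist W.continuous (wignerDist A).continuous
    fun k => by
      ext1 φ
      exact (hW _ k (hasSchwartzKernel_kernelOp k) φ).trans
        (extendsWigner_wignerDist h _ k (hasSchwartzKernel_kernelOp k) φ).symm
  exact DFunLike.coe_injective this

theorem existsUnique_extendsWigner (h : IsGaugeField A) : ∃! W, ExtendsWigner A W :=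
  ⟨wignerDist A, extendsWigner_wignerDist h, fun _ hW => hW.eq_wignerDist h⟩

theorem weylSymbol_eq (h : IsGaugeField A) (X : TemperedOperator D N) :
    weylSymbol A X = wignerDist A X.kernel := by
  have hex := existsUnique_extendsWigner h
  have hW : ExtendsWigner A hex.choose := hex.choose_spec.1
  rw [weylSymbol, wignerExtension, dif_pos hex, hW.eq_wignerDist h]

end Symbols

section TemperedKernels

variable {D N : ℕ}

/-- The map `φ ↦ φ ⊗ g`. -/
def tensorRight (g : 𝓢(Space D, ℂ)) : 𝓢(Space D, ℂ) →L[ℂ] 𝓢(Phase D, ℂ) :=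
  (compCLMOfContinuousLinearEquiv ℂ (ContinuousLinearEquiv.prodComm ℝ (Space D) (Space D))).comp
    (tensorCLM g)

theorem tensorRight_apply (g φ : 𝓢(Space D, ℂ)) : tensorRight g φ = tensor φ g := by
  ext1 z
  exact mul_comm (g z.2) (φ z.1)

theorem tensorCLM_eq_tensor (g φ : 𝓢(Space D, ℂ)) : tensorCLM φ g = tensor φ g := rfl

/-- A component of a wave function. -/
def component (j : Fin N) : Wave D N →L[ℂ] 𝓢(Space D, ℂ) :=
  SchwartzMap.postcompCLM (EuclideanSpace.proj j : Inner N →L[ℂ] ℂ)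

theorem component_apply (j : Fin N) (f : Wave D N) (x : Space D) : component j f x = f x j := rfl

theorem sum_vecWave_component (f : Wave D N) :
    ∑ j, vecWave (component j f) (EuclideanSpace.single j 1) = f := by
  ext1 x
  rw [_root_.sum_apply]
  exact sum_smul_single (f x)

/-- The distribution `φ ↦ ∫ φ(x) K(x, x') f(x')`. -/
def kernelDist (K : 𝓢'(Phase D, Mat N)) (f : Wave D N) : 𝓢'(Space D, Inner N) :=
  ∑ j, PointwiseConvergenceCLM.postcomp 𝓢(Space D, ℂ)
    (ContinuousLinearMap.apply ℂ (Inner N) (EuclideanSpace.single j (1 : ℂ)))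
    (PointwiseConvergenceCLM.precomp (Mat N) (tensorRight (component j f)) K)

theorem kernelDist_apply (K : 𝓢'(Phase D, Mat N)) (f : Wave D N) (φ : 𝓢(Space D, ℂ)) :
    kernelDist K f φ =
      ∑ j, K (tensorCLM φ (component j f)) (EuclideanSpace.single j (1 : ℂ)) := by
  rw [kernelDist, sum_dist_apply]
  refine Finset.sum_congr rfl fun j _ => ?_
  rw [tensorCLM_eq_tensor, ← tensorRight_apply]
  rfl

/-- The operator with a given tempered kernel. -/
def kernelDistOp (K : 𝓢'(Phase D, Mat N)) : Wave D N →L[ℂ] 𝓢'(Space D, Inner N) where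
  toFun := kernelDist K
  map_add' f g := by
    ext1 φ
    change kernelDist K (f + g) φ = kernelDist K f φ + kernelDist K g φ
    simp only [kernelDist_apply, map_add, add_apply, Finset.sum_add_distrib]
  map_smul' c f := by
    ext1 φ
    change kernelDist K (c • f) φ = c • kernelDist K f φ
    simp only [kernelDist_apply, map_smul, smul_apply, Finset.smul_sum]
  cont := PointwiseConvergenceCLM.continuous_of_continuous_eval fun φ => by
    simp only [kernelDist_apply]
    exact continuous_finsetSum _ fun j _ =>
      (K.continuous.comp ((tensorCLM φ).continuous.comp (component j).continuous)).clm_apply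
        continuous_const

theorem hasTemperedKernel_kernelDistOp (K : 𝓢'(Phase D, Mat N)) :
    HasTemperedKernel (kernelDistOp K) K := by
  intro φ g v
  refine (kernelDist_apply K _ φ).trans ?_
  have h1 : ∀ j, tensorCLM φ (component j (vecWave g v)) = v j • tensor φ g := fun j => by
    ext1 z
    change φ z.1 * (g z.2 * v j) = v j * (φ z.1 * g z.2)
    ring
  simp only [h1, map_smul, smul_apply]
  conv_rhs => rw [← sum_smul_single v]
  simp only [map_sum, map_smul]

theorem HasTemperedKernel.eq_kernelDistOp {X : Wave D N →L[ℂ] 𝓢'(Space D, Inner N)}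
    {K : 𝓢'(Phase D, Mat N)} (h : HasTemperedKernel X K) : X = kernelDistOp K := by
  ext1 f; ext1 φ
  rw [← sum_vecWave_component f]
  simp only [map_sum, sum_dist_apply]
  refine Finset.sum_congr rfl fun j _ => ?_
  rw [h, hasTemperedKernel_kernelDistOp]

/-- A tempered kernel is determined by its values on tensor products. -/
theorem HasTemperedKernel.unique {X : Wave D N →L[ℂ] 𝓢'(Space D, Inner N)}
    {K K' : 𝓢'(Phase D, Mat N)} (h : HasTemperedKernel X K) (h' : HasTemperedKernel X K') :
    K = K' := by
  ext1 t
  refine mat_ext fun i j => ?_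
  set L : 𝓢(Phase D, ℂ) →L[ℂ] ℂ := (entryCLM i j).comp (K - K' : 𝓢(Phase D, ℂ) →L[ℂ] Mat N)
  have hL : ∀ t, L t = entry (K t) i j - entry (K' t) i j := fun t =>
    map_sub (entryCLM i j) (K t) (K' t)
  have h0 : L = 0 := eq_zero_of_tensor L fun t φ g ht => by
    have e : t = tensor φ g := by ext1 z; exact ht z
    rw [hL, e, entry, entry, ← h, ← h', sub_self]
  exact sub_eq_zero.1 ((hL t).symm.trans (congrArg (fun L : 𝓢(Phase D, ℂ) →L[ℂ] ℂ => L t) h0))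

/-- The operator with a given tempered kernel, as a bundled element. -/
def temperedOf (K : 𝓢'(Phase D, Mat N)) : TemperedOperator D N :=
  ⟨kernelDistOp K, K, hasTemperedKernel_kernelDistOp K⟩

theorem hasTemperedKernel_kernel (X : TemperedOperator D N) : HasTemperedKernel X.1 X.kernel :=
  X.2.choose_spec

theorem kernel_temperedOf (K : 𝓢'(Phase D, Mat N)) : (temperedOf K).kernel = K :=
  (hasTemperedKernel_kernel (temperedOf K)).unique (hasTemperedKernel_kernelDistOp K)

theorem bijective_weylSymbol {A : Fin D → Space D → Mat N} (h : IsGaugeField A) :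
    Function.Bijective (weylSymbol (D := D) (N := N) A) := by
  refine ⟨fun X X' hX => ?_, fun T => ⟨temperedOf (wignerInvDist A T), ?_⟩⟩
  · rw [weylSymbol_eq h, weylSymbol_eq h] at hX
    have hK : X.kernel = X'.kernel := by
      rw [← wignerInvDist_wignerDist h X.kernel, hX, wignerInvDist_wignerDist h]
    refine Subtype.ext ?_
    rw [(hasTemperedKernel_kernel X).eq_kernelDistOp, hK,
      ← (hasTemperedKernel_kernel X').eq_kernelDistOp]
  · rw [weylSymbol_eq h, kernel_temperedOf, wignerDist_wignerInvDist h]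

end TemperedKernels

/-! ### The Weyl integral of a tempered symbol -/

section Parseval

variable {D : ℕ} {W G F : Type}
  [NormedAddCommGroup W] [NormedSpace ℝ W] [NormedSpace ℂ W] [IsScalarTower ℝ ℂ W]
  [SMulCommClass ℝ ℂ W] [CompleteSpace W]
  [NormedAddCommGroup G] [NormedSpace ℝ G] [NormedSpace ℂ G] [IsScalarTower ℝ ℂ G]
  [SMulCommClass ℝ ℂ G] [CompleteSpace G]
  [NormedAddCommGroup F] [NormedSpace ℂ F] [CompleteSpace F]

theorem integral_apply_differenceTransform (ev : W →L[ℂ] G →L[ℂ] F) (L : F →L[ℂ] ℂ)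
    (Θ : 𝓢(Phase D, W)) (κ : 𝓢(Phase D, G)) :
    ∫ z : Phase D, ((((2 * Real.pi) ^ D)⁻¹ : ℝ) : ℂ) *
      L (ev (differenceTransform Θ z) (phaseIntegral κ z)) =
        L (∫ z : Phase D, ev (Θ z) (κ z)) := by
  rw [integral_const_mul]
  have h := (L.integral_comp_comm (integrable_ev ev (differenceTransform Θ)
    (phaseIntegral κ))).trans (congrArg L (integral_differenceTransform ev Θ κ))
  rw [← Complex.coe_smul, map_smul, smul_eq_mul] at h
  refine (congrArg _ h).trans ?_
  rw [← mul_assoc, ← Complex.ofReal_mul, inv_mul_cancel₀ (by positivity), Complex.ofReal_one,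
    one_mul]

end Parseval

section TemperedWeyl

variable {D N : ℕ} {A : Fin D → Space D → Mat N}

/-- The Schwartz function that is paired with the `(i, j)` entry of the symbol to give the `l`-th
component of a matrix element. -/
def symbolTest (h : IsGaugeField A) (ψ : Wave D N) (φ : 𝓢(Space D, ℂ)) (l i j : Fin N) :
    𝓢(Phase D, ℂ) :=
  (((((2 * Real.pi) ^ D)⁻¹ : ℝ) : ℂ)) • SchwartzMap.postcompCLM (𝕜 := ℂ)
    ((EuclideanSpace.proj l : Inner N →L[ℂ] ℂ).comp
      ((homEval (Mat N) (Inner N)).flip (matUnit i j))) (differenceTransform (weylTheta h φ ψ))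

theorem symbolTest_apply (h : IsGaugeField A) (ψ : Wave D N) (φ : 𝓢(Space D, ℂ)) (l i j : Fin N)
    (z : Phase D) : symbolTest h ψ φ l i j z = ((((2 * Real.pi) ^ D)⁻¹ : ℝ) : ℂ) *
      homEval (Mat N) (Inner N) (differenceTransform (weylTheta h φ ψ) z) (matUnit i j) l := rfl

theorem symbolTest_eq (h : IsGaugeField A) (ψ : Wave D N) (φ : 𝓢(Space D, ℂ)) (l i j : Fin N)
    (x p : Space D) : symbolTest h ψ φ l i j (x, p) = ((((2 * Real.pi) ^ (2 * D))⁻¹ : ℝ) : ℂ) *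
      (∫ w : Phase D, pair φ (weylIntegrand A w.1 w.2 x p (matUnit i j) ψ)) l := by
  rw [(integral_pair_weylIntegrand h ψ φ x p (matUnit i j)).2, symbolTest_apply,
    PiLp.smul_apply, Complex.real_smul, ← mul_assoc, ← Complex.ofReal_mul]
  have e : ((2 * Real.pi) ^ D)⁻¹ = ((2 * Real.pi) ^ (2 * D))⁻¹ * (2 * Real.pi) ^ D := by
    rw [two_mul D, pow_add]
    field_simp
  rw [e]

/-- The pairing with a Schwartz symbol: by Parseval's formula it is a matrix element. -/
theorem sum_entry_toDist_symbolTest (h : IsGaugeField A) (ψ : Wave D N) (φ : 𝓢(Space D, ℂ))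
    (l : Fin N) (k : 𝓢(Phase D, Mat N)) :
    ∑ i, ∑ j, entry (toDist (wignerCLM h k) (symbolTest h ψ φ l i j)) i j =
      (∫ z, matrixElement φ k ψ z) l := by
  obtain ⟨a, ha⟩ : ∃ a, a = phaseIntegral (sandwichCLM h.temperate_left h.temperate_right
    (compCLMOfContinuousLinearEquiv ℂ midEquiv k)) := ⟨_, rfl⟩
  have hak : wignerCLM h k = a := ha.symm
  simp only [hak]
  have hi : ∀ i j, Integrable fun z => symbolTest h ψ φ l i j z • a z := fun i j =>
    (SchwartzMap.smulLeftCLM (Mat N) (symbolTest h ψ φ l i j) a).integrable.congr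
      (.of_forall fun z => SchwartzMap.smulLeftCLM_apply_apply
        (symbolTest h ψ φ l i j).hasTemperateGrowth a z)
  have hi' : ∀ i j, Integrable fun z => entryCLM i j (symbolTest h ψ φ l i j z • a z) := fun i j =>
    (entryCLM i j).integrable_comp (hi i j)
  have h1 : ∀ i j, entry (toDist a (symbolTest h ψ φ l i j)) i j =
      ∫ z, entryCLM i j (symbolTest h ψ φ l i j z • a z) := fun i j => by
    rw [toDist_apply]
    exact ((entryCLM i j).integral_comp_comm (hi i j)).symm
  simp only [h1]
  simp only [← integral_finsetSum _ fun j _ => hi' _ j]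
  rw [← integral_finsetSum _ fun i _ => integrable_finsetSum _ fun j _ => hi' i j]
  have h2 : ∀ z, ∑ i, ∑ j, entryCLM i j (symbolTest h ψ φ l i j z • a z) =
      ((((2 * Real.pi) ^ D)⁻¹ : ℝ) : ℂ) * (EuclideanSpace.proj l : Inner N →L[ℂ] ℂ)
        (homEval (Mat N) (Inner N) (differenceTransform (weylTheta h φ ψ) z) (a z)) := fun z => by
    conv_rhs => rw [← sum_entry_smul_matUnit (a z)]
    simp only [map_sum, map_smul, Finset.mul_sum, symbolTest_apply, entryCLM_apply, smul_eq_mul]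
    refine Finset.sum_congr rfl fun i _ => Finset.sum_congr rfl fun j _ => ?_
    exact (mul_assoc _ _ _).trans (congrArg _ (mul_comm _ _))
  refine (integral_congr_ae (.of_forall h2)).trans ?_
  rw [← integral_weylTheta_apply h, ha]
  exact integral_apply_differenceTransform (homEval (Mat N) (Inner N)) (EuclideanSpace.proj l)
    (weylTheta h φ ψ) _

theorem kernelDist_toDist (k : 𝓢(Phase D, Mat N)) (ψ : Wave D N) (φ : 𝓢(Space D, ℂ)) :
    kernelDist (toDist k) ψ φ = ∫ z, matrixElement φ k ψ z := by
  have hi : ∀ j, Integrable fun z : Phase D => tensorCLM φ (component j ψ) z • k z := fun j =>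
    (SchwartzMap.smulLeftCLM (Mat N) (tensorCLM φ (component j ψ)) k).integrable.congr
      (.of_forall fun z => SchwartzMap.smulLeftCLM_apply_apply
        (tensorCLM φ (component j ψ)).hasTemperateGrowth k z)
  have h1 : ∀ j : Fin N, toDist k (tensorCLM φ (component j ψ)) (EuclideanSpace.single j (1 : ℂ)) =
      ∫ z, (tensorCLM φ (component j ψ) z • k z) (EuclideanSpace.single j (1 : ℂ)) := fun j => by
    rw [toDist_apply]
    exact ((ContinuousLinearMap.apply ℂ (Inner N)
      (EuclideanSpace.single j (1 : ℂ))).integral_comp_comm (hi j)).symm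
  rw [kernelDist_apply]
  simp only [h1]
  have hi' : ∀ j, Integrable fun z : Phase D =>
      (tensorCLM φ (component j ψ) z • k z) (EuclideanSpace.single j (1 : ℂ)) := fun j =>
    (ContinuousLinearMap.apply ℂ (Inner N)
      (EuclideanSpace.single j (1 : ℂ))).integrable_comp (hi j)
  refine (integral_finsetSum _ fun j _ => hi' j).symm.trans ?_
  refine integral_congr_ae (.of_forall fun z => ?_)
  simp only [matrixElement_apply]
  conv_rhs => rw [← sum_smul_single (ψ z.2)]
  simp only [map_sum, map_smul, Finset.smul_sum, tensorCLM_apply, component_apply, smul_apply,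
    smul_smul, smul_eq_mul]

theorem continuous_dist_apply {E F : Type} [NormedAddCommGroup E] [NormedSpace ℝ E]
    [NormedAddCommGroup F] [NormedSpace ℂ F] (t : 𝓢(E, ℂ)) : Continuous fun K : 𝓢'(E, F) => K t :=
  (PointwiseConvergenceCLM.evalCLM (RingHom.id ℂ) F t).continuous

theorem continuous_kernelDist (ψ : Wave D N) (φ : 𝓢(Space D, ℂ)) :
    Continuous fun K : 𝓢'(Phase D, Mat N) => kernelDist K ψ φ := by
  simp only [kernelDist_apply]
  exact continuous_finsetSum _ fun j _ => (continuous_dist_apply _).clm_apply continuous_const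

/-- The matrix elements of a tempered kernel are pairings with its symbol: both sides are weakly
continuous in the kernel and agree on Schwartz kernels. -/
theorem kernelDist_eq_sum (h : IsGaugeField A) (ψ : Wave D N) (φ : 𝓢(Space D, ℂ)) (l : Fin N)
    (K : 𝓢'(Phase D, Mat N)) :
    kernelDist K ψ φ l =
      ∑ i, ∑ j, entry (wignerDist A K (symbolTest h ψ φ l i j)) i j := by
  refine congrFun (eq_of_forall_toDist (f := fun K => kernelDist K ψ φ l)
    (g := fun K => ∑ i, ∑ j, entry (wignerDist A K (symbolTest h ψ φ l i j)) i j) ?_ ?_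
    fun k => ?_) K
  · exact (EuclideanSpace.proj l : Inner N →L[ℂ] ℂ).continuous.comp (continuous_kernelDist ψ φ)
  · exact continuous_finsetSum _ fun i _ => continuous_finsetSum _ fun j _ =>
      (entryCLM i j).continuous.comp
        (Continuous.comp (g := fun T : 𝓢'(Phase D, Mat N) => T (symbolTest h ψ φ l i j))
          (f := wignerDist A) (continuous_dist_apply _) (wignerDist A).continuous)
  · simp only [kernelDist_toDist, wignerDist_toDist h, sum_entry_toDist_symbolTest]

/-- The Weyl integral inverts the Wigner transform on operators with a tempered kernel: by density,
this is the case of Schwartz kernels. -/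
theorem isTemperedWeylIntegral (h : IsGaugeField A) (X : TemperedOperator D N) :
    IsTemperedWeylIntegral A (weylSymbol A X) X.1 := by
  intro ψ φ l
  refine ⟨symbolTest h ψ φ l, fun i j x p => ⟨(integral_pair_weylIntegrand h ψ φ x p _).1,
    symbolTest_eq h ψ φ l i j x p⟩, ?_⟩
  rw [weylSymbol_eq h, ← kernelDist_eq_sum, (hasTemperedKernel_kernel X).eq_kernelDistOp]
  rfl

end TemperedWeyl

/-! ### Gauge transformations -/

section GaugeAlgebra

variable {D : ℕ} {𝔸 : Type} [CStarAlgebra 𝔸] {A : Fin D → Space D → 𝔸} {Ω : Space D → 𝔸}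

theorem hasTemperateGrowth_star {E : Type} [NormedAddCommGroup E] [NormedSpace ℝ E] {f : E → 𝔸}
    (hf : f.HasTemperateGrowth) : (fun z => star (f z)).HasTemperateGrowth :=
  (starL' ℝ : 𝔸 ≃L[ℝ] 𝔸).toContinuousLinearMap.hasTemperateGrowth.comp hf

/-- The gauge transform of a gauge field with values in a C⋆-algebra. For matrices it is
`gaugeField` by definition. -/
def gaugeTransform (Ω : Space D → 𝔸) (A : Fin D → Space D → 𝔸) (μ : Fin D) (x : Space D) : 𝔸 :=
  Ω x * A μ x * star (Ω x) +
    Complex.I • (Ω x * fderiv ℝ (fun z => star (Ω z)) x (EuclideanSpace.single μ (1 : ℝ)))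

theorem isGaugeField_gaugeTransform (h : IsGaugeField A) (hΩ : Ω.HasTemperateGrowth)
    (hu : ∀ x, Ω x * star (Ω x) = 1) : IsGaugeField (gaugeTransform Ω A) := by
  have hs := hasTemperateGrowth_star hΩ
  refine ⟨fun μ => ?_, fun μ x => ?_⟩
  · have h1 : (fun x => fderiv ℝ (fun z => star (Ω z)) x
        (EuclideanSpace.single μ (1 : ℝ))).HasTemperateGrowth :=
      (ContinuousLinearMap.apply ℝ 𝔸 (EuclideanSpace.single μ (1 : ℝ))).hasTemperateGrowth.comp
        (HasTemperateGrowth.fderiv hs)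
    exact ((hΩ.mul (h.temperate μ)).mul hs).add
      ((Function.HasTemperateGrowth.const Complex.I).smul (hΩ.mul h1))
  · have hd : Differentiable ℝ Ω := hΩ.1.differentiable (by simp)
    have hd' : HasFDerivAt (fun z => star (Ω z))
        ((starL' ℝ : 𝔸 ≃L[ℝ] 𝔸).toContinuousLinearMap.comp (fderiv ℝ Ω x)) x :=
      (starL' ℝ : 𝔸 ≃L[ℝ] 𝔸).toContinuousLinearMap.hasFDerivAt.comp x (hd x).hasFDerivAt
    set v : Space D := EuclideanSpace.single μ (1 : ℝ)
    have h2 : fderiv ℝ (fun z => star (Ω z)) x v = star (fderiv ℝ Ω x v) := by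
      rw [hd'.fderiv]; rfl
    -- the derivative of `Ω Ω† = 1`
    have h3 : Ω x * star (fderiv ℝ Ω x v) + fderiv ℝ Ω x v * star (Ω x) = 0 := by
      have e1 := ((hd x).hasFDerivAt.mul' hd').fderiv
      have e2 : (Ω * fun z => star (Ω z)) = fun _ => 1 := funext hu
      rw [e2, fderiv_fun_const] at e1
      have e3 := congrArg (fun L : Space D →L[ℝ] 𝔸 => L v) e1
      exact e3.symm
    rw [isSelfAdjoint_iff, gaugeTransform, h2]
    simp only [star_add, star_mul, star_star, star_smul, (h.selfAdjoint μ x).star_eq, mul_assoc]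
    rw [← eq_neg_iff_add_eq_zero] at h3
    rw [h3, smul_neg, ← neg_smul]
    congr 2
    simp

/-- The inhomogeneous term of the gauge transformation is linear in the direction. -/
theorem connection_gaugeTransform (x v : Space D) :
    connection (gaugeTransform Ω A) x v = Ω x * connection A x v * star (Ω x) +
      Ω x * fderiv ℝ (fun z => star (Ω z)) x v := by
  set L := fderiv ℝ (fun z => star (Ω z)) x
  have hL : L v = ∑ μ, ((v μ : ℝ) : ℂ) • L (EuclideanSpace.single μ 1) := by
    conv_lhs => rw [← (EuclideanSpace.basisFun (Fin D) ℝ).sum_repr v]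
    simp only [map_sum, map_smul, EuclideanSpace.basisFun_repr, EuclideanSpace.basisFun_apply,
      Complex.coe_smul]
  have h1 : ∀ μ, ((v μ : ℝ) : ℂ) • gaugeTransform Ω A μ x =
      Ω x * (((v μ : ℝ) : ℂ) • A μ x) * star (Ω x) +
        Complex.I • (Ω x * (((v μ : ℝ) : ℂ) • L (EuclideanSpace.single μ 1))) := fun μ => by
    rw [gaugeTransform, smul_add, smul_comm _ Complex.I]
    simp only [mul_smul_comm, smul_mul_assoc]
    rfl
  simp only [connection, h1, Finset.sum_add_distrib]
  rw [← Finset.smul_sum, ← Finset.mul_sum, ← Finset.sum_mul, ← Finset.mul_sum, ← hL, smul_add,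
    smul_smul, Complex.I_mul_I]
  simp only [neg_add, mul_neg, neg_mul, mul_smul_comm, smul_mul_assoc, neg_smul, one_smul, neg_neg]

end GaugeAlgebra

section Covariance

variable {D N : ℕ} {A : Fin D → Space D → Mat N} {Ω : Space D → Mat N}

theorem isGaugeField_gaugeField (h : IsGaugeField A) (hΩ : IsGauge Ω) :
    IsGaugeField (gaugeField Ω A) :=
  isGaugeField_gaugeTransform h hΩ.temperate fun x => Unitary.mul_star_self_of_mem (hΩ.unitary x)

theorem IsGauge.star_mul (hΩ : IsGauge Ω) (x : Space D) : star (Ω x) * Ω x = 1 :=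
  Unitary.star_mul_self_of_mem (hΩ.unitary x)

theorem IsGauge.mul_star (hΩ : IsGauge Ω) (x : Space D) : Ω x * star (Ω x) = 1 :=
  Unitary.mul_star_self_of_mem (hΩ.unitary x)

theorem IsGauge.temperate_star (hΩ : IsGauge Ω) : Function.HasTemperateGrowth fun x => star (Ω x) :=
  hasTemperateGrowth_star hΩ.temperate

theorem IsGauge.temperate_fst (hΩ : IsGauge Ω) :
    Function.HasTemperateGrowth fun z : Phase D => Ω z.1 :=
  hΩ.temperate.comp hasTemperateGrowth_fst

theorem IsGauge.temperate_star_fst (hΩ : IsGauge Ω) :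
    Function.HasTemperateGrowth fun z : Phase D => star (Ω z.1) :=
  hΩ.temperate_star.comp hasTemperateGrowth_fst

theorem IsGauge.temperate_star_snd (hΩ : IsGauge Ω) :
    Function.HasTemperateGrowth fun z : Phase D => star (Ω z.2) :=
  hΩ.temperate_star.comp hasTemperateGrowth_snd

theorem transport_gaugeField (h : IsGaugeField A) (hΩ : IsGauge Ω) (x v : Space D) :
    (transport (gaugeField Ω A) x v : Mat N) = Ω x * transport A x v * star (Ω (x + v)) :=
  transport_gauge h (isGaugeField_gaugeField h hΩ) (hΩ.temperate.1.differentiable (by simp))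
    hΩ.mul_star (fun x v => connection_gaugeTransform x v) x v

/-- The kernel `Ω(x) k(x, x') Ω(x')†`. -/
def gaugeKernel (hΩ : IsGauge Ω) : 𝓢(Phase D, Mat N) →L[ℂ] 𝓢(Phase D, Mat N) :=
  sandwichCLM hΩ.temperate_fst hΩ.temperate_star_snd

/-- The symbol `Ω(x) a(x, p) Ω(x)†`. -/
def gaugeSymbol (hΩ : IsGauge Ω) : 𝓢(Phase D, Mat N) →L[ℂ] 𝓢(Phase D, Mat N) :=
  sandwichCLM hΩ.temperate_fst hΩ.temperate_star_fst

theorem gaugeKernel_apply (hΩ : IsGauge Ω) (k : 𝓢(Phase D, Mat N)) (z : Phase D) :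
    gaugeKernel hΩ k z = Ω z.1 * k z * star (Ω z.2) := rfl

theorem gaugeSymbol_apply (hΩ : IsGauge Ω) (k : 𝓢(Phase D, Mat N)) (z : Phase D) :
    gaugeSymbol hΩ k z = Ω z.1 * k z * star (Ω z.1) := rfl

theorem HasSchwartzKernel.gauge {X : Op D N} {k : 𝓢(Phase D, Mat N)} (hk : HasSchwartzKernel X k)
    (hΩ : IsGauge Ω) : HasSchwartzKernel
      ((mulOp Ω).comp (X.comp (mulOp fun z => star (Ω z)))) (gaugeKernel hΩ k) := by
  intro f x
  simp only [ContinuousLinearMap.comp_apply]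
  rw [mulOp_apply hΩ.temperate, hk]
  refine ((Ω x).integral_comp_comm (integrable_kernel_apply k _ x)).symm.trans ?_
  refine integral_congr_ae (.of_forall fun x' => ?_)
  simp only [mulOp_apply hΩ.temperate_star]
  rfl

theorem mul_sandwich_mul {a b k c d u v : Mat N} (hu : star u * u = 1) (hv : star v * v = 1) :
    (a * b * star u) * (u * k * star v) * (v * c * d) = a * (b * k * c) * d := by
  calc _ = a * b * (star u * u) * k * (star v * v) * c * d := by simp only [mul_assoc]
    _ = _ := by rw [hu, hv]; simp only [mul_assoc, mul_one]

/-- The symbol map is gauge covariant: the transports to the midpoint conjugate `Ω` at the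
arguments of the kernel into `Ω` at the midpoint. -/
theorem wignerCLM_gaugeKernel (h : IsGaugeField A) (hΩ : IsGauge Ω)
    (h' : IsGaugeField (gaugeField Ω A)) (k : 𝓢(Phase D, Mat N)) :
    wignerCLM h' (gaugeKernel hΩ k) = gaugeSymbol hΩ (wignerCLM h k) := by
  have hs : ∀ x y, sandwichCLM h'.temperate_left h'.temperate_right
      (compCLMOfContinuousLinearEquiv ℂ midEquiv (gaugeKernel hΩ k)) (x, y) =
      ContinuousLinearMap.mulLeftRight ℂ (Mat N) (Ω x) (star (Ω x))
        (sandwichCLM h.temperate_left h.temperate_right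
          (compCLMOfContinuousLinearEquiv ℂ midEquiv k) (x, y)) := fun x y => by
    have h1 : transportLeft (gaugeField Ω A) (x, y) =
        Ω x * transportLeft A (x, y) * star (Ω (x + -(1 / 2 : ℝ) • y)) :=
      transport_gaugeField h hΩ _ _
    have h2 : transportRight (gaugeField Ω A) (x, y) =
        Ω (x + (1 / 2 : ℝ) • y) * transportRight A (x, y) * star (Ω x) := by
      have e := transport_gaugeField h hΩ (x + (1 / 2 : ℝ) • y) (-(1 / 2 : ℝ) • y)
      rw [add_assoc, ← add_smul, add_neg_cancel, zero_smul, add_zero] at e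
      exact e
    rw [sandwichCLM_apply, sandwichCLM_apply, h1, h2]
    exact mul_sandwich_mul (hΩ.star_mul _) (hΩ.star_mul _)
  ext1 ⟨x, p⟩
  rw [gaugeSymbol_apply]
  simp only [wignerCLM, ContinuousLinearMap.comp_apply, phaseIntegral_apply, hs]
  have hi := (ContinuousLinearMap.mulLeftRight ℂ (Mat N) (Ω x) (star (Ω x))).integral_comp_comm
    (integrable_phaseIntegral (sandwichCLM h.temperate_left h.temperate_right
      (compCLMOfContinuousLinearEquiv ℂ midEquiv k)) x p)
  simp only [map_smul] at hi
  exact hi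

theorem wignerTransform_gauge (h : IsGaugeField A) (hΩ : IsGauge Ω) {X : Op D N}
    {k : 𝓢(Phase D, Mat N)} (hk : HasSchwartzKernel X k) (x p : Space D) :
    wignerTransform (gaugeField Ω A) ((mulOp Ω).comp (X.comp (mulOp fun z => star (Ω z)))) x p =
      Ω x * wignerTransform A X x p * star (Ω x) := by
  rw [wignerTransform_eq (isGaugeField_gaugeField h hΩ) (hk.gauge hΩ), wignerTransform_eq h hk,
    wignerCLM_gaugeKernel h hΩ, gaugeSymbol_apply]

/-- The distribution kernel `Ω(x) K(x, x') Ω(x')†`. -/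
def gaugeKernelDist (Ω : Space D → Mat N) : 𝓢'(Phase D, Mat N) →L[ℂ] 𝓢'(Phase D, Mat N) :=
  sandwichDist (fun z => Ω z.1) fun z => star (Ω z.2)

/-- The tempered symbol `Ω(x) T(x, p) Ω(x)†`. -/
def gaugeSymbolDist (Ω : Space D → Mat N) : 𝓢'(Phase D, Mat N) →L[ℂ] 𝓢'(Phase D, Mat N) :=
  sandwichDist (fun z => Ω z.1) fun z => star (Ω z.1)

theorem gaugeKernelDist_toDist (hΩ : IsGauge Ω) (k : 𝓢(Phase D, Mat N)) :
    gaugeKernelDist Ω (toDist k) = toDist (gaugeKernel hΩ k) :=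
  sandwichDist_toDist hΩ.temperate_fst hΩ.temperate_star_snd k

theorem gaugeSymbolDist_toDist (hΩ : IsGauge Ω) (k : 𝓢(Phase D, Mat N)) :
    gaugeSymbolDist Ω (toDist k) = toDist (gaugeSymbol hΩ k) :=
  sandwichDist_toDist hΩ.temperate_fst hΩ.temperate_star_fst k

theorem gaugeSymbolDist_apply (Ω : Space D → Mat N) (T : 𝓢'(Phase D, Mat N)) (φ : 𝓢(Phase D, ℂ)) :
    gaugeSymbolDist Ω T φ = adjointAction Ω T φ := sandwichDist_apply _ _ T φ

theorem wignerDist_gaugeKernelDist (h : IsGaugeField A) (hΩ : IsGauge Ω) (K : 𝓢'(Phase D, Mat N)) :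
    wignerDist (gaugeField Ω A) (gaugeKernelDist Ω K) = gaugeSymbolDist Ω (wignerDist A K) :=
  congrFun (eq_of_forall_toDist
    (f := fun K => wignerDist (gaugeField Ω A) (gaugeKernelDist Ω K))
    (g := fun K => gaugeSymbolDist Ω (wignerDist A K))
    (Continuous.comp (g := wignerDist (gaugeField Ω A)) (f := gaugeKernelDist Ω)
      (wignerDist _).continuous (gaugeKernelDist Ω).continuous)
    (Continuous.comp (g := gaugeSymbolDist Ω) (f := wignerDist A)
      (gaugeSymbolDist Ω).continuous (wignerDist A).continuous) fun k => by
      have h' := isGaugeField_gaugeField h hΩ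
      simp only [gaugeKernelDist_toDist hΩ, wignerDist_toDist h, wignerDist_toDist h',
        gaugeSymbolDist_toDist hΩ, wignerCLM_gaugeKernel h hΩ h']) K

theorem distMul_kernelDist (hΩ : IsGauge Ω) (ψ : Wave D N) (φ : 𝓢(Space D, ℂ))
    (K : 𝓢'(Phase D, Mat N)) :
    kernelDist (gaugeKernelDist Ω K) (mulOp Ω ψ) φ = distMul Ω (kernelDist K ψ) φ := by
  refine congrFun (eq_of_forall_toDist
    (f := fun K => kernelDist (gaugeKernelDist Ω K) (mulOp Ω ψ) φ)
    (g := fun K => distMul Ω (kernelDist K ψ) φ) ?_ ?_ fun k => ?_) K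
  · exact Continuous.comp (g := fun K => kernelDist K (mulOp Ω ψ) φ) (f := gaugeKernelDist Ω)
      (continuous_kernelDist _ φ) (gaugeKernelDist Ω).continuous
  · exact continuous_finsetSum _ fun i _ => continuous_finsetSum _ fun j _ =>
      (matUnit i j).continuous.comp (continuous_kernelDist ψ _)
  · simp only [gaugeKernelDist_toDist hΩ, distMul, kernelDist_toDist]
    set χ : Fin N → Fin N → 𝓢(Space D, ℂ) := fun i j =>
      SchwartzMap.smulLeftCLM ℂ (fun x => entry (Ω x) i j) φ
    have hχ : ∀ i j x, χ i j x = entry (Ω x) i j * φ x := fun i j x =>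
      SchwartzMap.smulLeftCLM_apply_apply (hasTemperateGrowth_entry hΩ.temperate i j) φ x
    have h1 : ∀ i j, matUnit i j (∫ z, matrixElement (χ i j) k ψ z) =
        ∫ z, matUnit i j (matrixElement (χ i j) k ψ z) := fun i j =>
      ((matUnit i j).integral_comp_comm (matrixElement (χ i j) k ψ).integrable).symm
    have hi : ∀ i j, Integrable fun z => matUnit i j (matrixElement (χ i j) k ψ z) := fun i j =>
      (matUnit i j).integrable_comp (matrixElement (χ i j) k ψ).integrable
    refine Eq.trans ?_ (Finset.sum_congr rfl fun i _ => Finset.sum_congr rfl fun j _ =>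
      (h1 i j).symm)
    simp only [← integral_finsetSum _ fun j _ => hi _ j]
    rw [← integral_finsetSum _ fun i _ => integrable_finsetSum _ fun j _ => hi i j]
    refine integral_congr_ae (.of_forall fun z => ?_)
    simp only [matrixElement_apply, hχ, gaugeKernel_apply, mulOp_apply hΩ.temperate, map_smul]
    have e1 : (Ω z.1 * k z * star (Ω z.2)) (Ω z.2 (ψ z.2)) = Ω z.1 (k z (ψ z.2)) := by
      change Ω z.1 (k z ((star (Ω z.2) * Ω z.2) (ψ z.2))) = _
      rw [hΩ.star_mul]
      rfl
    rw [e1]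
    conv_lhs => rw [← sum_entry_smul_matUnit (Ω z.1)]
    simp only [_root_.sum_apply, smul_apply, Finset.smul_sum, smul_smul]
    refine Finset.sum_congr rfl fun i _ => Finset.sum_congr rfl fun j _ => ?_
    rw [mul_comm]

/-- Gauge covariance for operators with a tempered kernel. -/
theorem exists_gauge_temperedOperator (h : IsGaugeField A) (hΩ : IsGauge Ω)
    (X : TemperedOperator D N) : ∃ X' : TemperedOperator D N,
      (∀ ψ φ, X'.1 (mulOp Ω ψ) φ = distMul Ω (X.1 ψ) φ) ∧
      ∀ φ, weylSymbol (gaugeField Ω A) X' φ = adjointAction Ω (weylSymbol A X) φ := by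
  refine ⟨temperedOf (gaugeKernelDist Ω X.kernel), fun ψ φ => ?_, fun φ => ?_⟩
  · rw [(hasTemperedKernel_kernel X).eq_kernelDistOp]
    exact distMul_kernelDist hΩ ψ φ X.kernel
  · rw [weylSymbol_eq (isGaugeField_gaugeField h hΩ), weylSymbol_eq h, kernel_temperedOf,
      wignerDist_gaugeKernelDist h hΩ, gaugeSymbolDist_apply]

end Covariance

end GaugeWeyl

end

open GaugeWeyl in
theorem theorem1 (D N : ℕ) (A : Fin D → Space D → Mat N)
    (hA : ∀ μ, (A μ).HasTemperateGrowth) (hA' : ∀ μ x, IsSelfAdjoint (A μ x)) :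
    -- all the exponentials of operators exist
    (∀ y, HasExp (-(Complex.I / 2) • dotOp y (covMomentum A) 0)) ∧
    (∀ y p, HasExp ((Complex.I / 2) • dotOp y (covMomentum A) p)) ∧
    (∀ q x : Space D, HasExp (Complex.I • dotOp (N := N) q position x)) ∧
    -- operators with a Schwartz kernel: the transform converges, has a Schwartz symbol,
    -- and is inverted by the Weyl integral
    (∀ X : Op D N, (∃ k, HasSchwartzKernel X k) →
      (∀ x p, MeasureTheory.Integrable (wignerIntegrand A X x p)) ∧
      (∃ a : SchwartzMap (Phase D) (Mat N), ∀ x p, a (x, p) = wignerTransform A X x p) ∧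
      IsWeylIntegral A (wignerTransform A X) X) ∧
    -- every Schwartz symbol comes from exactly one such operator
    (∀ a : SchwartzMap (Phase D) (Mat N), ∃! X : Op D N,
      (∃ k, HasSchwartzKernel X k) ∧ ∀ x p, wignerTransform A X x p = a (x, p)) ∧
    -- the transform extends uniquely to operators with a tempered kernel, is inverted by the
    -- Weyl integral and is a bijection onto the tempered symbols
    (∃! W, ExtendsWigner A W) ∧
    (∀ X : TemperedOperator D N, IsTemperedWeylIntegral A (weylSymbol A X) X.1) ∧
    Function.Bijective (weylSymbol (D := D) (N := N) A) ∧
    -- the symbols transform in the adjoint representation under gauge transformations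
    (∀ Ω : Space D → Mat N, IsGauge Ω →
      (∀ X : Op D N, (∃ k, HasSchwartzKernel X k) → ∀ x p,
        wignerTransform (gaugeField Ω A)
            ((mulOp Ω).comp (X.comp (mulOp fun z => star (Ω z)))) x p =
          Ω x * wignerTransform A X x p * star (Ω x)) ∧
      (∀ X : TemperedOperator D N, ∃ X' : TemperedOperator D N,
        (∀ ψ φ, X'.1 (mulOp Ω ψ) φ = distMul Ω (X.1 ψ) φ) ∧
        ∀ φ, weylSymbol (gaugeField Ω A) X' φ = adjointAction Ω (weylSymbol A X) φ)) := by
  have h := IsGaugeField.of_mat hA hA'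
  refine ⟨hasExp_wigner h, hasExp_weyl h, fun q x => (hasExp_dotOp_position q x).1, ?_,
    existsUnique_wignerTransform h, existsUnique_extendsWigner h, isTemperedWeylIntegral h,
    bijective_weylSymbol h, fun Ω hΩ => ⟨?_, exists_gauge_temperedOperator h hΩ⟩⟩
  · rintro X ⟨k, hk⟩
    exact ⟨integrable_wignerIntegrand h hk,
      ⟨wignerCLM h k, fun x p => (wignerTransform_eq h hk x p).symm⟩, isWeylIntegral h hk⟩
  · rintro X ⟨k, hk⟩ x p
    exact wignerTransform_gauge h hΩ hk x p
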